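/- **Setting.** Let $r\ge 2$, $n_o\ge 1$, $0<\delta<1$. Let $\mathcal U_1,\dots,\mathcal U_m$ be $d$-dimensional subspaces of $\mathbb R^{M_1}$ whose sum is direct, and let $\mathcal U=\mathcal U_1\oplus\cdots\oplus\mathcal U_m$, $\dim\mathcal U=r$. Let $\mathbf D=[\mathbf B\ \mathbf A_1\ \cdots\ \mathbf A_m]$ be a random matrix with independent columns: the $n_o$ columns $\mathbf b_1,\dots,\mathbf b_{n_o}$ of $\mathbf B$ (the outliers) are uniformly distributed on the unit sphere $\mathbb S^{M_1-1}$, and the $n_{i_k}$ columns of $\mathbf A_k$ (the inliers of the $k$-th cluster) are uniformly distributed on $\mathcal U_k\cap\mathbb S^{M_1-1}$, where $n_{i_k}>d$ for every $k$. For a column $\mathbf d_j$ of $\mathbf D$ let $\mathbf c_j^*$ be an optimal point of $$\min_{\mathbf c}\ \|\mathbf c^T\mathbf D\|_1\quad\text{subject to}\quad \mathbf c^T\mathbf d_j=1,$$ and call $1/\|\mathbf D^T\mathbf c_j^*\|_1$ the Innovation Value of $\mathbf d_j$. Writing $\mathbf c_1^*,\dots,\mathbf c_{n_o}^*$ for the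 optimal points that belong to the outliers, put $$\chi=\max_{j\le n_o}\|\mathbf c_j^*\|_2,\qquad n_z'=\max_{j\le n_o}\bigl|\{i\le n_o:\ (\mathbf c_j^*)^T\mathbf b_i=0\}\bigr| .$$ With $\mathbf U_k$ an orthonormal basis of $\mathcal U_k$, let $$g=\arg\min_k\ \inf_{\mathbf u\in\mathcal U_k,\ \|\mathbf u\|=1}\|\mathbf u^T\mathbf A_k\|_1,\qquad n_g=n_{i_g},\qquad \rho=\inf_{\mathbf u\in\mathcal U,\ \|\mathbf u\|=1}\ \sum_{k=1}^m\|\mathbf u^T\mathbf U_k\|_2,$$ $$\mathcal A=\rho\left(\sqrt{\tfrac2\pi}\,\frac{n_g}{\sqrt d}-2\sqrt{n_g}-\sqrt{\frac{2n_g\log\frac1\delta}{r-1}}\right),$$ $$\sqrt{c_\delta}=3\max\left(1,\sqrt{\tfrac{8M_1\pi}{(M_1-1)r}},\sqrt{\tfrac{8M_1\log (n_o/\delta)}{(M_1-1)r}}\right),\qquad \sqrt{c_\delta''}=3\max\left(1,\sqrt{\tfrac{8M_1\pi}{M_1-1}},\sqrt{\tfrac{16M_1\log (n_o/\delta)}{M_1-1}}\right),$$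 $$\eta_\delta=\max\left(\tfrac43\log\tfrac{2M_1}\delta,\ \sqrt{4\tfrac{n_o}{M_1}\log\tfrac{2M_1}\delta}\right),$$ and suppose $M_1>c_\delta r$. Consider the conditions $$\mathcal A>2n_z'\sqrt{\tfrac{c_\delta r}{M_1}}+2\sqrt{\tfrac{n_oc_\delta r\log (n_o/\delta)}{M_1}},$$ $$\mathcal A>\left[\tfrac{n_o}{M_1}+\sqrt{\tfrac{4n_o}{M_1}}+\sqrt{\tfrac{2n_o\log (1/\delta)}{(M_1-1)M_1}}+\sqrt{\tfrac{n_oc_\delta''\log (n_o/\delta)}{M_1^2}}+n_z'\sqrt{\tfrac{c_\delta''}{M_1^2}}+\sqrt{\tfrac{n_o\log (n_o/\delta)}{M_1^2}+\tfrac{\eta_\delta\log (n_o/\delta)}{M_1}}\right]\sqrt{\tfrac{4M_1c_\delta}{M_1-c_\delta r}},$$ $$\mathcal A>\chi\tfrac{n_o}{\sqrt{M_1}}+2\sqrt{n_o}\,(1+\sqrt\chi)+2\sqrt{\tfrac{2\chi n_o\log (1/\delta)}{M_1-1}}.$$ **Claim.** With probability at least $1-7\delta$ the following holds (for every choice of the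 optimal points $\mathbf c_j^*$ and of the minimizer $g$): if the three conditions are satisfied, then the Innovation Value of every outlier is strictly greater than the Innovation Value of every inlier, and $\mathcal U$ is recovered exactly, that is, if the columns of $\mathbf D$ are collected in the order of increasing Innovation Values (ties broken arbitrarily) until they span an $r$-dimensional subspace, then such a stage is reached and that subspace is $\mathcal U$. -/

import Mathlib

open MeasureTheory ProbabilityTheory

namespace ISearch

noncomputable section

/-- The ambient space `ℝ^M` with the Euclidean norm. -/
abbrev Amb (M : ℕ) : Type := EuclideanSpace ℝ (Fin M)

/-- The uniform probability measure on the unit sphere of a finite-dimensional Euclidean space `F`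
(normalized surface measure), viewed as a measure on `F`. -/
def uniformSphere (F : Type*) [NormedAddCommGroup F] [InnerProductSpace ℝ F]
    [FiniteDimensional ℝ F] [MeasurableSpace F] [BorelSpace F] : Measure F :=
  ((((volume : Measure F).toSphere Set.univ)⁻¹ • (volume : Measure F).toSphere)).map Subtype.val

/-- The uniform probability measure on the intersection of the unit sphere of `ℝ^M` with the
subspace `V`, viewed as a measure on `ℝ^M`. -/
def uniformSphereIn {M : ℕ} (V : Submodule ℝ (Amb M)) : Measure (Amb M) :=
  (uniformSphere V).map Subtype.val

/-- Index set of the columns of `D = [B A]`: the outliers, and the inliers of the `m` clusters,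
where the `k`-th cluster has `n k` members. -/
abbrev Col (no : ℕ) {m : ℕ} (n : Fin m → ℕ) : Type := Fin no ⊕ (Σ k : Fin m, Fin (n k))

/-- `‖Dᵀ c‖₁` for the matrix with columns `D i`. -/
def l1 {M : ℕ} {ι : Type*} [Fintype ι] (D : ι → Amb M) (c : Amb M) : ℝ :=
  ∑ i, |inner ℝ c (D i)|

/-- `c` is an optimal point of: minimize `‖cᵀ D‖₁` subject to `cᵀ d = 1`. -/
def IsOptimalDirection {M : ℕ} {ι : Type*} [Fintype ι] (D : ι → Amb M) (d c : Amb M) : Prop :=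
  inner ℝ c d = 1 ∧ ∀ c' : Amb M, inner ℝ c' d = 1 → l1 D c ≤ l1 D c'

/-- The Innovation Value `1 / ‖Dᵀ c‖₁` belonging to an optimal direction `c`. -/
def innovationValue {M : ℕ} {ι : Type*} [Fintype ι] (D : ι → Amb M) (c : Amb M) : ℝ :=
  1 / l1 D c

/-- The span of the first `N` columns of `D` in the order given by `e`. -/
def prefixSpan {M : ℕ} {ι : Type*} [Fintype ι] (D : ι → Amb M)
    (e : Fin (Fintype.card ι) ≃ ι) (N : ℕ) : Submodule ℝ (Amb M) :=
  Submodule.span ℝ (D '' (e '' {i | i.val < N}))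

/-- Exact recovery of the subspace `W`: sort the columns by increasing Innovation Values `x`
(ties broken arbitrarily) and collect columns in this order until they span a subspace of dimension
`r`; such a stage is reached, and the subspace found is `W`. -/
def RecoversExactly {M : ℕ} {ι : Type*} [Fintype ι] (D : ι → Amb M) (x : ι → ℝ) (r : ℕ)
    (W : Submodule ℝ (Amb M)) : Prop :=
  ∀ e : Fin (Fintype.card ι) ≃ ι, Monotone (x ∘ e) →
    (∃ N, Module.finrank ℝ (prefixSpan D e N) = r) ∧
    ∀ N, Module.finrank ℝ (prefixSpan D e N) = r → prefixSpan D e N = W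

/-- `inf_{δ ∈ V, ‖δ‖ = 1} ‖δᵀ A‖₁` for the matrix with columns `A i`. -/
def permeance {M : ℕ} {ι : Type*} [Fintype ι] (V : Submodule ℝ (Amb M)) (A : ι → Amb M) : ℝ :=
  ⨅ δ : {δ : Amb M // δ ∈ V ∧ ‖δ‖ = 1}, l1 A δ.1

/-- `ρ = inf_{δ ∈ U, ‖δ‖ = 1} ∑ₖ ‖δᵀ Uₖ‖₂`, where `U` is the sum of the `Uₖ`. The coherence
`‖δᵀ Uₖ‖₂` of `δ` with (an orthonormal basis of) `Uₖ` is the norm of the orthogonal projection of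
`δ` onto `Uₖ`. -/
def rho {M m : ℕ} (U : Fin m → Submodule ℝ (Amb M)) : ℝ :=
  ⨅ δ : {δ : Amb M // δ ∈ (⨆ k, U k) ∧ ‖δ‖ = 1}, ∑ k, ‖(U k).starProjection δ.1‖

/-- The quantity `𝒜 = ρ (√(2/π) n_g/√d - 2 √n_g - √(2 n_g log(1/δ) / (r-1)))`. -/
def calA (ρ : ℝ) (d r ng : ℕ) (δ : ℝ) : ℝ :=
  ρ * (√(2 / Real.pi) * (ng / √(d : ℝ)) - 2 * √(ng : ℝ)
    - √(2 * ng * Real.log (1 / δ) / ((r : ℝ) - 1)))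

/-- `c_δ`. -/
def cDelta (M r no : ℕ) (δ : ℝ) : ℝ :=
  (3 * max 1 (max √(8 * M * Real.pi / (((M : ℝ) - 1) * r))
    √(8 * M * Real.log (no / δ) / (((M : ℝ) - 1) * r)))) ^ 2

/-- `c_δ''`. -/
def cDelta'' (M no : ℕ) (δ : ℝ) : ℝ :=
  (3 * max 1 (max √(8 * M * Real.pi / ((M : ℝ) - 1))
    √(16 * M * Real.log (no / δ) / ((M : ℝ) - 1)))) ^ 2

/-- `η_δ`. -/
def etaDelta (M no : ℕ) (δ : ℝ) : ℝ :=
  max (4 / 3 * Real.log (2 * M / δ)) √(4 * (no / M) * Real.log (2 * M / δ))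

/-- The three sufficient conditions on `𝒜`, for given `n_z'` and `χ`. -/
def SufficientConditions (𝒜 : ℝ) (M r no nz : ℕ) (χ δ : ℝ) : Prop :=
  (𝒜 > 2 * nz * √(cDelta M r no δ * r / M)
      + 2 * √(no * cDelta M r no δ * r * Real.log (no / δ) / M)) ∧
  (𝒜 > (no / M + √(4 * no / M) + √(2 * no * Real.log (1 / δ) / (((M : ℝ) - 1) * M))
        + √(no * cDelta'' M no δ * Real.log (no / δ) / (M : ℝ) ^ 2)
        + nz * √(cDelta'' M no δ / (M : ℝ) ^ 2)
        + √(no * Real.log (no / δ) / (M : ℝ) ^ 2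
            + etaDelta M no δ * Real.log (no / δ) / M))
      * √(4 * M * cDelta M r no δ / (M - cDelta M r no δ * r))) ∧
  (𝒜 > χ * (no / √(M : ℝ)) + 2 * √(no : ℝ) * (1 + √χ)
      + 2 * √(2 * χ * no * Real.log (1 / δ) / ((M : ℝ) - 1)))

/-- `χ`: the largest norm of the optimal directions of the outliers. -/
def chi {M no m : ℕ} {n : Fin m → ℕ} (c : Col no n → Amb M) : ℝ :=
  ⨆ j : Fin no, ‖c (Sum.inl j)‖

open Classical in
/-- `n_z'`: the largest number of outliers that are orthogonal to the optimal direction of one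
outlier. -/
def nz {M no m : ℕ} {n : Fin m → ℕ} (D c : Col no n → Amb M) : ℕ :=
  Finset.univ.sup fun j : Fin no =>
    (Finset.univ.filter fun i : Fin no => inner ℝ (c (Sum.inl j)) (D (Sum.inl i)) = 0).card

end

end ISearch

/-! Call ‖Dᵀc‖₁ the value of a direction c. It suffices to find a number v such that every outlier
has a feasible direction of value at most v, while every feasible direction of every inlier has
value greater than v (`innovationValue_lt_and_recoversExactly`). Every inlier then precedes every
outlier in the order of Innovation Values, and a prefix whose span has dimension r must span 𝒰. Two
regimes are treated separately.

If n_o + r ≤ M, then v = 1 works almost surely. An outlier lies outside the span of 𝒰 and the other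
outliers, so some feasible direction annihilates every other column. An inlier lies in the span of
the other inliers of its cluster, so no feasible direction annihilates them all.

If n_o + r > M, then M > c_δ r gives M > 9r, hence n_o > 8M/9. Let P be the projection onto 𝒰ᗮ. For
an outlier b the direction Pb/‖Pb‖² annihilates the inliers, and concentration gives ‖Pb‖ ≥ √3/2 and
value at most 1 + (2/√3)T, where T is about √(2/π) n_o/√M. A feasible direction of an inlier has a
component of norm at least 1 in 𝒰, so its value is at least ρ times the smallest permeance, that of
cluster g. This permeance is at least √(2/π) n_g/√d - 2√n_g - 2√(2 n_g log(m/δ)/d).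

The deviation term here differs from the one in 𝒜. Let Z be 𝒜 without its deviation term, so that 𝒜
≤ Z. The deviation satisfies a quadratic inequality in terms of Z (`deviation_sq_le`). The first
condition makes Z large compared with log(n_o/δ), so the deviation is at most a fraction τZ. The
third condition gives Z ≥ n_o/√M + 4√n_o, and the remaining (1-τ)Z still exceeds the outlier value
(`outlier_bound_lt`).

The probabilistic input is that the uniform law on a d-dimensional sphere is subgaussian with proxy
1/d, by Jensen's inequality in the squared radius of a Gaussian vector. Symmetrization, contraction
and a χ² bound then give the uniform lower bound on the permeance
(`measure_exists_sum_abs_inner_le`). -/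

namespace ISearch

/-! ### Polar decomposition of the standard Gaussian measure -/

section GaussianPolar

variable {F : Type*} [NormedAddCommGroup F] [InnerProductSpace ℝ F] [FiniteDimensional ℝ F]
  [MeasurableSpace F] [BorelSpace F]

/-- A non-integrable function has Bochner integral zero, whereas the Gaussian integral is positive.
-/
lemma integrable_exp_neg_mul_sq_norm {b : ℝ} (hb : 0 < b) :
    Integrable (fun x : F => Real.exp (-b * ‖x‖ ^ 2)) := by
  by_contra h
  have := GaussianFourier.integral_rexp_neg_mul_sq_norm (V := F) hb
  rw [integral_undef h] at this
  exact (Real.rpow_pos_of_pos (div_pos Real.pi_pos hb) _).ne this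

/-- The density of the standard Gaussian measure with respect to Lebesgue measure. -/
noncomputable def gaussDensity (d : ℕ) (r : ℝ) : ℝ :=
  (2 * Real.pi) ^ (-(d : ℝ) / 2) * Real.exp (-(1 / 2) * r ^ 2)

lemma gaussDensity_nonneg (d : ℕ) (r : ℝ) : 0 ≤ gaussDensity d r := by
  unfold gaussDensity; positivity

lemma measurable_gaussDensity (d : ℕ) : Measurable (gaussDensity d) := by
  unfold gaussDensity; fun_prop

/-- Both sides are finite measures with the same characteristic function. -/
lemma stdGaussian_eq_withDensity :
    stdGaussian F = (volume : Measure F).withDensity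
      (fun x => ENNReal.ofReal (gaussDensity (Module.finrank ℝ F) ‖x‖)) := by
  have hint : Integrable (fun x : F => gaussDensity (Module.finrank ℝ F) ‖x‖) :=
    (integrable_exp_neg_mul_sq_norm (F := F) (b := 1 / 2) (by norm_num)).const_mul _
  have : IsFiniteMeasure ((volume : Measure F).withDensity
      (fun x => ENNReal.ofReal (gaussDensity (Module.finrank ℝ F) ‖x‖))) :=
    isFiniteMeasure_withDensity_ofReal hint.2
  apply Measure.ext_of_charFun
  ext t
  rw [charFun_stdGaussian, charFun_apply, integral_withDensity_eq_integral_toReal_smul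
    (by have := measurable_gaussDensity (Module.finrank ℝ F); fun_prop) (by simp)]
  have h1 := GaussianFourier.integral_cexp_neg_mul_sq_norm_add (V := F) (b := 1 / 2)
    (by norm_num) Complex.I t
  have h2 : ∀ x : F, (ENNReal.ofReal (gaussDensity (Module.finrank ℝ F) ‖x‖)).toReal •
      Complex.exp ((inner ℝ x t : ℝ) * Complex.I) =
      (((2 * Real.pi) ^ (-(Module.finrank ℝ F : ℝ) / 2) : ℝ) : ℂ) *
        Complex.exp (-(1 / 2) * (‖x‖ : ℂ) ^ 2 + Complex.I * (inner ℝ t x : ℝ)) := by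
    intro x
    rw [ENNReal.toReal_ofReal (gaussDensity_nonneg _ _), gaussDensity, Complex.real_smul,
      Complex.ofReal_mul, Complex.exp_add, Complex.ofReal_exp, real_inner_comm, mul_assoc]
    push_cast
    ring_nf
  simp_rw [h2]
  rw [integral_const_mul, h1, Complex.I_sq]
  have h3 : (Real.pi / (1 / 2) : ℂ) = ((2 * Real.pi : ℝ) : ℂ) := by push_cast; ring
  rw [h3, show ((Module.finrank ℝ F : ℂ) / 2) = (((Module.finrank ℝ F : ℝ) / 2 : ℝ) : ℂ) by
    push_cast; ring, ← Complex.ofReal_cpow (by positivity), ← mul_assoc, ← Complex.ofReal_mul,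
    ← Real.rpow_add (by positivity)]
  rw [show -(Module.finrank ℝ F : ℝ) / 2 + (Module.finrank ℝ F : ℝ) / 2 = 0 by ring]
  simp only [Real.rpow_zero, Complex.ofReal_one, one_mul]
  congr 1
  ring

instance isProbabilityMeasure_uniformSphere [Nontrivial F] :
    IsProbabilityMeasure (uniformSphere F) := by
  unfold uniformSphere
  have h0 : (volume : Measure F).toSphere Set.univ ≠ 0 := by
    simp only [ne_eq, Measure.measure_univ_eq_zero]
    exact Measure.toSphere_ne_zero _
  have : IsProbabilityMeasure
      (((volume : Measure F).toSphere Set.univ)⁻¹ • (volume : Measure F).toSphere) := by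
    refine ⟨?_⟩
    simp only [Measure.smul_apply, smul_eq_mul]
    exact ENNReal.inv_mul_cancel h0 (measure_ne_top _ _)
  exact Measure.isProbabilityMeasure_map measurable_subtype_coe.aemeasurable

lemma ae_norm_uniformSphere : ∀ᵐ x ∂(uniformSphere F), ‖x‖ = 1 := by
  unfold uniformSphere
  rw [ae_map_iff measurable_subtype_coe.aemeasurable
    (measurableSet_eq_fun measurable_norm measurable_const)]
  exact Filter.Eventually.of_forall fun x => by simp

lemma lintegral_uniformSphere {f : F → ENNReal} (hf : Measurable f) :
    ∫⁻ x, f x ∂(uniformSphere F) =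
      ((volume : Measure F).toSphere Set.univ)⁻¹ *
        ∫⁻ x, f (x : F) ∂((volume : Measure F).toSphere) := by
  rw [uniformSphere, lintegral_map hf measurable_subtype_coe, lintegral_smul_measure, smul_eq_mul]

/-- Polar decomposition of the standard Gaussian measure: the direction is uniform on the sphere and
independent of the radius. -/
lemma exists_stdGaussian_eq_map_prod [Nontrivial F] :
    ∃ R : Measure ℝ, IsProbabilityMeasure R ∧ (∀ᵐ r ∂ R, 0 < r) ∧
      stdGaussian F = (R.prod (uniformSphere F)).map (fun p => p.1 • p.2) := by
  set d := Module.finrank ℝ F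
  set c := (volume : Measure F).toSphere Set.univ with hc
  have hc0 : c ≠ 0 := by
    simp only [hc, ne_eq, Measure.measure_univ_eq_zero]
    exact Measure.toSphere_ne_zero _
  have hct : c ≠ ⊤ := measure_ne_top _ _
  -- The radial law. The factor `c`, the total surface measure, cancels the normalization in
  -- `uniformSphere`.
  set R₀ : Measure (Set.Ioi (0 : ℝ)) := (Measure.volumeIoiPow (d - 1)).withDensity
    (fun r => c * ENNReal.ofReal (gaussDensity d r)) with hR₀
  have hg := measurable_gaussDensity d
  have hgm : Measurable (fun r : Set.Ioi (0 : ℝ) => c * ENNReal.ofReal (gaussDensity d r)) := by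
    fun_prop
  have : SFinite R₀ := by rw [hR₀]; infer_instance
  set R : Measure ℝ := R₀.map Subtype.val with hR
  have key : ∀ f : F → ENNReal, Measurable f → ∫⁻ x, f x ∂(stdGaussian F) =
      ∫⁻ p, f (p.1 • p.2) ∂ (R.prod (uniformSphere F)) := by
    intro f hf
    have hm1 : Measurable (fun x : F => ENNReal.ofReal (gaussDensity d ‖x‖)) := by fun_prop
    rw [stdGaussian_eq_withDensity, lintegral_withDensity_eq_lintegral_mul _ hm1 hf]
    have h1 : ∫⁻ x, ((fun x : F => ENNReal.ofReal (gaussDensity d ‖x‖)) * f) x =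
        ∫⁻ x : ({(0)}ᶜ : Set F), ENNReal.ofReal (gaussDensity d ‖(x : F)‖) * f (x : F)
          ∂((volume : Measure F).comap (↑)) := by
      rw [lintegral_subtype_comap (measurableSet_singleton _).compl
        (fun x => ENNReal.ofReal (gaussDensity d ‖(x : F)‖) * f (x : F)), restrict_compl_singleton]
      rfl
    rw [h1]
    have h2 := ((volume : Measure F).measurePreserving_homeomorphUnitSphereProd).lintegral_comp_emb
      (Homeomorph.measurableEmbedding _)
      (fun p : Metric.sphere (0 : F) 1 × Set.Ioi (0 : ℝ) =>
        ENNReal.ofReal (gaussDensity d p.2) * f ((p.2 : ℝ) • (p.1 : F)))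
    have h3 : ∀ x : ({(0)}ᶜ : Set F), ENNReal.ofReal (gaussDensity d ‖(x : F)‖) * f (x : F) =
        ENNReal.ofReal (gaussDensity d (homeomorphUnitSphereProd F x).2) *
          f (((homeomorphUnitSphereProd F x).2 : ℝ) • ((homeomorphUnitSphereProd F x).1 : F)) := by
      intro x
      have : ((homeomorphUnitSphereProd F x).2 : ℝ) •
          ((homeomorphUnitSphereProd F x).1 : F) = x := by
        have hx : ‖(x : F)‖ ≠ 0 := norm_ne_zero_iff.2 x.2
        simp [smul_smul, hx]
      rw [this]; simp
    simp_rw [h3]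
    rw [h2, lintegral_prod_symm]
    swap
    · exact ((hg.comp (measurable_subtype_coe.comp measurable_snd)).ennreal_ofReal.mul
        (hf.comp (by fun_prop))).aemeasurable
    rw [lintegral_prod]
    swap
    · exact (hf.comp (by fun_prop)).aemeasurable
    have hΦ : Measurable (fun a : Set.Ioi (0 : ℝ) =>
        ∫⁻ y, f ((a : ℝ) • y) ∂(uniformSphere F)) :=
      (Measurable.lintegral_prod_right' (f := fun p : ℝ × F => f (p.1 • p.2))
        (hf.comp (by fun_prop))).comp measurable_subtype_coe
    rw [hR, lintegral_map (Measurable.lintegral_prod_right' (f := fun p : ℝ × F => f (p.1 • p.2))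
      (hf.comp (by fun_prop))) measurable_subtype_coe, hR₀]
    refine Eq.trans ?_ (lintegral_withDensity_eq_lintegral_mul _ hgm hΦ).symm
    refine lintegral_congr fun r => ?_
    simp only [Pi.mul_apply]
    have hfr : Measurable fun y : F => f ((r : ℝ) • y) := hf.comp (by fun_prop)
    have hfs : Measurable fun y : Metric.sphere (0 : F) 1 => f ((r : ℝ) • (y : F)) :=
      hfr.comp measurable_subtype_coe
    rw [lintegral_uniformSphere hfr]
    refine (lintegral_const_mul _ hfs).trans ?_
    rw [mul_comm c, mul_assoc, ← mul_assoc c, ENNReal.mul_inv_cancel hc0 hct, one_mul]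
  -- The total mass is read off from `key` applied to the constant 1.
  have hRp : IsProbabilityMeasure R := by
    have h := key (fun _ => 1) measurable_const
    rw [lintegral_const, lintegral_const, measure_univ, one_mul, one_mul] at h
    rw [← Set.univ_prod_univ, Measure.prod_prod, measure_univ (μ := uniformSphere F), mul_one] at h
    exact ⟨h.symm⟩
  refine ⟨R, hRp, ?_, ?_⟩
  · rw [hR, ae_map_iff measurable_subtype_coe.aemeasurable measurableSet_Ioi]
    exact Filter.Eventually.of_forall fun x => x.2
  · refine Measure.ext_of_lintegral _ fun f hf => ?_
    rw [key f hf, lintegral_map hf (by fun_prop)]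

end GaussianPolar

/-! ### Moments and exponential moments of the uniform law on a sphere -/

section SphereMoments

open scoped Pointwise

variable {F : Type*} [NormedAddCommGroup F] [InnerProductSpace ℝ F] [FiniteDimensional ℝ F]
  [MeasurableSpace F] [BorelSpace F]

lemma map_inner_stdGaussian (w : F) :
    (stdGaussian F).map (fun x => inner ℝ w x) = gaussianReal 0 (‖w‖ ^ 2).toNNReal := by
  have h := IsGaussian.map_eq_gaussianReal (μ := stdGaussian F) (innerSL ℝ w)
  rw [integral_strongDual_stdGaussian, variance_dual_stdGaussian, innerSL_apply_norm] at h
  exact h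

lemma integrable_exp_inner_stdGaussian (w : F) :
    Integrable (fun x => Real.exp (inner ℝ w x)) (stdGaussian F) := by
  have h := integrable_exp_mul_gaussianReal (μ := 0) (v := (‖w‖ ^ 2).toNNReal) 1
  rw [← map_inner_stdGaussian w, integrable_map_measure (by fun_prop) (by fun_prop)] at h
  simpa [Function.comp_def] using h

lemma integral_exp_inner_stdGaussian (w : F) :
    ∫ x, Real.exp (inner ℝ w x) ∂(stdGaussian F) = Real.exp (‖w‖ ^ 2 / 2) := by
  have h := mgf_gaussianReal (map_inner_stdGaussian w) 1
  simp only [mgf, one_mul, one_pow, mul_one, zero_add] at h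
  rw [h, Real.coe_toNNReal _ (by positivity)]

lemma integral_abs_gaussianReal : ∫ x, |x| ∂(gaussianReal 0 1) = √(2 / Real.pi) := by
  rw [integral_gaussianReal_eq_integral_smul one_ne_zero]
  have h0 : ∀ x : ℝ, gaussianPDFReal 0 1 x • |x| =
      (fun y : ℝ => (√(2 * Real.pi))⁻¹ * (y * Real.exp (-(1 / 2) * y ^ 2))) |x| := by
    intro x
    simp only [gaussianPDFReal, NNReal.coe_one, mul_one, sub_zero, smul_eq_mul, sq_abs]
    ring_nf
  simp_rw [h0]
  rw [integral_comp_abs (f := fun y : ℝ => (√(2 * Real.pi))⁻¹ * (y * Real.exp (-(1 / 2) * y ^ 2))),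
    integral_const_mul]
  have h := integral_rpow_mul_exp_neg_mul_rpow (p := 2) (q := 1) (b := 1 / 2) (by norm_num)
    (by norm_num) (by norm_num)
  have h1 : ∫ x in Set.Ioi (0 : ℝ), x * Real.exp (-(1 / 2) * x ^ 2) = 1 := by
    have : ∀ x : ℝ, x ^ (1 : ℝ) * Real.exp (-(1 / 2) * x ^ (2 : ℝ)) =
        x * Real.exp (-(1 / 2) * x ^ 2) := by
      intro x
      rw [Real.rpow_one, Real.rpow_two]
    simp_rw [this] at h
    rw [h]
    norm_num
  rw [h1, mul_one, Real.sqrt_div (by norm_num), Real.sqrt_mul (by norm_num)]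
  have h2 : √(2 : ℝ) ≠ 0 := by positivity
  have h3 : √Real.pi ≠ 0 := (Real.sqrt_pos.2 Real.pi_pos).ne'
  field_simp
  rw [Real.sq_sqrt (by norm_num)]

lemma integral_abs_inner_stdGaussian {u : F} (hu : ‖u‖ = 1) :
    ∫ x, |inner ℝ u x| ∂(stdGaussian F) = √(2 / Real.pi) := by
  rw [← integral_abs_gaussianReal]
  have h := map_inner_stdGaussian u
  rw [hu, one_pow, Real.toNNReal_one] at h
  rw [← h, integral_map (by fun_prop) (by fun_prop)]

lemma integrable_norm_pow_stdGaussian (p : ℕ) :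
    Integrable (fun x => ‖x‖ ^ p) (stdGaussian F) := by
  have := (IsGaussian.memLp_id (stdGaussian F) p (by simp)).integrable_norm_pow'
  simpa using this

/-- In polar coordinates each moment of the norm is a Gamma value, and raising the power by 2 shifts
the argument by 1. -/
lemma integral_norm_pow_stdGaussian [Nontrivial F] (p : ℕ) :
    ∫ x, ‖x‖ ^ (p + 2) ∂(stdGaussian F) =
      (Module.finrank ℝ F + p) * ∫ x, ‖x‖ ^ p ∂(stdGaussian F) := by
  set d := Module.finrank ℝ F with hd
  have hdpos : 0 < d := Module.finrank_pos
  have hrad : ∀ p : ℕ, ∫ x, ‖x‖ ^ p ∂(stdGaussian F) =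
      (d • (volume : Measure F).real (Metric.ball 0 1)) *
        ((2 * Real.pi) ^ (-(d : ℝ) / 2) * ((1 / 2 : ℝ) ^ (-((d : ℝ) + p) / 2) * (1 / 2) *
          Real.Gamma (((d : ℝ) + p) / 2))) := by
    intro p
    rw [stdGaussian_eq_withDensity, integral_withDensity_eq_integral_toReal_smul
      (by have := measurable_gaussDensity (Module.finrank ℝ F); fun_prop) (by simp)]
    have h1 := integral_fun_norm_addHaar (volume : Measure F)
      (fun r => (ENNReal.ofReal (gaussDensity (Module.finrank ℝ F) r)).toReal • r ^ p)
    rw [h1, smul_eq_mul, nsmul_eq_mul, nsmul_eq_mul, ← mul_assoc, ← hd]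
    congr 1
    have h2 := integral_rpow_mul_exp_neg_mul_rpow (p := 2) (q := (d : ℝ) - 1 + p) (b := 1 / 2)
      (by norm_num) (by have : (0 : ℝ) < d := by exact_mod_cast hdpos
                        have : (0 : ℝ) ≤ p := by positivity
                        linarith) (by norm_num)
    rw [show (d : ℝ) - 1 + p + 1 = d + p by ring] at h2
    rw [← h2, ← integral_const_mul]
    refine setIntegral_congr_fun measurableSet_Ioi fun y hy => ?_
    have hy' : (0 : ℝ) < y := hy
    have h3 : y ^ ((d : ℝ) - 1 + p) = y ^ (d - 1) * y ^ p := by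
      rw [Real.rpow_add hy', Real.rpow_natCast, ← Real.rpow_natCast y (d - 1),
        Nat.cast_sub hdpos, Nat.cast_one]
    simp only [smul_eq_mul]
    rw [ENNReal.toReal_ofReal (gaussDensity_nonneg _ _), h3, gaussDensity, Real.rpow_two]
    ring
  have e1 : (((d : ℝ) + (p + 2 : ℕ)) / 2) = ((d : ℝ) + p) / 2 + 1 := by push_cast; ring
  have e2 : (-((d : ℝ) + (p + 2 : ℕ)) / 2) = -((d : ℝ) + p) / 2 - 1 := by push_cast; ring
  rw [hrad, hrad, e1, e2, Real.Gamma_add_one (by positivity), Real.rpow_sub_one (by norm_num)]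
  ring

/-- The series of cosh has only even powers and nonnegative coefficients, so this is a power series
in s with nonnegative coefficients. It allows Jensen's inequality in the squared radius. -/
lemma convexOn_cosh_sqrt_mul (t : ℝ) :
    ConvexOn ℝ (Set.Ici 0) (fun s : ℝ => Real.cosh (√s * t)) := by
  have hs : ∀ s : ℝ, 0 ≤ s → HasSum (fun k : ℕ => t ^ (2 * k) / (2 * k).factorial * s ^ k)
      (Real.cosh (√s * t)) := by
    intro s hs
    refine (Real.hasSum_cosh (√s * t)).congr_fun ?_
    intro k
    rw [mul_pow, pow_mul (√s), Real.sq_sqrt hs]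
    ring
  refine ⟨convex_Ici 0, fun x hx y hy a b ha hb hab => ?_⟩
  have hx' : (0 : ℝ) ≤ x := hx
  have hy' : (0 : ℝ) ≤ y := hy
  simp only [smul_eq_mul]
  refine hasSum_le (fun k => ?_) (hs (a * x + b * y) (by positivity))
    (((hs x hx').mul_left a).add ((hs y hy').mul_left b))
  have h := (convexOn_pow k).2 hx hy ha hb hab
  simp only [smul_eq_mul] at h
  have hc : 0 ≤ t ^ (2 * k) / (2 * k).factorial := by
    rw [pow_mul]; positivity
  nlinarith [mul_le_mul_of_nonneg_left h hc]

lemma integrable_cosh_inner_stdGaussian (w : F) :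
    Integrable (fun x => Real.cosh (inner ℝ w x)) (stdGaussian F) := by
  simp_rw [Real.cosh_eq]
  refine ((integrable_exp_inner_stdGaussian w).add ?_).div_const 2
  simpa using integrable_exp_inner_stdGaussian (-w)

lemma integral_cosh_inner_stdGaussian (w : F) :
    ∫ x, Real.cosh (inner ℝ w x) ∂(stdGaussian F) = Real.exp (‖w‖ ^ 2 / 2) := by
  simp_rw [Real.cosh_eq]
  have h : Integrable (fun x => Real.exp (-inner ℝ w x)) (stdGaussian F) := by
    simpa using integrable_exp_inner_stdGaussian (-w)
  have h2 : ∫ x, Real.exp (-inner ℝ w x) ∂(stdGaussian F) = Real.exp (‖w‖ ^ 2 / 2) := by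
    simpa using integral_exp_inner_stdGaussian (-w)
  rw [integral_div, integral_add (integrable_exp_inner_stdGaussian w) h,
    integral_exp_inner_stdGaussian, h2]
  ring

/-- The uniform distribution on the sphere does not charge proper subspaces. -/
lemma uniformSphere_submodule_eq_zero {W : Submodule ℝ F} (hW : W ≠ ⊤) :
    uniformSphere F (W : Set F) = 0 := by
  have hWm : MeasurableSet (W : Set F) := W.closed_of_finiteDimensional.measurableSet
  rw [uniformSphere, Measure.map_apply measurable_subtype_coe hWm, Measure.smul_apply,
    Measure.toSphere_apply' _ (measurable_subtype_coe hWm)]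
  have : (volume : Measure F) (Set.Ioo (0 : ℝ) 1 • (Subtype.val ''
      (Subtype.val ⁻¹' (W : Set F) : Set (Metric.sphere (0 : F) 1)))) = 0 := by
    refine measure_mono_null ?_ (Measure.addHaar_submodule volume W hW)
    rintro _ ⟨r, -, _, ⟨x, hx, rfl⟩, rfl⟩
    exact W.smul_mem r hx
  rw [this]
  simp

variable [Nontrivial F]

lemma integrable_uniformSphere {f : F → ℝ} (hf : Continuous f) :
    Integrable f (uniformSphere F) := by
  obtain ⟨C, hC⟩ := (isCompact_sphere (0 : F) 1).exists_bound_of_continuousOn hf.continuousOn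
  refine Integrable.of_bound hf.aestronglyMeasurable C ?_
  filter_upwards [ae_norm_uniformSphere (F := F)] with x hx
  exact hC x (by simpa using hx)

/-- Normalizing a Gaussian vector gives the uniform law on the sphere, and the Gaussian law is
symmetric. -/
lemma uniformSphere_map_neg : (uniformSphere F).map (fun x => -x) = uniformSphere F := by
  obtain ⟨R, hR, hpos, h⟩ := exists_stdGaussian_eq_map_prod (F := F)
  have hnm : Measurable (fun x : F => ‖x‖⁻¹ • x) := by fun_prop
  have key : (stdGaussian F).map (fun x => ‖x‖⁻¹ • x) = uniformSphere F := by
    rw [h, Measure.map_map hnm (by fun_prop)]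
    have h1 : ∀ᵐ p ∂(R.prod (uniformSphere F)), 0 < p.1 :=
      Measure.quasiMeasurePreserving_fst.ae hpos
    have h2 : ∀ᵐ p ∂(R.prod (uniformSphere F)), ‖p.2‖ = 1 :=
      Measure.quasiMeasurePreserving_snd.ae ae_norm_uniformSphere
    rw [Measure.map_congr (g := Prod.snd), ← Measure.snd, Measure.snd_prod]
    filter_upwards [h1, h2] with p hp1 hp2
    simp [norm_smul, hp2, abs_of_pos hp1, smul_smul, hp1.ne']
  have hneg := stdGaussian_map (LinearIsometryEquiv.neg ℝ (E := F))
  rw [← key, Measure.map_map (by fun_prop) hnm]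
  conv_rhs => rw [← hneg, Measure.map_map hnm (by fun_prop)]
  congr 1
  ext x
  simp

/-- Polar decomposition of the standard Gaussian measure, with the moments of the radius. -/
lemma exists_stdGaussian_eq_map_prod_moments :
    ∃ R : Measure ℝ, IsProbabilityMeasure R ∧ (∀ᵐ r ∂ R, 0 < r) ∧
      stdGaussian F = (R.prod (uniformSphere F)).map (fun p => p.1 • p.2) ∧
      ∀ p : ℕ, Integrable (fun r => r ^ p) R ∧ ∫ r, r ^ p ∂ R = ∫ x, ‖x‖ ^ p ∂(stdGaussian F) := by
  obtain ⟨R, hR, hpos, h⟩ := exists_stdGaussian_eq_map_prod (F := F)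
  refine ⟨R, hR, hpos, h, fun p => ?_⟩
  have h1 : ∀ᵐ p ∂(R.prod (uniformSphere F)), 0 < p.1 :=
    Measure.quasiMeasurePreserving_fst.ae hpos
  have h2 : ∀ᵐ p ∂(R.prod (uniformSphere F)), ‖p.2‖ = 1 :=
    Measure.quasiMeasurePreserving_snd.ae ae_norm_uniformSphere
  have hc : (fun q : ℝ × F => ‖q.1 • q.2‖ ^ p) =ᵐ[R.prod (uniformSphere F)]
      fun q => q.1 ^ p := by
    filter_upwards [h1, h2] with q hq1 hq2
    simp [norm_smul, hq2, abs_of_pos hq1]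
  have hi := integrable_norm_pow_stdGaussian (F := F) p
  rw [h, integrable_map_measure (by fun_prop) (by fun_prop)] at hi
  refine ⟨(Integrable.comp_fst_iff (μ := R) (ν := uniformSphere F) (f := fun r => r ^ p)
    (IsProbabilityMeasure.ne_zero _)).1 (hi.congr hc), ?_⟩
  rw [h, integral_map (by fun_prop) (by fun_prop), integral_congr_ae hc,
    integral_fun_fst (fun r : ℝ => r ^ p)]
  simp

/-- Jensen over the radius: its square has mean d, so replacing the radius by √d can only lower the
Gaussian integral. -/
lemma integral_cosh_inner_uniformSphere_le (w : F) :
    ∫ a, Real.cosh (√(Module.finrank ℝ F) * inner ℝ w a) ∂(uniformSphere F) ≤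
      Real.exp (‖w‖ ^ 2 / 2) := by
  set d := Module.finrank ℝ F with hd
  obtain ⟨R, hR, hpos, h, hmom⟩ := exists_stdGaussian_eq_map_prod_moments (F := F)
  have hsq : ∫ r, r ^ 2 ∂ R = d := by
    rw [(hmom 2).2]
    simpa using integral_norm_pow_stdGaussian (F := F) 0
  have hi := integrable_cosh_inner_stdGaussian w
  rw [h, integrable_map_measure (by fun_prop) (by fun_prop)] at hi
  replace hi : Integrable (fun p : ℝ × F => Real.cosh (inner ℝ w (p.1 • p.2)))
    (R.prod (uniformSphere F)) := hi
  have he := integral_cosh_inner_stdGaussian w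
  rw [h, integral_map (by fun_prop) (by fun_prop), integral_prod_symm _ hi] at he
  rw [← he]
  refine integral_mono_ae (integrable_uniformSphere (by fun_prop)) hi.integral_prod_right ?_
  filter_upwards [hi.prod_left_ae] with a ha
  have hcomp : (fun s : ℝ => Real.cosh (√s * inner ℝ w a)) ∘ (fun r : ℝ => r ^ 2) =
      fun r => Real.cosh (inner ℝ w (r • a)) := by
    ext r
    simp only [Function.comp, Real.sqrt_sq_eq_abs, inner_smul_right]
    rcases abs_choice r with hr | hr <;> simp [hr]
  have hJ := (convexOn_cosh_sqrt_mul (inner ℝ w a)).map_integral_le (μ := R)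
    (f := fun r => r ^ 2) (by fun_prop) isClosed_Ici
    (Filter.Eventually.of_forall fun r => by simp [sq_nonneg]) (hmom 2).1
    (by rw [hcomp]; exact ha)
  rw [hsq] at hJ
  refine hJ.trans_eq ?_
  refine integral_congr_ae (Filter.Eventually.of_forall fun r => ?_)
  exact congrFun hcomp r

/-- The uniform distribution on the sphere of dimension `d` is subgaussian with variance proxy
`1 / d`. -/
lemma integral_exp_inner_uniformSphere_le (w : F) :
    ∫ a, Real.exp (inner ℝ w a) ∂(uniformSphere F) ≤
      Real.exp ((Module.finrank ℝ F : ℝ)⁻¹ * ‖w‖ ^ 2 / 2) := by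
  have hdpos : (0 : ℝ) < Module.finrank ℝ F := by
    exact_mod_cast Module.finrank_pos (R := ℝ) (M := F)
  have h := integral_cosh_inner_uniformSphere_le ((√(Module.finrank ℝ F))⁻¹ • w)
  have hs : √(Module.finrank ℝ F : ℝ) ≠ 0 := (Real.sqrt_pos.2 hdpos).ne'
  simp only [inner_smul_left, conj_trivial, mul_inv_cancel_left₀ hs, norm_smul, norm_inv,
    Real.norm_eq_abs, mul_pow, inv_pow, sq_abs, Real.sq_sqrt hdpos.le] at h
  -- By symmetry the integrals of exp and cosh agree.
  have hneg : ∫ a, Real.exp (-inner ℝ w a) ∂(uniformSphere F) =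
      ∫ a, Real.exp (inner ℝ w a) ∂(uniformSphere F) := by
    conv_rhs => rw [← uniformSphere_map_neg]
    rw [integral_map (by fun_prop) (by fun_prop)]
    simp
  refine le_trans (le_of_eq ?_) h
  simp_rw [Real.cosh_eq]
  rw [integral_div, integral_add (integrable_uniformSphere (by fun_prop))
    (integrable_uniformSphere (by fun_prop)), hneg]
  ring

/-- Radius and direction of a Gaussian vector are independent, so E|⟨u, g⟩| factorizes. Bounds on
E‖g‖ thus become bounds on the spherical mean. -/
lemma integral_norm_mul_integral_abs_inner {u : F} (hu : ‖u‖ = 1) :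
    (∫ x, ‖x‖ ∂(stdGaussian F)) * ∫ a, |inner ℝ u a| ∂(uniformSphere F) = √(2 / Real.pi) := by
  obtain ⟨R, hR, hpos, h, hmom⟩ := exists_stdGaussian_eq_map_prod_moments (F := F)
  have h1 : ∀ᵐ p ∂(R.prod (uniformSphere F)), 0 < p.1 :=
    Measure.quasiMeasurePreserving_fst.ae hpos
  have h2 := (hmom 1).2
  simp only [pow_one] at h2
  rw [← integral_abs_inner_stdGaussian hu, ← h2]
  conv_rhs => rw [h, integral_map (by fun_prop) (by fun_prop)]
  rw [← integral_prod_mul]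
  refine integral_congr_ae ?_
  filter_upwards [h1] with p hp
  rw [inner_smul_right, abs_mul, abs_of_pos hp]

lemma integral_norm_stdGaussian_le : ∫ x, ‖x‖ ∂(stdGaussian F) ≤ √(Module.finrank ℝ F) := by
  have hdpos : (0 : ℝ) < Module.finrank ℝ F := by
    exact_mod_cast Module.finrank_pos (R := ℝ) (M := F)
  set s := √(Module.finrank ℝ F : ℝ) with hs
  have hspos : 0 < s := Real.sqrt_pos.2 hdpos
  have hss : s ^ 2 = Module.finrank ℝ F := Real.sq_sqrt hdpos.le
  have hi1 : Integrable (fun x => ‖x‖) (stdGaussian F) := by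
    simpa using integrable_norm_pow_stdGaussian (F := F) 1
  have hi2 := integrable_norm_pow_stdGaussian (F := F) 2
  have h2 : ∫ x, ‖x‖ ^ 2 ∂(stdGaussian F) = s ^ 2 := by
    simpa [hss] using integral_norm_pow_stdGaussian (F := F) 0
  -- Pointwise AM-GM against s², the mean of ‖x‖².
  have h : ∫ x, ‖x‖ ∂(stdGaussian F) ≤ ∫ x, (‖x‖ ^ 2 + s ^ 2) / (2 * s) ∂(stdGaussian F) := by
    refine integral_mono hi1 ((hi2.add (integrable_const _)).div_const _) fun x => ?_
    simp only
    rw [le_div_iff₀ (by positivity)]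
    nlinarith [sq_nonneg (‖x‖ - s)]
  rw [integral_div, integral_add hi2 (integrable_const _), h2] at h
  refine h.trans_eq ?_
  simp
  field_simp
  ring

lemma le_integral_norm_stdGaussian :
    √(Module.finrank ℝ F) * (1 - 1 / Module.finrank ℝ F) ≤ ∫ x, ‖x‖ ∂(stdGaussian F) := by
  have hdpos : (0 : ℝ) < Module.finrank ℝ F := by
    exact_mod_cast Module.finrank_pos (R := ℝ) (M := F)
  set s := √(Module.finrank ℝ F : ℝ) with hs
  have hspos : 0 < s := Real.sqrt_pos.2 hdpos
  have hss : s ^ 2 = Module.finrank ℝ F := Real.sq_sqrt hdpos.le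
  have hi1 : Integrable (fun x => ‖x‖) (stdGaussian F) := by
    simpa using integrable_norm_pow_stdGaussian (F := F) 1
  have hi2 := integrable_norm_pow_stdGaussian (F := F) 2
  have hi4 := integrable_norm_pow_stdGaussian (F := F) 4
  have h2 : ∫ x, ‖x‖ ^ 2 ∂(stdGaussian F) = s ^ 2 := by
    simpa [hss] using integral_norm_pow_stdGaussian (F := F) 0
  have h4 : ∫ x, ‖x‖ ^ 4 ∂(stdGaussian F) = (s ^ 2 + 2) * s ^ 2 := by
    have := integral_norm_pow_stdGaussian (F := F) 2
    rw [h2, ← hss] at this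
    exact_mod_cast this
  -- A polynomial minorant of the norm, touching it at s to second order: 2s³t - 3s²t² + t⁴ = t(t -
  -- s)²(t + 2s). Only the second and fourth moments are then needed.
  have h : ∫ x, (3 * s ^ 2 * ‖x‖ ^ 2 - ‖x‖ ^ 4) / (2 * s ^ 3) ∂(stdGaussian F) ≤
      ∫ x, ‖x‖ ∂(stdGaussian F) := by
    refine integral_mono (((hi2.const_mul _).sub hi4).div_const _) hi1 fun x => ?_
    simp only
    rw [div_le_iff₀ (by positivity)]
    have : 0 ≤ ‖x‖ * ((‖x‖ - s) ^ 2 * (‖x‖ + 2 * s)) := by positivity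
    nlinarith
  rw [integral_div, integral_sub (hi2.const_mul _) hi4, integral_const_mul, h2, h4] at h
  refine le_trans (le_of_eq ?_) h
  rw [← hss]
  field_simp
  ring

lemma le_integral_abs_inner_uniformSphere {u : F} (hu : ‖u‖ = 1) :
    √(2 / Real.pi) / √(Module.finrank ℝ F) ≤ ∫ a, |inner ℝ u a| ∂(uniformSphere F) := by
  have hdpos : (0 : ℝ) < Module.finrank ℝ F := by
    exact_mod_cast Module.finrank_pos (R := ℝ) (M := F)
  rw [div_le_iff₀ (Real.sqrt_pos.2 hdpos), ← integral_norm_mul_integral_abs_inner hu, mul_comm]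
  exact mul_le_mul_of_nonneg_left integral_norm_stdGaussian_le
    (integral_nonneg fun _ => abs_nonneg _)

lemma integral_abs_inner_uniformSphere_le {u : F} (hu : ‖u‖ = 1)
    (hd : 2 ≤ Module.finrank ℝ F) :
    ∫ a, |inner ℝ u a| ∂(uniformSphere F) ≤
      √(2 / Real.pi) / (√(Module.finrank ℝ F) * (1 - 1 / Module.finrank ℝ F)) := by
  have hd2 : (2 : ℝ) ≤ Module.finrank ℝ F := by exact_mod_cast hd
  have h1 : 0 < 1 - 1 / (Module.finrank ℝ F : ℝ) := by
    rw [sub_pos, div_lt_one (by linarith)]; linarith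
  have h2 : 0 < √(Module.finrank ℝ F : ℝ) := Real.sqrt_pos.2 (by linarith)
  rw [le_div_iff₀ (by positivity), ← integral_norm_mul_integral_abs_inner hu, mul_comm]
  exact mul_le_mul_of_nonneg_right le_integral_norm_stdGaussian
    (integral_nonneg fun _ => abs_nonneg _)

end SphereMoments

/-! ### Exponential moments with values in [0, ∞], free of integrability conditions -/

/-- The exponential function with values in `[0, ∞]`. -/
noncomputable def eexp (x : ℝ) : ENNReal := ENNReal.ofReal (Real.exp x)

lemma eexp_mono : Monotone eexp := fun _ _ h => ENNReal.ofReal_le_ofReal (Real.exp_le_exp.2 h)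

lemma eexp_add (x y : ℝ) : eexp (x + y) = eexp x * eexp y := by
  rw [eexp, Real.exp_add, ENNReal.ofReal_mul (Real.exp_pos _).le]; rfl

lemma eexp_zero : eexp 0 = 1 := by simp [eexp]

@[fun_prop]
lemma measurable_eexp : Measurable eexp := by unfold eexp; fun_prop

/-- AM-GM. In the symmetrization it separates the two independent copies. -/
lemma two_mul_eexp_add_le (x y : ℝ) : 2 * eexp (x + y) ≤ eexp (2 * x) + eexp (2 * y) := by
  rw [eexp, eexp, eexp, ← ENNReal.ofReal_add (Real.exp_pos _).le (Real.exp_pos _).le,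
    show (2 : ENNReal) = ENNReal.ofReal 2 by simp, ← ENNReal.ofReal_mul (by norm_num)]
  refine ENNReal.ofReal_le_ofReal ?_
  rw [two_mul x, two_mul y, Real.exp_add, Real.exp_add, Real.exp_add]
  nlinarith [sq_nonneg (Real.exp x - Real.exp y)]

lemma eexp_sum {ι : Type*} (s : Finset ι) (f : ι → ℝ) :
    eexp (∑ i ∈ s, f i) = ∏ i ∈ s, eexp (f i) := by
  classical
  induction s using Finset.induction_on with
  | empty => simp [eexp_zero]
  | insert a s ha ih => rw [Finset.sum_insert ha, Finset.prod_insert ha, eexp_add, ih]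

/-- Jensen's inequality for the exponential. -/
lemma eexp_integral_le {Ω : Type*} [MeasurableSpace Ω] {P : Measure Ω} [IsProbabilityMeasure P]
    {Y : Ω → ℝ} (hY : Integrable Y P) : eexp (∫ ω, Y ω ∂P) ≤ ∫⁻ ω, eexp (Y ω) ∂P := by
  by_cases hi : Integrable (fun ω => Real.exp (Y ω)) P
  · have h := convexOn_exp.map_integral_le (μ := P) (f := Y) Real.continuous_exp.continuousOn
      isClosed_univ (by simp) hY hi
    refine (ENNReal.ofReal_le_ofReal h).trans_eq ?_
    exact ofReal_integral_eq_lintegral_ofReal hi (Filter.Eventually.of_forall fun _ =>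
      (Real.exp_pos _).le)
  · have : ∫⁻ ω, eexp (Y ω) ∂P = ⊤ := by
      by_contra hne
      refine hi ⟨(Real.continuous_exp.measurable.comp_aemeasurable
        hY.aemeasurable).aestronglyMeasurable, ?_⟩
      rw [hasFiniteIntegral_iff_ofReal (Filter.Eventually.of_forall fun _ => (Real.exp_pos _).le)]
      exact lt_top_iff_ne_top.2 hne
    rw [this]; exact le_top

/-- Markov's inequality for the exponential. -/
lemma measure_le_of_lintegral_eexp_le {Ω : Type*} [MeasurableSpace Ω] {P : Measure Ω}
    {Y : Ω → ℝ} (hY : AEMeasurable Y P) {b c : ENNReal} {t : ℝ}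
    (h : ∫⁻ ω, eexp (Y ω) ∂P ≤ b) (hc : eexp (-t) * b ≤ c) : P {ω | t ≤ Y ω} ≤ c := by
  have h1 := mul_meas_ge_le_lintegral₀ (μ := P) (measurable_eexp.comp_aemeasurable hY) (eexp t)
  have h2 : {ω | t ≤ Y ω} ⊆ {ω | eexp t ≤ (eexp ∘ Y) ω} := fun ω hω => eexp_mono hω
  calc P {ω | t ≤ Y ω} = eexp (-t) * (eexp t * P {ω | t ≤ Y ω}) := by
        rw [← mul_assoc, ← eexp_add]; simp [eexp_zero]
    _ ≤ eexp (-t) * b := by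
        gcongr
        exact (mul_le_mul_right (measure_mono h2) _).trans (h1.trans h)
    _ ≤ c := hc

/-! ### From subgaussian vectors to χ² tails -/

section GaussianTrick

variable {F : Type*} [NormedAddCommGroup F] [InnerProductSpace ℝ F] [FiniteDimensional ℝ F]
  [MeasurableSpace F] [BorelSpace F]

lemma lintegral_eexp_inner_stdGaussian (w : F) :
    ∫⁻ x, eexp (inner ℝ w x) ∂(stdGaussian F) = eexp (‖w‖ ^ 2 / 2) := by
  rw [eexp, ← integral_exp_inner_stdGaussian, ofReal_integral_eq_lintegral_ofReal
    (integrable_exp_inner_stdGaussian w) (Filter.Eventually.of_forall fun _ => (Real.exp_pos _).le)]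
  rfl

lemma lintegral_eexp_sq_norm_stdGaussian {β : ℝ} (hβ : β < 1) :
    ∫⁻ x, eexp (β * ‖x‖ ^ 2 / 2) ∂(stdGaussian F) =
      ENNReal.ofReal ((1 - β) ^ (-(Module.finrank ℝ F : ℝ) / 2)) := by
  have hb : 0 < (1 - β) / 2 := by linarith
  have hg := measurable_gaussDensity (Module.finrank ℝ F)
  have hm : Measurable fun x : F => ENNReal.ofReal (gaussDensity (Module.finrank ℝ F) ‖x‖) := by
    fun_prop
  rw [stdGaussian_eq_withDensity, lintegral_withDensity_eq_lintegral_mul _ hm (by fun_prop)]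
  have h1 : ∀ x : F, ((fun x : F => ENNReal.ofReal (gaussDensity (Module.finrank ℝ F) ‖x‖)) *
      (fun x : F => eexp (β * ‖x‖ ^ 2 / 2) : F → ENNReal)) x =
      ENNReal.ofReal ((2 * Real.pi) ^ (-(Module.finrank ℝ F : ℝ) / 2) *
        Real.exp (-((1 - β) / 2) * ‖x‖ ^ 2)) := by
    intro x
    simp only [Pi.mul_apply]
    rw [eexp, ← ENNReal.ofReal_mul (gaussDensity_nonneg _ _), gaussDensity, mul_assoc,
      ← Real.exp_add]
    ring_nf
  rw [lintegral_congr h1, ← ofReal_integral_eq_lintegral_ofReal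
    ((integrable_exp_neg_mul_sq_norm hb).const_mul _)
    (Filter.Eventually.of_forall fun _ => by positivity), integral_const_mul,
    GaussianFourier.integral_rexp_neg_mul_sq_norm hb]
  congr 1
  rw [show Real.pi / ((1 - β) / 2) = 2 * Real.pi * (1 - β)⁻¹ by field_simp,
    Real.mul_rpow (x := 2 * Real.pi) (y := (1 - β)⁻¹) (by positivity)
      (by rw [inv_nonneg]; linarith), ← mul_assoc,
    ← Real.rpow_add (by positivity), Real.inv_rpow (by linarith), ← Real.rpow_neg (by linarith)]
  rw [show -(Module.finrank ℝ F : ℝ) / 2 + (Module.finrank ℝ F : ℝ) / 2 = 0 by ring]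
  simp [neg_div]

/-- If a random vector is subgaussian with variance proxy `K`, then the squared norm of its
projection to a subspace `V` has the exponential moments of a `χ²`-variable. -/
lemma lintegral_eexp_sq_norm_projection_le {Ω : Type*} [MeasurableSpace Ω] {P : Measure Ω}
    [SFinite P] {S : Ω → F} (hS : Measurable S) {K α : ℝ} (hα : 0 ≤ α) (hαK : α * K < 1)
    (h : ∀ w : F, ∫⁻ ω, eexp (inner ℝ w (S ω)) ∂P ≤ eexp (K * ‖w‖ ^ 2 / 2))
    (V : Submodule ℝ F) :
    ∫⁻ ω, eexp (α * ‖V.starProjection (S ω)‖ ^ 2 / 2) ∂P ≤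
      ENNReal.ofReal ((1 - α * K) ^ (-(Module.finrank ℝ V : ℝ) / 2)) := by
  -- The square is linearized by an auxiliary Gaussian vector g of V: exp(α‖Px‖²/2) = E exp(√α⟨g,
  -- x⟩). After exchanging the integrals, the subgaussian hypothesis applies for each fixed g.
  have h1 : ∀ ω, eexp (α * ‖V.starProjection (S ω)‖ ^ 2 / 2) =
      ∫⁻ g : V, eexp (inner ℝ ((√α • g : V) : F) (S ω)) ∂(stdGaussian V) := by
    intro ω
    have h2 := lintegral_eexp_inner_stdGaussian (√α • V.orthogonalProjectionOnto (S ω))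
    rw [norm_smul, mul_pow, Real.norm_eq_abs, sq_abs,
    Real.sq_sqrt hα] at h2
    rw [show ‖V.starProjection (S ω)‖ = ‖V.orthogonalProjectionOnto (S ω)‖ from rfl, ← h2]
    refine lintegral_congr fun g => ?_
    rw [real_inner_comm, inner_smul_right, Submodule.coe_smul, inner_smul_left, conj_trivial,
      Submodule.inner_orthogonalProjectionOnto_eq_of_mem_left]
  simp_rw [h1]
  rw [lintegral_lintegral_swap]
  swap
  · refine (measurable_eexp.comp ?_).aemeasurable
    exact Measurable.inner (𝕜 := ℝ) (by fun_prop) (hS.comp measurable_fst)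
  rw [← lintegral_eexp_sq_norm_stdGaussian (F := V) hαK]
  refine lintegral_mono fun g => (h _).trans_eq ?_
  rw [Submodule.coe_smul, Submodule.coe_norm, norm_smul, mul_pow, Real.norm_eq_abs, sq_abs,
    Real.sq_sqrt hα]
  ring_nf

end GaussianTrick

/-- The optimal exponent in the `χ²` tail bound. -/
lemma exists_chi_sq_exponent {K L D : ℝ} (hK : 0 < K) (hL : 0 ≤ L) (hD : 0 < D) :
    ∃ α, 0 ≤ α ∧ α * K < 1 ∧
      Real.exp (-(α * (√(K * D) + √(2 * K * L)) ^ 2 / 2)) * (1 - α * K) ^ (-D / 2) ≤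
        Real.exp (-L) := by
  set τ := √(2 * L / D) with hτ
  have hτ0 : 0 ≤ τ := Real.sqrt_nonneg _
  have hτ2 : D * τ ^ 2 = 2 * L := by
    rw [hτ, Real.sq_sqrt (by positivity)]; field_simp
  have hx : √(K * D) + √(2 * K * L) = √(K * D) * (1 + τ) := by
    rw [mul_add, mul_one, hτ, ← Real.sqrt_mul (by positivity)]
    congr 2
    field_simp
  -- With this choice the exponent is -τ(1 + τ)D/2, and (1 + τ)^(D/2) ≤ exp(τD/2) leaves -τ²D/2 =
  -- -L.
  refine ⟨τ / (1 + τ) / K, by positivity, ?_, ?_⟩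
  · rw [div_mul_cancel₀ _ hK.ne', div_lt_one (by positivity)]; linarith
  · rw [div_mul_cancel₀ _ hK.ne', hx, mul_pow, Real.sq_sqrt (by positivity),
      show 1 - τ / (1 + τ) = (1 + τ)⁻¹ by field_simp; ring, Real.inv_rpow (by positivity),
      ← Real.rpow_neg (by positivity)]
    have h1 : (1 + τ) ^ (-(-D / 2)) ≤ Real.exp (τ * (D / 2)) := by
      rw [show -(-D / 2) = D / 2 by ring, Real.exp_mul]
      exact Real.rpow_le_rpow (by positivity) (by linarith [Real.add_one_le_exp τ]) (by positivity)
    refine (mul_le_mul_of_nonneg_left h1 (Real.exp_pos _).le).trans_eq ?_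
    rw [← Real.exp_add]
    congr 1
    have : L = D * τ ^ 2 / 2 := by linarith
    rw [this]
    field_simp
    ring

/-- The sign attached to a Boolean. -/
def sgn (b : Bool) : ℝ := if b then 1 else -1

lemma sgn_not (b : Bool) : sgn (!b) = -sgn b := by cases b <;> simp [sgn]

lemma sgn_sq (b : Bool) : sgn b ^ 2 = 1 := by cases b <;> simp [sgn]

/-! ### Contraction principle for random signs -/

section Contraction

variable {E : Type*} [TopologicalSpace E] {T : Set E}

lemma le_sSup_image (hT : IsCompact T) {f : E → ℝ} (hf : Continuous f) {u : E} (hu : u ∈ T) :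
    f u ≤ sSup (f '' T) :=
  le_csSup (hT.image hf).bddAbove (Set.mem_image_of_mem f hu)

/-- One step of the contraction principle: replacing `x` by `|x|` below a random sign. -/
lemma map_sSup_add_abs_le (hT : IsCompact T) (hne : T.Nonempty) {F : ℝ → ENNReal} (hF : Monotone F)
    {A x : E → ℝ} (hA : Continuous A) (hx : Continuous x) :
    F (sSup ((fun u => A u + |x u|) '' T)) + F (sSup ((fun u => A u - |x u|) '' T)) ≤
      F (sSup ((fun u => A u + x u) '' T)) + F (sSup ((fun u => A u - x u) '' T)) := by
  obtain ⟨t, ht, hte⟩ := hT.exists_sSup_image_eq hne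
    (f := fun u => A u + |x u|) (by fun_prop)
  obtain ⟨s, hs, hse⟩ := hT.exists_sSup_image_eq hne
    (f := fun u => A u - |x u|) (by fun_prop)
  rw [hte, hse]
  have hp : ∀ u ∈ T, A u + x u ≤ sSup ((fun u => A u + x u) '' T) := fun u hu =>
    le_sSup_image hT (f := fun u => A u + x u) (by fun_prop) hu
  have hm : ∀ u ∈ T, A u - x u ≤ sSup ((fun u => A u - x u) '' T) := fun u hu =>
    le_sSup_image hT (f := fun u => A u - x u) (by fun_prop) hu
  -- Only the sign of x at the maximizer t of A + |x| matters. If it is negative, the two suprema on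
  -- the right exchange roles.
  rcases le_total 0 (x t) with h | h
  · rw [abs_of_nonneg h]
    refine add_le_add (hF (hp t ht)) (hF ((hm s hs).trans' ?_))
    linarith [le_abs_self (x s)]
  · rw [abs_of_nonpos h, add_comm]
    refine add_le_add (hF ((hp s hs).trans' ?_)) (hF ((hm t ht).trans' ?_))
    · linarith [neg_abs_le (x s)]
    · linarith

variable {ι : Type*} [Fintype ι]

/-- Contraction principle for the absolute value. -/
lemma sum_map_sSup_abs_le [DecidableEq ι] (hT : IsCompact T) (hne : T.Nonempty)
    {F : ℝ → ENNReal} (hF : Monotone F) {x : ι → E → ℝ} (hx : ∀ i, Continuous (x i)) :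
    ∑ ε : ι → Bool, F (sSup ((fun u => ∑ i, sgn (ε i) * |x i u|) '' T)) ≤
      ∑ ε : ι → Bool, F (sSup ((fun u => ∑ i, sgn (ε i) * x i u) '' T)) := by
  -- Absolute values are inserted one coordinate at a time, those in S being already done.
  set y : Finset ι → ι → E → ℝ := fun S i u => if i ∈ S then |x i u| else x i u with hy
  have hyc : ∀ S i, Continuous (y S i) := by
    intro S i
    by_cases h : i ∈ S <;> simp only [hy, h, if_true, if_false]
    · exact (hx i).abs
    · exact hx i
  have key : ∀ S : Finset ι,
      ∑ ε : ι → Bool, F (sSup ((fun u => ∑ i, sgn (ε i) * y S i u) '' T)) ≤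
        ∑ ε : ι → Bool, F (sSup ((fun u => ∑ i, sgn (ε i) * x i u) '' T)) := by
    intro S
    induction S using Finset.induction_on with
    | empty => simp [hy]
    | insert j S hj ih =>
      refine le_trans ?_ ih
      set g : (ι → Bool) → ENNReal :=
        fun ε => F (sSup ((fun u => ∑ i, sgn (ε i) * y (insert j S) i u) '' T)) with hg
      set h : (ι → Bool) → ENNReal :=
        fun ε => F (sSup ((fun u => ∑ i, sgn (ε i) * y S i u) '' T)) with hh
      -- Pairing each sign pattern with its flip at j reduces the induction step to
      -- `map_sSup_add_abs_le`.
      set fl : (ι → Bool) → (ι → Bool) := fun ε => Function.update ε j (!ε j) with hfl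
      have hinv : Function.Involutive fl := by
        intro ε
        simp [hfl]
      have hflip : ∀ k : (ι → Bool) → ENNReal, ∑ ε, k (fl ε) = ∑ ε, k ε := fun k =>
        Equiv.sum_comp hinv.toPerm k
      have hpair : ∀ ε, g ε + g (fl ε) ≤ h ε + h (fl ε) := by
        have hmain : ∀ ε : ι → Bool, ε j = true → g ε + g (fl ε) ≤ h ε + h (fl ε) := by
          intro ε hε
          set A : E → ℝ := fun u => ∑ i ∈ Finset.univ.erase j, sgn (ε i) * y S i u with hA
          have hAc : Continuous A := by
            refine continuous_finsetSum _ fun i _ => continuous_const.mul (hyc S i)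
          have hsplit : ∀ (S' : Finset ι) (ε' : ι → Bool), (∀ i, i ≠ j → (i ∈ S' ↔ i ∈ S)) →
              (∀ i, i ≠ j → ε' i = ε i) → ∀ u, ∑ i, sgn (ε' i) * y S' i u =
                A u + sgn (ε' j) * y S' j u := by
            intro S' ε' h1 h2 u
            rw [← Finset.sum_erase_add _ _ (Finset.mem_univ j)]
            congr 1
            refine Finset.sum_congr rfl fun i hi => ?_
            have hij := Finset.ne_of_mem_erase hi
            simp only [hy, h1 i hij, h2 i hij]
          have hins : ∀ i, i ≠ j → (i ∈ insert j S ↔ i ∈ S) := fun i hi => by simp [hi]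
          have hfe : ∀ i, i ≠ j → fl ε i = ε i := fun i hi => by simp [hfl, hi]
          have hfj : fl ε j = false := by simp [hfl, hε]
          have e1 : y (insert j S) j = fun u => |x j u| := by simp [hy]
          have e2 : y S j = x j := by simp [hy, hj]
          simp only [hg, hh]
          simp_rw [hsplit (insert j S) ε hins (fun _ _ => rfl), hsplit (insert j S) (fl ε) hins hfe,
            hsplit S ε (fun _ _ => Iff.rfl) (fun _ _ => rfl),
            hsplit S (fl ε) (fun _ _ => Iff.rfl) hfe, hfj, hε, e1, e2]
          simpa [sgn, sub_eq_add_neg] using map_sSup_add_abs_le hT hne hF hAc (hx j)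
        intro ε
        cases hε : ε j
        · have h1 := hmain (fl ε) (by simp [hfl, hε])
          rw [hinv ε] at h1
          rw [add_comm (g ε), add_comm (h ε)]
          exact h1
        · exact hmain ε hε
      have h2 : 2 * ∑ ε, g ε ≤ 2 * ∑ ε, h ε := by
        calc 2 * ∑ ε, g ε = ∑ ε, (g ε + g (fl ε)) := by
              rw [Finset.sum_add_distrib, hflip g, two_mul]
          _ ≤ ∑ ε, (h ε + h (fl ε)) := Finset.sum_le_sum fun ε _ => hpair ε
          _ = 2 * ∑ ε, h ε := by rw [Finset.sum_add_distrib, hflip h, two_mul]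
      exact (ENNReal.mul_le_mul_iff_right two_ne_zero ENNReal.ofNat_ne_top).1 h2
  simpa [hy] using key Finset.univ

end Contraction

/-! ### Symmetrization -/

section Symmetrization

variable {E : Type*} [NormedAddCommGroup E] [InnerProductSpace ℝ E] [FiniteDimensional ℝ E]
  [MeasurableSpace E] [BorelSpace E] {ι : Type*} [Fintype ι]

lemma integrable_abs_inner {ν : Measure E} [IsProbabilityMeasure ν] (hν : ∀ᵐ a ∂ν, ‖a‖ ≤ 1)
    (u : E) : Integrable (fun a => |inner ℝ u a|) ν := by
  refine Integrable.of_bound (by fun_prop) ‖u‖ ?_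
  filter_upwards [hν] with a ha
  rw [Real.norm_eq_abs, abs_abs]
  exact (abs_real_inner_le_norm u a).trans (mul_le_of_le_one_right (norm_nonneg _) ha)

lemma continuous_integral_abs_inner {ν : Measure E} [IsProbabilityMeasure ν]
    (hν : ∀ᵐ a ∂ν, ‖a‖ ≤ 1) : Continuous (fun u => ∫ a, |inner ℝ u a| ∂ν) := by
  refine LipschitzWith.continuous (K := 1) (LipschitzWith.of_dist_le_mul fun u v => ?_)
  rw [NNReal.coe_one, one_mul, dist_eq_norm, dist_eq_norm,
    ← integral_sub (integrable_abs_inner hν u) (integrable_abs_inner hν v)]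
  refine (norm_integral_le_of_norm_le_const (C := ‖u - v‖) ?_).trans (by simp)
  filter_upwards [hν] with a ha
  refine (abs_abs_sub_abs_le _ _).trans ?_
  rw [← inner_sub_left]
  exact (abs_real_inner_le_norm _ a).trans (mul_le_of_le_one_right (norm_nonneg _) ha)

/-- Symmetrization inequality for exponential moments. -/
lemma card_mul_lintegral_eexp_sSup_le [DecidableEq ι] {ν : Measure E} [IsProbabilityMeasure ν]
    (hν : ∀ᵐ a ∂ν, ‖a‖ ≤ 1) {T : Set E} (hT : IsCompact T) (hne : T.Nonempty) {l : ℝ}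
    (hl : 0 ≤ l) :
    (Fintype.card (ι → Bool) : ENNReal) * ∫⁻ a, eexp (l * sSup ((fun u =>
        ∑ i, ((∫ x, |inner ℝ u x| ∂ν) - |inner ℝ u (a i)|)) '' T)) ∂(Measure.pi fun _ : ι => ν) ≤
      ∑ ε : ι → Bool, ∫⁻ a, eexp (2 * l * sSup ((fun u =>
        ∑ i, sgn (ε i) * |inner ℝ u (a i)|) '' T)) ∂(Measure.pi fun _ : ι => ν) := by
  set P := Measure.pi fun _ : ι => ν with hP
  have hec := continuous_integral_abs_inner hν
  set X := ∫⁻ a, eexp (l * sSup ((fun u =>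
        ∑ i, ((∫ x, |inner ℝ u x| ∂ν) - |inner ℝ u (a i)|)) '' T)) ∂P with hX
  set A : (ι → Bool) → ENNReal := fun ε => ∫⁻ a, eexp (2 * l * sSup ((fun u =>
        ∑ i, sgn (ε i) * |inner ℝ u (a i)|) '' T)) ∂P with hA
  set Z := Measure.pi fun _ : ι => ν.prod ν with hZ
  have hm2 : ∀ ε : ι → Bool, Continuous fun a : ι → E => sSup ((fun u =>
      ∑ i, sgn (ε i) * |inner ℝ u (a i)|) '' T) := fun ε =>
    hT.continuous_sSup (f := fun (a : ι → E) u => ∑ i, sgn (ε i) * |inner ℝ u (a i)|) (by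
      simp only [Function.HasUncurry.uncurry, id]; fun_prop)
  have hm1 : ∀ ε : ι → Bool, Continuous fun z : ι → E × E => sSup ((fun u =>
      ∑ i, sgn (ε i) * (|inner ℝ u (z i).2| - |inner ℝ u (z i).1|)) '' T) := fun ε =>
    hT.continuous_sSup (f := fun (z : ι → E × E) u =>
      ∑ i, sgn (ε i) * (|inner ℝ u (z i).2| - |inner ℝ u (z i).1|)) (by
      simp only [Function.HasUncurry.uncurry, id]; fun_prop)
  -- The means are replaced by an independent second copy, by Jensen at the maximizing u.
  have hjensen : X ≤ ∫⁻ z, eexp (l * sSup ((fun u =>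
      ∑ i, sgn true * (|inner ℝ u (z i).2| - |inner ℝ u (z i).1|)) '' T)) ∂Z := by
    have hmp := measurePreserving_arrowProdEquivProdArrow E E ι (fun _ => ν) (fun _ => ν)
    have hcont : Continuous fun p : (ι → E) × (ι → E) => sSup ((fun u =>
      ∑ i, sgn true * (|inner ℝ u (p.2 i)| - |inner ℝ u (p.1 i)|)) '' T) :=
      hT.continuous_sSup (f := fun (p : (ι → E) × (ι → E)) u =>
        ∑ i, sgn true * (|inner ℝ u (p.2 i)| - |inner ℝ u (p.1 i)|)) (by
        simp only [Function.HasUncurry.uncurry, id]; fun_prop)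
    have h1 := hmp.lintegral_comp (f := fun p : (ι → E) × (ι → E) => eexp (l * sSup ((fun u =>
      ∑ i, sgn true * (|inner ℝ u (p.2 i)| - |inner ℝ u (p.1 i)|)) '' T))) (by
        have := hcont.measurable; fun_prop)
    refine le_trans ?_ h1.ge
    rw [lintegral_prod _ (Measurable.aemeasurable (by have := hcont.measurable; fun_prop))]
    refine lintegral_mono fun a => ?_
    obtain ⟨u, hu, hue⟩ := hT.exists_sSup_image_eq hne (f := fun u =>
      ∑ i, ((∫ x, |inner ℝ u x| ∂ν) - |inner ℝ u (a i)|)) (by fun_prop)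
    have hint : ∀ i, Integrable (fun b : ι → E => |inner ℝ u (b i)|) P := fun i =>
      integrable_comp_eval (μ := fun _ : ι => ν) (i := i) (f := fun x => |inner ℝ u x|)
        (integrable_abs_inner hν u)
    have hint2 : ∀ i, Integrable (fun b : ι → E => |inner ℝ u (b i)| - |inner ℝ u (a i)|) P :=
      fun i => (hint i).sub (integrable_const _)
    have hY : l * ∑ i, ((∫ x, |inner ℝ u x| ∂ν) - |inner ℝ u (a i)|) =
        ∫ b, l * ∑ i, (|inner ℝ u (b i)| - |inner ℝ u (a i)|) ∂P := by
      rw [integral_const_mul, integral_finsetSum _ fun i _ => hint2 i]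
      congr 1
      refine Finset.sum_congr rfl fun i _ => ?_
      rw [integral_sub (hint i) (integrable_const _)]
      congr 1
      · exact (integral_comp_eval (μ := fun _ : ι => ν) (i := i) (f := fun x => |inner ℝ u x|)
          (by fun_prop)).symm
      · simp
    simp only
    rw [hue, hY]
    refine (eexp_integral_le ((integrable_finsetSum _ fun i _ => hint2 i).const_mul l)).trans ?_
    refine lintegral_mono fun b => eexp_mono (mul_le_mul_of_nonneg_left ?_ hl)
    refine (le_of_eq ?_).trans (le_sSup_image hT (f := fun u =>
      ∑ i, sgn true * (|inner ℝ u (b i)| - |inner ℝ u (a i)|)) (by fun_prop) hu)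
    simp [sgn]
  -- Exchanging the two copies in the coordinates where ε is false preserves the product law and
  -- inserts the signs.
  have hswap : ∀ ε : ι → Bool, X ≤ ∫⁻ z, eexp (l * sSup ((fun u =>
      ∑ i, sgn (ε i) * (|inner ℝ u (z i).2| - |inner ℝ u (z i).1|)) '' T)) ∂Z := by
    intro ε
    have hmp : MeasurePreserving (fun (z : ι → E × E) i => (if ε i then id else Prod.swap) (z i))
        Z Z := by
      refine measurePreserving_pi _ _ fun i => ?_
      by_cases h : ε i
      · simp only [h, if_true]; exact MeasurePreserving.id _
      · simp only [h]; exact Measure.measurePreserving_swap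
    have h1 := hmp.lintegral_comp (f := fun z : ι → E × E => eexp (l * sSup ((fun u =>
      ∑ i, sgn true * (|inner ℝ u (z i).2| - |inner ℝ u (z i).1|)) '' T))) (by
        have := (hm1 fun _ => true).measurable; fun_prop)
    refine hjensen.trans (h1.ge.trans_eq ?_)
    refine lintegral_congr fun z => ?_
    congr 4
    ext u
    refine Finset.sum_congr rfl fun i _ => ?_
    by_cases h : ε i <;> simp [h, sgn]
  -- The supremum splits over the two copies. The first one carries the signs -ε, which summation
  -- over all ε turns back into ε.
  have hhalf : ∀ ε : ι → Bool, 2 * X ≤ A ε + A (fun i => !ε i) := by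
    intro ε
    have hsnd : MeasurePreserving (fun (z : ι → E × E) i => (z i).2) Z P :=
      measurePreserving_pi _ _ fun i => measurePreserving_snd
    have hfst : MeasurePreserving (fun (z : ι → E × E) i => (z i).1) Z P :=
      measurePreserving_pi _ _ fun i => measurePreserving_fst
    have hme : ∀ ε : ι → Bool, Measurable fun a : ι → E => eexp (2 * l * sSup ((fun u =>
      ∑ i, sgn (ε i) * |inner ℝ u (a i)|) '' T)) := fun ε => by
      have := (hm2 ε).measurable; fun_prop
    have h1 := hsnd.lintegral_comp (hme ε)
    have h2 := hfst.lintegral_comp (hme fun i => !ε i)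
    simp only [hA]
    rw [← h1, ← h2]
    refine le_trans ?_ (lintegral_add_left ((hme ε).comp hsnd.measurable) _).le
    refine (mul_le_mul_right (hswap ε) 2).trans ?_
    rw [← lintegral_const_mul _ (by have := (hm1 ε).measurable; fun_prop)]
    refine lintegral_mono fun z => ?_
    obtain ⟨u, hu, hue⟩ := hT.exists_sSup_image_eq hne (f := fun u =>
      ∑ i, sgn (ε i) * (|inner ℝ u (z i).2| - |inner ℝ u (z i).1|)) (by fun_prop)
    have h3 := le_sSup_image hT (f := fun u => ∑ i, sgn (ε i) * |inner ℝ u (z i).2|)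
      (by fun_prop) hu
    have h4 := le_sSup_image hT (f := fun u => ∑ i, sgn (!ε i) * |inner ℝ u (z i).1|)
      (by fun_prop) hu
    have h5 : ∑ i, sgn (ε i) * (|inner ℝ u (z i).2| - |inner ℝ u (z i).1|) =
        ∑ i, sgn (ε i) * |inner ℝ u (z i).2| + ∑ i, sgn (!ε i) * |inner ℝ u (z i).1| := by
      rw [← Finset.sum_add_distrib]
      refine Finset.sum_congr rfl fun i _ => ?_
      rw [sgn_not]; ring
    simp only
    rw [hue, h5, mul_add]
    refine (two_mul_eexp_add_le _ _).trans ?_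
    rw [← mul_assoc, ← mul_assoc]
    exact add_le_add (eexp_mono (mul_le_mul_of_nonneg_left h3 (by positivity)))
      (eexp_mono (mul_le_mul_of_nonneg_left h4 (by positivity)))
  have hinv : ∑ ε : ι → Bool, A (fun i => !ε i) = ∑ ε, A ε := by
    have : Function.Involutive (fun (ε : ι → Bool) i => !ε i) := fun ε => by simp
    exact Equiv.sum_comp this.toPerm A
  have h2 : 2 * ((Fintype.card (ι → Bool) : ENNReal) * X) ≤ 2 * ∑ ε, A ε := by
    calc 2 * ((Fintype.card (ι → Bool) : ENNReal) * X) = ∑ ε : ι → Bool, 2 * X := by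
          rw [Finset.sum_const, nsmul_eq_mul, Finset.card_univ]; ring
      _ ≤ ∑ ε : ι → Bool, (A ε + A (fun i => !ε i)) := Finset.sum_le_sum fun ε _ => hhalf ε
      _ = 2 * ∑ ε, A ε := by rw [Finset.sum_add_distrib, hinv, two_mul]
  exact (ENNReal.mul_le_mul_iff_right two_ne_zero ENNReal.ofNat_ne_top).1 h2

end Symmetrization

lemma lintegral_pi_eexp_sum {E ι : Type*} [MeasurableSpace E] [Fintype ι] {ν : Measure E}
    [IsProbabilityMeasure ν] {f : ι → E → ℝ}
    (hf : ∀ i, Measurable (f i)) :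
    ∫⁻ a, eexp (∑ i, f i (a i)) ∂(Measure.pi fun _ : ι => ν) = ∏ i, ∫⁻ x, eexp (f i x) ∂ν := by
  simp_rw [eexp_sum]
  have hind := iIndepFun_pi (μ := fun _ : ι => ν) (X := fun i x => eexp (f i x))
    (fun i => (measurable_eexp.comp (hf i)).aemeasurable)
  rw [lintegral_prod_eq_prod_lintegral_of_indepFun Finset.univ _ hind
    (fun i => measurable_eexp.comp ((hf i).comp (measurable_pi_apply i)))]
  refine Finset.prod_congr rfl fun i _ => ?_
  exact (measurePreserving_eval (fun _ : ι => ν) i).lintegral_comp (measurable_eexp.comp (hf i))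

/-! ### Concentration of sums of |⟨u, aᵢ⟩| -/

section Concentration

variable {E : Type*} [NormedAddCommGroup E] [InnerProductSpace ℝ E] [FiniteDimensional ℝ E]
  [MeasurableSpace E] [BorelSpace E] {ι : Type*} [Fintype ι]

lemma lintegral_pi_eexp_inner_sum_le {ν : Measure E} [IsProbabilityMeasure ν] {κ : ℝ}
    (hsub : ∀ w : E, ∫⁻ a, eexp (inner ℝ w a) ∂ν ≤ eexp (κ * ‖w‖ ^ 2 / 2)) (ε : ι → Bool) (w : E) :
    ∫⁻ a, eexp (inner ℝ w (∑ i, sgn (ε i) • a i)) ∂(Measure.pi fun _ : ι => ν) ≤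
      eexp (Fintype.card ι * κ * ‖w‖ ^ 2 / 2) := by
  have h1 : ∀ a : ι → E, inner ℝ w (∑ i, sgn (ε i) • a i) =
      ∑ i, inner ℝ (sgn (ε i) • w) (a i) := fun a => by
    simp [inner_sum, inner_smul_left, inner_smul_right]
  simp_rw [h1]
  rw [lintegral_pi_eexp_sum (f := fun i x => inner ℝ (sgn (ε i) • w) x) (fun i => by fun_prop)]
  calc ∏ i, ∫⁻ x, eexp (inner ℝ (sgn (ε i) • w) x) ∂ν ≤ ∏ _i : ι, eexp (κ * ‖w‖ ^ 2 / 2) := by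
        refine Finset.prod_le_prod' fun i _ => (hsub _).trans_eq ?_
        rw [norm_smul, mul_pow, Real.norm_eq_abs, sq_abs, sgn_sq, one_mul]
    _ = eexp (Fintype.card ι * κ * ‖w‖ ^ 2 / 2) := by
        rw [← eexp_sum, Finset.sum_const, nsmul_eq_mul, Finset.card_univ]
        ring_nf

/-- Uniform lower bound for `∑ᵢ |⟨u, aᵢ⟩|` over the unit vectors `u` of a subspace, for independent
subgaussian vectors `aᵢ`. -/
theorem measure_exists_sum_abs_inner_le {ν : Measure E} [IsProbabilityMeasure ν]
    (hν : ∀ᵐ a ∂ν, ‖a‖ ≤ 1) {κ : ℝ} (hκ : 0 < κ)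
    (hsub : ∀ w : E, ∫⁻ a, eexp (inner ℝ w a) ∂ν ≤ eexp (κ * ‖w‖ ^ 2 / 2))
    {V : Submodule ℝ E} (hV : V ≠ ⊥) [Nonempty ι] {L : ℝ} (hL : 0 ≤ L) :
    (Measure.pi fun _ : ι => ν) {a | ∃ u ∈ V, ‖u‖ = 1 ∧
      ∑ i, |inner ℝ u (a i)| ≤ Fintype.card ι * (∫ x, |inner ℝ u x| ∂ν) -
        2 * (√(Fintype.card ι * κ * Module.finrank ℝ V) + √(2 * (Fintype.card ι * κ) * L))} ≤
      eexp (-L) := by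
  classical
  set P := Measure.pi fun _ : ι => ν with hP
  set K : ℝ := Fintype.card ι * κ with hK
  have hn : (0 : ℝ) < Fintype.card ι := by exact_mod_cast Fintype.card_pos
  have hK0 : 0 < K := by positivity
  have hD : (0 : ℝ) < Module.finrank ℝ V := by
    have : Nontrivial V := (Submodule.nontrivial_iff_ne_bot).2 hV
    exact_mod_cast Module.finrank_pos (R := ℝ) (M := V)
  obtain ⟨α, hα0, hα1, hα⟩ := exists_chi_sq_exponent hK0 hL hD
  set x := √(K * Module.finrank ℝ V) + √(2 * K * L) with hx
  have hx0 : 0 ≤ x := by positivity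
  set T : Set E := {u | u ∈ V ∧ ‖u‖ = 1} with hTdef
  have hT : IsCompact T := by
    have : T = (V : Set E) ∩ Metric.sphere 0 1 := by ext u; simp [hTdef]
    rw [this]
    exact (isCompact_sphere 0 1).inter_left V.closed_of_finiteDimensional
  have hne : T.Nonempty := by
    obtain ⟨v, hv, hv0⟩ := V.ne_bot_iff.1 hV
    exact ⟨‖v‖⁻¹ • v, V.smul_mem _ hv, by simp [norm_smul, hv0]⟩
  have hec := continuous_integral_abs_inner hν
  set Y : (ι → E) → ℝ := fun a => sSup ((fun u =>
    ∑ i, ((∫ x, |inner ℝ u x| ∂ν) - |inner ℝ u (a i)|)) '' T) with hY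
  have hYc : Continuous Y := hT.continuous_sSup (f := fun (a : ι → E) u =>
    ∑ i, ((∫ x, |inner ℝ u x| ∂ν) - |inner ℝ u (a i)|)) (by
      simp only [Function.HasUncurry.uncurry, id]
      have := hec.comp (continuous_snd (X := ι → E) (Y := E))
      simp only [Function.comp_def] at this
      fun_prop)
  set Ψ := ENNReal.ofReal ((1 - α * K) ^ (-(Module.finrank ℝ V : ℝ) / 2)) with hΨ
  -- Chosen so that 2ly = αxy ≤ αx²/2 + αy²/2, which reduces to a χ² moment. The event Y ≥ 2x
  -- becomes lY ≥ αx², and Markov leaves the factor exp(-αx²/2) of `exists_chi_sq_exponent`.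
  set l := α * x / 2 with hl
  have hl0 : 0 ≤ l := by positivity
  have hsup : ∀ (ε : ι → Bool) (a : ι → E),
      2 * l * sSup ((fun u => ∑ i, sgn (ε i) * inner ℝ u (a i)) '' T) ≤
        α * x ^ 2 / 2 + α * ‖V.starProjection (∑ i, sgn (ε i) • a i)‖ ^ 2 / 2 := by
    intro ε a
    obtain ⟨u, hu, hue⟩ := hT.exists_sSup_image_eq hne (f := fun u =>
      ∑ i, sgn (ε i) * inner ℝ u (a i)) (by fun_prop)
    have h1 : ∑ i, sgn (ε i) * inner ℝ u (a i) =
        inner ℝ u (V.starProjection (∑ i, sgn (ε i) • a i)) := by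
      rw [← Submodule.inner_starProjection_left_eq_right,
        Submodule.starProjection_eq_self_iff.2 hu.1]
      simp [inner_sum, inner_smul_right]
    have h2 := real_inner_le_norm u (V.starProjection (∑ i, sgn (ε i) • a i))
    rw [hu.2, one_mul] at h2
    rw [hue, h1, hl]
    nlinarith [mul_nonneg hα0 (sq_nonneg (x - ‖V.starProjection (∑ i, sgn (ε i) • a i)‖)),
      mul_le_mul_of_nonneg_left h2 (mul_nonneg hα0 hx0)]
  have hA : ∀ ε : ι → Bool, ∫⁻ a, eexp (2 * l *
      sSup ((fun u => ∑ i, sgn (ε i) * inner ℝ u (a i)) '' T)) ∂P ≤ eexp (α * x ^ 2 / 2) * Ψ := by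
    intro ε
    calc _ ≤ ∫⁻ a, eexp (α * x ^ 2 / 2) *
          eexp (α * ‖V.starProjection (∑ i, sgn (ε i) • a i)‖ ^ 2 / 2) ∂P := by
          refine lintegral_mono fun a => ?_
          rw [← eexp_add]
          exact eexp_mono (hsup ε a)
      _ = eexp (α * x ^ 2 / 2) *
          ∫⁻ a, eexp (α * ‖V.starProjection (∑ i, sgn (ε i) • a i)‖ ^ 2 / 2) ∂P :=
          lintegral_const_mul _ (by fun_prop)
      _ ≤ _ := by
          refine mul_le_mul_right (lintegral_eexp_sq_norm_projection_le
            (S := fun a : ι → E => ∑ i, sgn (ε i) • a i) (by fun_prop) hα0 hα1 ?_ V) _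
          exact lintegral_pi_eexp_inner_sum_le hsub ε
  -- Symmetrize, remove the absolute values by contraction, and bound every sign pattern alike; the
  -- number of patterns cancels.
  have hX : ∫⁻ a, eexp (l * Y a) ∂P ≤ eexp (α * x ^ 2 / 2) * Ψ := by
    have h1 := card_mul_lintegral_eexp_sSup_le (ι := ι) hν hT hne hl0
    have hm : ∀ (g : ℝ → ℝ), Continuous g → ∀ ε : ι → Bool, Measurable fun a : ι → E =>
        eexp (2 * l * sSup ((fun u => ∑ i, sgn (ε i) * g (inner ℝ u (a i))) '' T)) := by
      intro g hg ε
      have := (hT.continuous_sSup (f := fun (a : ι → E) u =>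
        ∑ i, sgn (ε i) * g (inner ℝ u (a i))) (by
        simp only [Function.HasUncurry.uncurry, id]; fun_prop)).measurable
      fun_prop
    have h2 : ∑ ε : ι → Bool, ∫⁻ a, eexp (2 * l * sSup ((fun u =>
        ∑ i, sgn (ε i) * |inner ℝ u (a i)|) '' T)) ∂P ≤
        ∑ ε : ι → Bool, ∫⁻ a, eexp (2 * l * sSup ((fun u =>
        ∑ i, sgn (ε i) * inner ℝ u (a i)) '' T)) ∂P := by
      rw [← lintegral_finsetSum _ fun ε _ => hm _ continuous_abs ε,
        ← lintegral_finsetSum _ fun ε _ => hm (fun t => t) continuous_id ε]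
      refine lintegral_mono fun a => ?_
      exact sum_map_sSup_abs_le hT hne (F := fun t => eexp (2 * l * t))
        (fun s t hst => eexp_mono (mul_le_mul_of_nonneg_left hst (by positivity)))
        (x := fun i u => inner ℝ u (a i)) (fun i => by fun_prop)
    have h3 := (h1.trans h2).trans (Finset.sum_le_sum fun ε _ => hA ε)
    rw [Finset.sum_const, nsmul_eq_mul, Finset.card_univ] at h3
    exact (ENNReal.mul_le_mul_iff_right (by simp) (ENNReal.natCast_ne_top _)).1 h3
  have hm := measure_le_of_lintegral_eexp_le (P := P) (Y := fun a => l * Y a)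
    (t := α * x ^ 2) (c := eexp (-L)) (by have := hYc.measurable; fun_prop) hX ?_
  swap
  · rw [← mul_assoc, ← eexp_add, show -(α * x ^ 2) + α * x ^ 2 / 2 = -(α * x ^ 2 / 2) by ring,
      eexp, hΨ, ← ENNReal.ofReal_mul (Real.exp_pos _).le]
    exact ENNReal.ofReal_le_ofReal hα
  refine (measure_mono ?_).trans hm
  rintro a ⟨u, huV, hu1, hle⟩
  have h1 := le_sSup_image hT (f := fun u =>
    ∑ i, ((∫ x, |inner ℝ u x| ∂ν) - |inner ℝ u (a i)|)) (by fun_prop) (show u ∈ T from ⟨huV, hu1⟩)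
  have h2 : 2 * x ≤ Y a := by
    refine le_trans ?_ h1
    rw [Finset.sum_sub_distrib, Finset.sum_const, nsmul_eq_mul, Finset.card_univ]
    linarith
  have h3 := mul_le_mul_of_nonneg_left h2 hl0
  show α * x ^ 2 ≤ l * Y a
  refine le_trans (le_of_eq ?_) h3
  rw [hl]; ring

/-- Tail bound for the norm of the projection of a subgaussian vector to a subspace. -/
theorem measure_norm_projection_ge_le {ν : Measure E} [IsProbabilityMeasure ν] {κ : ℝ} (hκ : 0 < κ)
    (hsub : ∀ w : E, ∫⁻ a, eexp (inner ℝ w a) ∂ν ≤ eexp (κ * ‖w‖ ^ 2 / 2))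
    {V : Submodule ℝ E} (hV : V ≠ ⊥) {L : ℝ} (hL : 0 ≤ L) :
    ν {a | √(κ * Module.finrank ℝ V) + √(2 * κ * L) ≤ ‖V.starProjection a‖} ≤ eexp (-L) := by
  have hD : (0 : ℝ) < Module.finrank ℝ V := by
    have : Nontrivial V := (Submodule.nontrivial_iff_ne_bot).2 hV
    exact_mod_cast Module.finrank_pos (R := ℝ) (M := V)
  obtain ⟨α, hα0, hα1, hα⟩ := exists_chi_sq_exponent hκ hL hD
  set x := √(κ * Module.finrank ℝ V) + √(2 * κ * L) with hx
  have hx0 : 0 ≤ x := by positivity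
  have h1 := lintegral_eexp_sq_norm_projection_le (P := ν) (S := id) measurable_id hα0 hα1 hsub V
  refine (measure_mono ?_).trans (measure_le_of_lintegral_eexp_le (t := α * x ^ 2 / 2)
    (by fun_prop) h1 ?_)
  · intro a ha
    have ha' : x ≤ ‖V.starProjection a‖ := ha
    show α * x ^ 2 / 2 ≤ α * ‖V.starProjection (id a)‖ ^ 2 / 2
    simp only [id]
    gcongr
  · rw [eexp, ← ENNReal.ofReal_mul (Real.exp_pos _).le]
    exact ENNReal.ofReal_le_ofReal hα

/-- Subgaussianity passes to the centred absolute value. By Jensen the mean is replaced by an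
independent copy, after which the absolute values can be dropped under cosh and the integral
factorizes. -/
lemma lintegral_eexp_abs_inner_sub_le {ν : Measure E} [IsProbabilityMeasure ν]
    (hν : ∀ᵐ a ∂ν, ‖a‖ ≤ 1) {κ : ℝ}
    (hsub : ∀ w : E, ∫⁻ a, eexp (inner ℝ w a) ∂ν ≤ eexp (κ * ‖w‖ ^ 2 / 2)) (l : ℝ) (v : E) :
    ∫⁻ a, eexp (l * (|inner ℝ v a| - ∫ x, |inner ℝ v x| ∂ν)) ∂ν ≤
      eexp (l ^ 2 * κ * ‖v‖ ^ 2) := by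
  have hint := integrable_abs_inner hν v
  have h1 : ∀ a : E, eexp (l * (|inner ℝ v a| - ∫ x, |inner ℝ v x| ∂ν)) ≤
      ∫⁻ x, eexp (l * (|inner ℝ v a| - |inner ℝ v x|)) ∂ν := by
    intro a
    have h2 : l * (|inner ℝ v a| - ∫ x, |inner ℝ v x| ∂ν) =
        ∫ x, l * (|inner ℝ v a| - |inner ℝ v x|) ∂ν := by
      rw [integral_const_mul, integral_sub (integrable_const _) hint]
      simp
    rw [h2]
    exact eexp_integral_le (((integrable_const _).sub hint).const_mul l)
  have hpt : ∀ s t : ℝ, eexp (l * (|s| - |t|)) + eexp (l * (|t| - |s|)) ≤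
      eexp (l * s) * eexp (-l * t) + eexp (-l * s) * eexp (l * t) := by
    intro s t
    rw [← eexp_add, ← eexp_add]
    simp only [eexp]
    rw [← ENNReal.ofReal_add (Real.exp_pos _).le (Real.exp_pos _).le,
      ← ENNReal.ofReal_add (Real.exp_pos _).le (Real.exp_pos _).le]
    refine ENNReal.ofReal_le_ofReal ?_
    have h3 : Real.cosh (l * (|s| - |t|)) ≤ Real.cosh (l * (s - t)) := by
      rw [Real.cosh_le_cosh, abs_mul, abs_mul]
      exact mul_le_mul_of_nonneg_left (abs_abs_sub_abs_le s t) (abs_nonneg l)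
    rw [Real.cosh_eq, Real.cosh_eq] at h3
    rw [show l * (|t| - |s|) = -(l * (|s| - |t|)) by ring,
      show l * s + -l * t = l * (s - t) by ring, show -l * s + l * t = -(l * (s - t)) by ring]
    linarith
  set J := ∫⁻ a, ∫⁻ x, eexp (l * (|inner ℝ v a| - |inner ℝ v x|)) ∂ν ∂ν with hJ
  have hswap : J = ∫⁻ a, ∫⁻ x, eexp (l * (|inner ℝ v x| - |inner ℝ v a|)) ∂ν ∂ν := by
    rw [hJ, lintegral_lintegral_swap]
    exact Measurable.aemeasurable (by fun_prop)
  have hexp : ∀ c : ℝ, ∫⁻ a, eexp (c * inner ℝ v a) ∂ν ≤ eexp (κ * (c ^ 2 * ‖v‖ ^ 2) / 2) := by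
    intro c
    have := hsub (c • v)
    simpa [inner_smul_left, norm_smul, mul_pow] using this
  have h2J : 2 * J ≤ 2 * eexp (l ^ 2 * κ * ‖v‖ ^ 2) := by
    calc 2 * J = ∫⁻ a, ∫⁻ x, (eexp (l * (|inner ℝ v a| - |inner ℝ v x|)) +
          eexp (l * (|inner ℝ v x| - |inner ℝ v a|))) ∂ν ∂ν := by
          rw [two_mul]
          nth_rewrite 2 [hswap]
          rw [hJ, ← lintegral_add_left (Measurable.lintegral_prod_right'
            (f := fun p : E × E => eexp (l * (|inner ℝ v p.1| - |inner ℝ v p.2|)))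
            (by fun_prop))]
          refine lintegral_congr fun a => ?_
          rw [← lintegral_add_left (by fun_prop)]
      _ ≤ ∫⁻ a, ∫⁻ x, (eexp (l * inner ℝ v a) * eexp (-l * inner ℝ v x) +
          eexp (-l * inner ℝ v a) * eexp (l * inner ℝ v x)) ∂ν ∂ν :=
          lintegral_mono fun a => lintegral_mono fun x => hpt _ _
      _ = (∫⁻ a, eexp (l * inner ℝ v a) ∂ν) * (∫⁻ a, eexp (-l * inner ℝ v a) ∂ν) +
          (∫⁻ a, eexp (-l * inner ℝ v a) ∂ν) * (∫⁻ a, eexp (l * inner ℝ v a) ∂ν) := by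
          rw [← lintegral_mul_const _ (by fun_prop), ← lintegral_mul_const _ (by fun_prop),
            ← lintegral_add_left (by fun_prop)]
          refine lintegral_congr fun a => ?_
          rw [lintegral_add_left (by fun_prop), lintegral_const_mul _ (by fun_prop),
            lintegral_const_mul _ (by fun_prop)]
      _ ≤ eexp (κ * (l ^ 2 * ‖v‖ ^ 2) / 2) * eexp (κ * ((-l) ^ 2 * ‖v‖ ^ 2) / 2) +
          eexp (κ * ((-l) ^ 2 * ‖v‖ ^ 2) / 2) * eexp (κ * (l ^ 2 * ‖v‖ ^ 2) / 2) :=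
          add_le_add (mul_le_mul' (hexp _) (hexp _)) (mul_le_mul' (hexp _) (hexp _))
      _ = 2 * eexp (l ^ 2 * κ * ‖v‖ ^ 2) := by
          rw [← eexp_add, ← eexp_add, two_mul]
          ring_nf
  exact (lintegral_mono h1).trans
    ((ENNReal.mul_le_mul_iff_right two_ne_zero ENNReal.ofNat_ne_top).1 h2J)

/-- Upper tail bound for `∑ᵢ |⟨v, aᵢ⟩|` in a fixed direction `v`. -/
theorem measure_sum_abs_inner_ge_le {ν : Measure E} [IsProbabilityMeasure ν]
    (hν : ∀ᵐ a ∂ν, ‖a‖ ≤ 1) {κ : ℝ} (hκ : 0 < κ)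
    (hsub : ∀ w : E, ∫⁻ a, eexp (inner ℝ w a) ∂ν ≤ eexp (κ * ‖w‖ ^ 2 / 2))
    {v : E} (hv : v ≠ 0) {N : ℝ} (hN : Fintype.card ι ≤ N) (hN0 : 0 < N) {L : ℝ} (hL : 0 ≤ L) :
    (Measure.pi fun _ : ι => ν) {a | Fintype.card ι * (∫ x, |inner ℝ v x| ∂ν) +
        ‖v‖ * (2 * √(N * κ * L)) ≤ ∑ i, |inner ℝ v (a i)|} ≤ eexp (-L) := by
  have hv0 : 0 < ‖v‖ := norm_pos_iff.2 hv
  set t := ‖v‖ * (2 * √(N * κ * L)) with ht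
  -- The minimizer of -lt + N l² κ‖v‖².
  set l := t / (2 * N * κ * ‖v‖ ^ 2) with hl
  have hl0 : 0 ≤ l := by positivity
  have ht2 : t ^ 2 = 4 * ‖v‖ ^ 2 * (N * κ * L) := by
    rw [ht, mul_pow, mul_pow, Real.sq_sqrt (by positivity)]; ring
  have h1 := lintegral_pi_eexp_sum (ι := ι) (ν := ν)
    (f := fun _ a => l * (|inner ℝ v a| - ∫ x, |inner ℝ v x| ∂ν)) (fun i => by fun_prop)
  have h2 : ∫⁻ a, eexp (∑ i : ι, l * (|inner ℝ v (a i)| - ∫ x, |inner ℝ v x| ∂ν))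
      ∂(Measure.pi fun _ : ι => ν) ≤ eexp (N * (l ^ 2 * κ * ‖v‖ ^ 2)) := by
    rw [h1]
    calc _ ≤ ∏ _i : ι, eexp (l ^ 2 * κ * ‖v‖ ^ 2) :=
          Finset.prod_le_prod' fun i _ => lintegral_eexp_abs_inner_sub_le hν hsub l v
      _ = eexp (Fintype.card ι * (l ^ 2 * κ * ‖v‖ ^ 2)) := by
          rw [← eexp_sum, Finset.sum_const, nsmul_eq_mul, Finset.card_univ]
      _ ≤ _ := eexp_mono (mul_le_mul_of_nonneg_right hN (by positivity))
  refine (measure_mono ?_).trans (measure_le_of_lintegral_eexp_le (t := l * t)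
    (Measurable.aemeasurable (Finset.measurable_fun_sum _ fun i _ => by fun_prop)) h2 ?_)
  · intro a ha
    have ha' : Fintype.card ι * (∫ x, |inner ℝ v x| ∂ν) + t ≤ ∑ i, |inner ℝ v (a i)| := ha
    show l * t ≤ ∑ i : ι, l * (|inner ℝ v (a i)| - ∫ x, |inner ℝ v x| ∂ν)
    rw [← Finset.mul_sum, Finset.sum_sub_distrib, Finset.sum_const, nsmul_eq_mul,
      Finset.card_univ]
    exact mul_le_mul_of_nonneg_left (by linarith) hl0
  · rw [← eexp_add]
    refine eexp_mono (le_of_eq ?_)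
    have h3 : l * t = t ^ 2 / (2 * N * κ * ‖v‖ ^ 2) := by rw [hl]; ring
    have h4 : N * (l ^ 2 * κ * ‖v‖ ^ 2) = t ^ 2 / (4 * N * κ * ‖v‖ ^ 2) := by
      rw [hl]; field_simp; ring
    rw [h3, h4, ht2]
    field_simp
    ring

end Concentration

/-! ### The uniform law on the unit sphere of a subspace -/

section SphereLaws

lemma lintegral_eexp_inner_uniformSphere_le {F : Type*} [NormedAddCommGroup F]
    [InnerProductSpace ℝ F] [FiniteDimensional ℝ F] [MeasurableSpace F] [BorelSpace F]
    [Nontrivial F] (w : F) :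
    ∫⁻ a, eexp (inner ℝ w a) ∂(uniformSphere F) ≤
      eexp ((Module.finrank ℝ F : ℝ)⁻¹ * ‖w‖ ^ 2 / 2) := by
  have h := ofReal_integral_eq_lintegral_ofReal (μ := uniformSphere F)
    (f := fun a => Real.exp (inner ℝ w a)) (integrable_uniformSphere (by fun_prop))
    (Filter.Eventually.of_forall fun _ => (Real.exp_pos _).le)
  simp only [eexp]
  rw [← h]
  exact ENNReal.ofReal_le_ofReal (integral_exp_inner_uniformSphere_le w)

variable {M : ℕ} {V : Submodule ℝ (Amb M)}

lemma isProbabilityMeasure_uniformSphereIn (hV : V ≠ ⊥) :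
    IsProbabilityMeasure (uniformSphereIn V) := by
  have : Nontrivial V := (Submodule.nontrivial_iff_ne_bot).2 hV
  exact Measure.isProbabilityMeasure_map measurable_subtype_coe.aemeasurable

lemma ae_uniformSphereIn : ∀ᵐ a ∂(uniformSphereIn V), a ∈ V ∧ ‖a‖ = 1 := by
  have hVm : MeasurableSet (V : Set (Amb M)) := V.closed_of_finiteDimensional.measurableSet
  unfold uniformSphereIn
  have hm : MeasurableSet {a : Amb M | a ∈ V ∧ ‖a‖ = 1} :=
    hVm.inter (measurableSet_eq_fun measurable_norm measurable_const)
  rw [ae_map_iff measurable_subtype_coe.aemeasurable hm]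
  filter_upwards [ae_norm_uniformSphere (F := V)] with a ha
  exact ⟨a.2, ha⟩

lemma lintegral_eexp_inner_uniformSphereIn_le (hV : V ≠ ⊥) (w : Amb M) :
    ∫⁻ a, eexp (inner ℝ w a) ∂(uniformSphereIn V) ≤
      eexp ((Module.finrank ℝ V : ℝ)⁻¹ * ‖w‖ ^ 2 / 2) := by
  have : Nontrivial V := (Submodule.nontrivial_iff_ne_bot).2 hV
  have h := lintegral_eexp_inner_uniformSphere_le (V.orthogonalProjectionOnto w)
  rw [uniformSphereIn, lintegral_map (by fun_prop) measurable_subtype_coe]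
  have h1 : ∀ a : V, inner ℝ w (a : Amb M) = inner ℝ (V.orthogonalProjectionOnto w) a :=
    fun a => (Submodule.inner_orthogonalProjectionOnto_eq_of_mem_right a w).symm
  simp_rw [h1]
  refine h.trans (eexp_mono ?_)
  have := V.norm_orthogonalProjectionOnto_apply_le w
  gcongr

lemma le_integral_abs_inner_uniformSphereIn {u : Amb M} (huV : u ∈ V) (hu : ‖u‖ = 1) :
    √(2 / Real.pi) / √(Module.finrank ℝ V) ≤ ∫ a, |inner ℝ u a| ∂(uniformSphereIn V) := by
  have : Nontrivial V := ⟨⟨⟨u, huV⟩, 0, fun h => by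
    have : u = 0 := congrArg Subtype.val h
    simp [this] at hu⟩⟩
  rw [uniformSphereIn, integral_map measurable_subtype_coe.aemeasurable (by fun_prop)]
  exact le_integral_abs_inner_uniformSphere (u := (⟨u, huV⟩ : V)) hu

lemma uniformSphereIn_submodule_eq_zero {W : Submodule ℝ (Amb M)} (hW : ¬ V ≤ W) :
    uniformSphereIn V (W : Set (Amb M)) = 0 := by
  have hWm : MeasurableSet (W : Set (Amb M)) := W.closed_of_finiteDimensional.measurableSet
  rw [uniformSphereIn, Measure.map_apply measurable_subtype_coe hWm]
  refine uniformSphere_submodule_eq_zero (W := W.comap V.subtype) fun h => hW ?_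
  exact Submodule.comap_subtype_eq_top.1 h

end SphereLaws

/-! ### Separation of values implies recovery; permeance and ρ -/

section Recovery

variable {M no m : ℕ} {n : Fin m → ℕ}

/-- All inliers precede all outliers, so a prefix either contains no outlier and spans a subspace of
W, or contains every inlier and spans at least W. Equal dimension forces equality in both cases. -/
lemma recoversExactly_of_lt {D : Col no n → Amb M} {x : Col no n → ℝ} {r : ℕ}
    {W : Submodule ℝ (Amb M)} (hlt : ∀ i j, x (Sum.inr i) < x (Sum.inl j))
    (hmem : ∀ i, D (Sum.inr i) ∈ W)
    (hspan : W ≤ Submodule.span ℝ (Set.range fun i => D (Sum.inr i)))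
    (hr : Module.finrank ℝ W = r) : RecoversExactly D x r W := by
  intro e he
  have hpos : ∀ i j, e.symm (Sum.inr i) < e.symm (Sum.inl j) := by
    intro i j
    by_contra h
    have := he (not_lt.1 h)
    simp only [Function.comp_apply, Equiv.apply_symm_apply] at this
    exact (hlt i j).not_ge this
  have hall : ∀ N, (∀ i, (e.symm (Sum.inr i)).val < N) → W ≤ prefixSpan D e N := by
    intro N hN
    refine hspan.trans (Submodule.span_mono ?_)
    rintro _ ⟨i, rfl⟩
    exact ⟨_, ⟨e.symm (Sum.inr i), hN i, by simp⟩, rfl⟩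
  have hnone : ∀ N, (∀ j, N ≤ (e.symm (Sum.inl j)).val) → prefixSpan D e N ≤ W := by
    intro N hN
    refine Submodule.span_le.2 ?_
    rintro _ ⟨_, ⟨a, ha, rfl⟩, rfl⟩
    rcases hea : e a with j | i
    · have h1 := hN j
      rw [← hea, Equiv.symm_apply_apply] at h1
      exact absurd ha (not_lt.2 h1)
    · exact hmem i
  refine ⟨?_, fun N hN => ?_⟩
  -- One past the position of the last inlier.
  · refine ⟨Finset.univ.sup fun i => (e.symm (Sum.inr i)).val + 1, ?_⟩
    have h : prefixSpan D e (Finset.univ.sup fun i => (e.symm (Sum.inr i)).val + 1) = W := by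
      refine le_antisymm (hnone _ fun j => ?_) (hall _ fun i => ?_)
      · exact Finset.sup_le fun i _ => hpos i j
      · exact Finset.le_sup (f := fun i => (e.symm (Sum.inr i)).val + 1) (Finset.mem_univ i)
    rw [h, hr]
  · by_cases h : ∀ j, N ≤ (e.symm (Sum.inl j)).val
    · exact Submodule.eq_of_le_of_finrank_eq (hnone N h) (hN.trans hr.symm)
    · push Not at h
      obtain ⟨j, hj⟩ := h
      have : W ≤ prefixSpan D e N := hall N fun i => lt_trans (hpos i j) hj
      exact (Submodule.eq_of_le_of_finrank_eq this (hr.trans hN.symm)).symm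

lemma l1_nonneg {ι : Type*} [Fintype ι] (D : ι → Amb M) (c : Amb M) : 0 ≤ l1 D c :=
  Finset.sum_nonneg fun _ _ => abs_nonneg _

lemma abs_inner_le_l1 {ι : Type*} [Fintype ι] (D : ι → Amb M) (c : Amb M) (i : ι) :
    |inner ℝ c (D i)| ≤ l1 D c :=
  Finset.single_le_sum (f := fun i => |inner ℝ c (D i)|) (fun _ _ => abs_nonneg _)
    (Finset.mem_univ i)

/-- If `v` separates the optimal values of the outliers from those of the inliers, then the
Innovation Values are separated and the subspace is recovered. -/
lemma innovationValue_lt_and_recoversExactly {D : Col no n → Amb M} {c : Col no n → Amb M}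
    (hc : ∀ i, IsOptimalDirection D (D i) (c i)) {r : ℕ} {W : Submodule ℝ (Amb M)} (v : ℝ)
    (hout : ∀ j : Fin no, ∃ c', inner ℝ c' (D (Sum.inl j)) = 1 ∧ l1 D c' ≤ v)
    (hin : ∀ i c', inner ℝ c' (D (Sum.inr i)) = 1 → v < l1 D c')
    (hmem : ∀ i, D (Sum.inr i) ∈ W)
    (hspan : W ≤ Submodule.span ℝ (Set.range fun i => D (Sum.inr i)))
    (hr : Module.finrank ℝ W = r) :
    (∀ (i : Σ k : Fin m, Fin (n k)) (j : Fin no),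
      innovationValue D (c (Sum.inr i)) < innovationValue D (c (Sum.inl j))) ∧
    RecoversExactly D (fun i => innovationValue D (c i)) r W := by
  have h : ∀ (i : Σ k : Fin m, Fin (n k)) (j : Fin no),
      innovationValue D (c (Sum.inr i)) < innovationValue D (c (Sum.inl j)) := by
    intro i j
    obtain ⟨c', hc', hle⟩ := hout j
    have h1 := (hc (Sum.inl j)).2 c' hc'
    have h2 := hin i _ (hc (Sum.inr i)).1
    -- The value of a feasible direction is at least 1, so the reciprocals are taken of positive
    -- numbers.
    have h3 := abs_inner_le_l1 D (c (Sum.inl j)) (Sum.inl j)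
    rw [(hc (Sum.inl j)).1, abs_one] at h3
    exact one_div_lt_one_div_of_lt (by linarith) (by linarith)
  exact ⟨h, recoversExactly_of_lt (fun i j => h i j) hmem hspan hr⟩

lemma rho_bddBelow (U : Fin m → Submodule ℝ (Amb M)) :
    BddBelow (Set.range fun δ : {δ : Amb M // δ ∈ (⨆ k, U k) ∧ ‖δ‖ = 1} =>
      ∑ k, ‖(U k).starProjection δ.1‖) :=
  ⟨0, by rintro _ ⟨δ, rfl⟩; exact Finset.sum_nonneg fun _ _ => norm_nonneg _⟩

lemma rho_nonneg (U : Fin m → Submodule ℝ (Amb M)) : 0 ≤ rho U :=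
  Real.iInf_nonneg fun _ => Finset.sum_nonneg fun _ _ => norm_nonneg _

lemma rho_mul_norm_le (U : Fin m → Submodule ℝ (Amb M)) {u : Amb M} (hu : u ∈ ⨆ k, U k) :
    rho U * ‖u‖ ≤ ∑ k, ‖(U k).starProjection u‖ := by
  rcases eq_or_ne u 0 with rfl | h0
  · simp
  · have hn : 0 < ‖u‖ := norm_pos_iff.2 h0
    have h := ciInf_le (rho_bddBelow U) ⟨‖u‖⁻¹ • u, Submodule.smul_mem _ _ hu, by
      simp [norm_smul, hn.ne']⟩
    simp only [map_smul, norm_smul, norm_inv, norm_norm] at h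
    rw [← Finset.mul_sum, inv_mul_eq_div, le_div_iff₀ hn] at h
    exact h

/-- A proper subspace `W` of `V` is orthogonal to some unit vector of `V`. -/
lemma exists_unit_orthogonal {W V : Submodule ℝ (Amb M)} (hle : W ≤ V) (hne : ¬ V ≤ W) :
    ∃ u ∈ V, ‖u‖ = 1 ∧ ∀ w ∈ W, inner ℝ u w = 0 := by
  obtain ⟨x, hxV, hxW⟩ := SetLike.not_le_iff_exists.1 hne
  set y := x - W.starProjection x with hy
  have hy0 : y ≠ 0 := fun h => hxW (by
    rw [sub_eq_zero.1 h]; exact W.starProjection_apply_mem x)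
  refine ⟨‖y‖⁻¹ • y, V.smul_mem _ (V.sub_mem hxV (hle (W.starProjection_apply_mem x))), by
    simp [norm_smul, hy0], fun w hw => ?_⟩
  rw [inner_smul_left, hy,
    Submodule.inner_left_of_mem_orthogonal hw (W.sub_starProjection_mem_orthogonal x), mul_zero]

/-- Independence provides a unit vector of 𝒰 orthogonal to all subspaces but one; its sum of
projections has a single nonzero term. -/
lemma rho_le_one {U : Fin m → Submodule ℝ (Amb M)} (hU : iSupIndep U) (k : Fin m)
    (hk : U k ≠ ⊥) : rho U ≤ 1 := by
  have hle : (⨆ l, ⨆ (_ : l ≠ k), U l) ≤ ⨆ l, U l := iSup₂_le fun l _ => le_iSup U l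
  have hne : ¬ (⨆ l, U l) ≤ ⨆ l, ⨆ (_ : l ≠ k), U l := by
    intro h
    exact hk ((hU k).eq_bot_of_le ((le_iSup U k).trans h))
  obtain ⟨u, hu, hu1, horth⟩ := exists_unit_orthogonal hle hne
  have h := rho_mul_norm_le U hu
  rw [hu1, mul_one, Finset.sum_eq_single k] at h
  · exact h.trans (((U k).norm_starProjection_apply_le u).trans hu1.le)
  · intro l _ hl
    rw [norm_eq_zero, Submodule.starProjection_apply_eq_zero_iff]
    intro w hw
    rw [real_inner_comm]
    exact horth w ((le_iSup₂_of_le (f := fun l (_ : l ≠ k) => U l) l hl le_rfl) hw)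
  · simp

lemma permeance_mul_norm_le {ι : Type*} [Fintype ι] (V : Submodule ℝ (Amb M)) (A : ι → Amb M)
    {u : Amb M} (hu : u ∈ V) : permeance V A * ‖u‖ ≤ l1 A u := by
  rcases eq_or_ne u 0 with rfl | h0
  · simp [l1]
  · have hn : 0 < ‖u‖ := norm_pos_iff.2 h0
    have hb : BddBelow (Set.range fun δ : {δ : Amb M // δ ∈ V ∧ ‖δ‖ = 1} => l1 A δ.1) :=
      ⟨0, by rintro _ ⟨δ, rfl⟩; exact l1_nonneg _ _⟩
    have h := ciInf_le hb ⟨‖u‖⁻¹ • u, V.smul_mem _ hu, by simp [norm_smul, hn.ne']⟩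
    simp only [l1, inner_smul_left, conj_trivial, abs_mul, abs_inv, abs_norm] at h
    rw [← Finset.mul_sum, inv_mul_eq_div, le_div_iff₀ hn] at h
    exact h

/-- The inliers force a large objective value on directions with a component in their span. -/
lemma rho_mul_mul_norm_le_l1 {U : Fin m → Submodule ℝ (Amb M)}
    {A : (k : Fin m) → Fin (n k) → Amb M} (hA : ∀ k i, A k i ∈ U k) {p : ℝ} (hp : 0 ≤ p)
    (hperm : ∀ k, p ≤ permeance (U k) (A k)) (c : Amb M) :
    rho U * p * ‖(⨆ k, U k).starProjection c‖ ≤ ∑ k, l1 (A k) c := by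
  have h1 := rho_mul_norm_le U ((⨆ k, U k).starProjection_apply_mem c)
  calc rho U * p * ‖(⨆ k, U k).starProjection c‖
      = p * (rho U * ‖(⨆ k, U k).starProjection c‖) := by ring
    _ ≤ p * ∑ k, ‖(U k).starProjection ((⨆ k, U k).starProjection c)‖ :=
        mul_le_mul_of_nonneg_left h1 hp
    _ = ∑ k, p * ‖(U k).starProjection c‖ := by
        rw [Finset.mul_sum]
        refine Finset.sum_congr rfl fun k _ => ?_
        rw [← ContinuousLinearMap.comp_apply,
          Submodule.starProjection_comp_starProjection_of_le (le_iSup U k)]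
    _ ≤ ∑ k, l1 (A k) c := by
        refine Finset.sum_le_sum fun k _ => ?_
        have h2 := permeance_mul_norm_le (U k) (A k) ((U k).starProjection_apply_mem c)
        refine (mul_le_mul_of_nonneg_right (hperm k) (norm_nonneg _)).trans (h2.trans_eq ?_)
        refine Finset.sum_congr rfl fun i _ => ?_
        rw [Submodule.inner_starProjection_left_eq_right,
          Submodule.starProjection_eq_self_iff.2 (hA k i)]

end Recovery

/-! ### Conditioning and general position -/

section Independence

variable {Ω : Type*} [MeasurableSpace Ω] {μ : Measure Ω} [IsProbabilityMeasure μ]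

/-- Conditioning on the first of two independent random variables. -/
lemma measure_pair_mem_le {α β : Type*} [MeasurableSpace α] [MeasurableSpace β] {X : Ω → α}
    {Y : Ω → β} (h : IndepFun X Y μ) (hX : AEMeasurable X μ) (hY : AEMeasurable Y μ)
    {B : Set (α × β)} (hB : MeasurableSet B) {p : ENNReal}
    (hp : ∀ x, μ.map Y {y | (x, y) ∈ B} ≤ p) : μ {ω | (X ω, Y ω) ∈ B} ≤ p := by
  have := Measure.isProbabilityMeasure_map hX (μ := μ)
  have := Measure.isProbabilityMeasure_map hY (μ := μ)
  have h1 := (indepFun_iff_map_prod_eq_prod_map_map hX hY).1 h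
  calc μ {ω | (X ω, Y ω) ∈ B} ≤ μ.map (fun ω => (X ω, Y ω)) B :=
        Measure.le_map_apply (hX.prodMk hY) B
    _ = ∫⁻ x, μ.map Y (Prod.mk x ⁻¹' B) ∂(μ.map X) := by rw [h1, Measure.prod_apply hB]
    _ ≤ ∫⁻ _, p ∂(μ.map X) := lintegral_mono fun x => hp x
    _ = p := by simp

lemma map_subfamily_eq_pi {E ι ι' : Type*} [MeasurableSpace E] [Fintype ι'] {D : ι → Ω → E}
    (hind : iIndepFun D μ) {f : ι' → ι} (hf : f.Injective) {ν : Measure E}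
    (hlaw : ∀ i, HasLaw (D (f i)) ν μ) :
    μ.map (fun ω i => D (f i) ω) = Measure.pi fun _ : ι' => ν := by
  have h := (iIndepFun_iff_map_fun_eq_pi_map (fun i => (hlaw i).aemeasurable)).1 (hind.precomp hf)
  rw [h]
  congr 1
  ext1 i
  exact (hlaw i).map_eq

variable {M : ℕ}

/-- Membership asks for coefficients. With coefficients in a compact ball the set is the projection
of a closed set along a compact factor, hence closed; the union over integer radii is countable. -/
lemma measurableSet_mem_sup_span {ι : Type*} [Fintype ι] (W : Submodule ℝ (Amb M)) :
    MeasurableSet {p : (ι → Amb M) × Amb M | p.2 ∈ W ⊔ Submodule.span ℝ (Set.range p.1)} := by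
  have h : {p : (ι → Amb M) × Amb M | p.2 ∈ W ⊔ Submodule.span ℝ (Set.range p.1)} =
      ⋃ N : ℕ, Prod.fst '' {q : ((ι → Amb M) × Amb M) × Metric.closedBall (0 : ι → ℝ) N |
        q.1.2 - ∑ i, q.2.1 i • q.1.1 i ∈ W} := by
    ext p
    rw [Set.mem_ofPred_eq, Set.mem_iUnion]
    constructor
    · intro hp
      obtain ⟨w, hw, y, hy, hwy⟩ := Submodule.mem_sup.1 hp
      obtain ⟨c, hc⟩ := (Submodule.mem_span_range_iff_exists_fun ℝ).1 hy
      obtain ⟨N, hN⟩ := exists_nat_ge ‖c‖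
      refine ⟨N, ⟨p, ⟨c, by simpa using hN⟩⟩, ?_, rfl⟩
      change p.2 - ∑ i, c i • p.1 i ∈ W
      rw [hc, ← hwy, add_sub_cancel_right]
      exact hw
    · rintro ⟨N, ⟨q, c⟩, hq, rfl⟩
      change q.2 ∈ _
      rw [← sub_add_cancel q.2 (∑ i, c.1 i • q.1 i)]
      exact Submodule.add_mem_sup hq
        ((Submodule.mem_span_range_iff_exists_fun ℝ).2 ⟨c.1, rfl⟩)
  rw [h]
  refine MeasurableSet.iUnion fun N => IsClosed.measurableSet ?_
  have : CompactSpace (Metric.closedBall (0 : ι → ℝ) N) :=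
    isCompact_iff_compactSpace.1 (isCompact_closedBall _ _)
  refine isClosedMap_fst_of_compactSpace _ ?_
  exact W.closed_of_finiteDimensional.preimage ((continuous_snd.comp continuous_fst).sub
    (continuous_finsetSum _ fun i _ => ((continuous_apply i).comp
      (continuous_subtype_val.comp continuous_snd)).smul
        ((continuous_apply i).comp (continuous_fst.comp continuous_fst))))

/-- A random vector whose law does not charge proper subspaces of `V` avoids the span of few
independent random vectors. -/
lemma ae_notMem_sup_span {ι : Type*} {D : ι → Ω → Amb M} (hind : iIndepFun D μ)
    (hm : ∀ i, AEMeasurable (D i) μ) {S : Finset ι} {j : ι} (hj : j ∉ S)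
    {V W : Submodule ℝ (Amb M)} {ν : Measure (Amb M)} (hlaw : HasLaw (D j) ν μ)
    (hnull : ∀ W : Submodule ℝ (Amb M), ¬ V ≤ W → ν (W : Set (Amb M)) = 0)
    (hdim : Module.finrank ℝ W + S.card < Module.finrank ℝ V) :
    ∀ᵐ ω ∂μ, D j ω ∉ W ⊔ Submodule.span ℝ ((fun i => D i ω) '' S) := by
  have hi := hind.indepFun_finset₀ S {j} (by simpa using hj) hm
  have hi2 : IndepFun (fun ω (i : S) => D i ω) (D j) μ :=
    hi.comp (φ := id) (ψ := fun y : ({j} : Finset ι) → Amb M => y ⟨j, Finset.mem_singleton_self j⟩)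
      measurable_id (measurable_pi_apply _)
  -- For fixed values of the vectors in S, the subspace has dimension below dim V, so it does not
  -- contain V and is a null set for ν.
  have h := measure_pair_mem_le (p := 0) hi2 (aemeasurable_pi_lambda _ fun i => hm i) (hm j)
    (measurableSet_mem_sup_span (ι := S) W) (fun x => by
      rw [hlaw.map_eq]
      refine (hnull (W ⊔ Submodule.span ℝ (Set.range x)) fun hle => ?_).le
      have h1 := Submodule.finrank_mono hle
      have h2 := Submodule.finrank_add_le_finrank_add_finrank W (Submodule.span ℝ (Set.range x))
      have h3 := finrank_range_le_card (R := ℝ) x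
      rw [Fintype.card_coe] at h3
      simp only [Set.finrank] at h3
      omega)
  rw [ae_iff]
  refine le_antisymm ((measure_mono ?_).trans h) bot_le
  intro ω hω
  simp only [Set.mem_ofPred_eq, not_not] at hω ⊢
  convert hω using 3
  rw [Set.image_eq_range]
  rfl

/-- Vectors are added one at a time: fewer than dim V of them cannot span V, so the next one almost
surely avoids their span. -/
lemma ae_linearIndepOn {ι : Type*} [DecidableEq ι] {D : ι → Ω → Amb M} (hind : iIndepFun D μ)
    (hm : ∀ i, AEMeasurable (D i) μ) {V : Submodule ℝ (Amb M)} {ν : Measure (Amb M)}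
    (hnull : ∀ W : Submodule ℝ (Amb M), ¬ V ≤ W → ν (W : Set (Amb M)) = 0) (S : Finset ι)
    (hlaw : ∀ i ∈ S, HasLaw (D i) ν μ) (hcard : S.card ≤ Module.finrank ℝ V) :
    ∀ᵐ ω ∂μ, LinearIndepOn ℝ (fun i => D i ω) (S : Set ι) := by
  induction S using Finset.induction_on with
  | empty => simp [linearIndepOn_empty]
  | insert j S hj ih =>
    rw [Finset.card_insert_of_notMem hj] at hcard
    filter_upwards [ih (fun i hi => hlaw i (Finset.mem_insert_of_mem hi)) (by omega),
      ae_notMem_sup_span hind hm hj (hlaw j (Finset.mem_insert_self _ _)) hnull (W := ⊥)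
        (by rw [finrank_bot]; omega)] with ω h1 h2
    rw [Finset.coe_insert, linearIndepOn_insert (by simpa using hj)]
    rw [bot_sup_eq] at h2
    exact ⟨h1, h2⟩

lemma ae_le_span_of_card {ι : Type*} [DecidableEq ι] {D : ι → Ω → Amb M} (hind : iIndepFun D μ)
    (hm : ∀ i, AEMeasurable (D i) μ) {V : Submodule ℝ (Amb M)} (S : Finset ι)
    (hlaw : ∀ i ∈ S, HasLaw (D i) (uniformSphereIn V) μ) (hcard : Module.finrank ℝ V ≤ S.card) :
    ∀ᵐ ω ∂μ, V ≤ Submodule.span ℝ ((fun i => D i ω) '' S) := by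
  -- Exactly dim V of the vectors, which then form a basis of V.
  obtain ⟨S', hS', hc⟩ := Finset.exists_subset_card_eq hcard
  have hmem : ∀ᵐ ω ∂μ, ∀ i ∈ S', D i ω ∈ V := by
    rw [Finset.eventually_all]
    intro i hi
    have h := hlaw i (hS' hi)
    have h2 := ae_uniformSphereIn (V := V)
    rw [← h.map_eq] at h2
    exact (ae_of_ae_map h.aemeasurable h2).mono fun ω hω => hω.1
  filter_upwards [hmem, ae_linearIndepOn hind hm (fun W hW => uniformSphereIn_submodule_eq_zero hW)
    S' (fun i hi => hlaw i (hS' hi)) hc.le] with ω h1 h2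
  have h3 : Submodule.span ℝ ((fun i => D i ω) '' S') = V := by
    refine Submodule.eq_of_le_of_finrank_eq (Submodule.span_le.2 ?_) ?_
    · rintro _ ⟨i, hi, rfl⟩
      exact h1 i hi
    · rw [Set.image_eq_range]
      exact (finrank_span_eq_card (R := ℝ) h2).trans (by simp [hc])
  rw [← h3]
  exact Submodule.span_mono (Set.image_mono (by exact_mod_cast hS'))

end Independence

/-! ### The three high-probability events -/

section Events

variable {Ω : Type*} [MeasurableSpace Ω] {μ : Measure Ω} {M : ℕ}

lemma measure_norm_projection_sphere_ge_le {V : Submodule ℝ (Amb M)} (hV : V ≠ ⊥) {X : Ω → Amb M}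
    (hlaw : HasLaw X (uniformSphere (Amb M)) μ) {L : ℝ} (hL : 0 ≤ L) :
    μ {ω | √(Module.finrank ℝ V / M) + √(2 * L / M) ≤ ‖V.starProjection (X ω)‖} ≤ eexp (-L) := by
  have hnt : Nontrivial (Amb M) := by
    obtain ⟨v, -, hv⟩ := V.ne_bot_iff.1 hV
    exact ⟨⟨v, 0, hv⟩⟩
  have hM : (0 : ℝ) < M := by
    have := Module.finrank_pos (R := ℝ) (M := Amb M)
    rw [finrank_euclideanSpace_fin] at this
    exact_mod_cast this
  have h := measure_norm_projection_ge_le (ν := uniformSphere (Amb M)) (κ := (M : ℝ)⁻¹)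
    (inv_pos.2 hM) (fun w => by
      simpa using lintegral_eexp_inner_uniformSphere_le w) hV hL
  rw [← hlaw.map_eq] at h
  refine le_trans (le_trans (measure_mono ?_) (Measure.le_map_apply hlaw.aemeasurable _)) h
  intro ω hω
  simp only [Set.mem_ofPred_eq, Set.mem_preimage] at hω ⊢
  rwa [inv_mul_eq_div, show 2 * (M : ℝ)⁻¹ * L = 2 * L / M by ring]

variable [IsProbabilityMeasure μ] {ι : Type*} {D : ι → Ω → Amb M}

/-- With high probability, the permeance of a cluster is large. -/
lemma measure_permeance_lt_le (hind : iIndepFun D μ) {V : Submodule ℝ (Amb M)} {d N : ℕ}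
    (hd : Module.finrank ℝ V = d) (hd0 : 0 < d) (hN : 0 < N) {f : Fin N → ι} (hf : f.Injective)
    (hlaw : ∀ i, HasLaw (D (f i)) (uniformSphereIn V) μ) {L : ℝ} (hL : 0 ≤ L) :
    μ {ω | permeance V (fun i => D (f i) ω) <
      √(2 / Real.pi) * (N / √(d : ℝ)) - 2 * √(N : ℝ) - 2 * √(2 * N * L / d)} ≤ eexp (-L) := by
  have hd0' : (0 : ℝ) < d := by exact_mod_cast hd0
  have hV : V ≠ ⊥ := by
    rintro rfl
    rw [finrank_bot] at hd
    omega
  have := isProbabilityMeasure_uniformSphereIn hV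
  have : Nonempty (Fin N) := ⟨⟨0, hN⟩⟩
  have h := measure_exists_sum_abs_inner_le (ι := Fin N) (ν := uniformSphereIn V)
    (ae_uniformSphereIn.mono fun a ha => ha.2.le) (inv_pos.2 (hd ▸ hd0'))
    (lintegral_eexp_inner_uniformSphereIn_le hV) hV hL
  rw [← map_subfamily_eq_pi hind hf hlaw] at h
  refine le_trans (le_trans (measure_mono ?_) (Measure.le_map_apply
    (aemeasurable_pi_lambda _ fun i => (hlaw i).aemeasurable) _)) h
  intro ω hω
  simp only [Set.mem_ofPred_eq, Set.mem_preimage] at hω ⊢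
  obtain ⟨v, hv, hv0⟩ := V.ne_bot_iff.1 hV
  have : Nonempty {δ : Amb M // δ ∈ V ∧ ‖δ‖ = 1} :=
    ⟨⟨‖v‖⁻¹ • v, V.smul_mem _ hv, by simp [norm_smul, hv0]⟩⟩
  obtain ⟨⟨u, huV, hu1⟩, hu⟩ := exists_lt_of_ciInf_lt hω
  refine ⟨u, huV, hu1, hu.le.trans ?_⟩
  have h1 := le_integral_abs_inner_uniformSphereIn huV hu1
  rw [hd] at h1 ⊢
  have h2 : (N : ℝ) * (√(2 / Real.pi) / √(d : ℝ)) ≤ N * ∫ a, |inner ℝ u a| ∂(uniformSphereIn V) :=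
    mul_le_mul_of_nonneg_left h1 (by positivity)
  -- The variance proxy 1/d cancels the dimension d, leaving 2√N.
  have h3 : (Fintype.card (Fin N) : ℝ) * (d : ℝ)⁻¹ * d = N := by
    rw [Fintype.card_fin, inv_mul_cancel_right₀ hd0'.ne']
  have h4 : 2 * ((Fintype.card (Fin N) : ℝ) * (d : ℝ)⁻¹) * L = 2 * N * L / d := by
    rw [Fintype.card_fin]; field_simp
  rw [h3, h4, Fintype.card_fin]
  have h5 : √(2 / Real.pi) * (N / √(d : ℝ)) = N * (√(2 / Real.pi) / √(d : ℝ)) := by ring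
  linarith

/-- With high probability, the other outliers have a small component along the part of an outlier
that is orthogonal to `V`. -/
lemma measure_sum_abs_inner_projection_ge_le (hind : iIndepFun D μ)
    (hm : ∀ i, AEMeasurable (D i) μ) (V : Submodule ℝ (Amb M)) (hM : 2 ≤ M) {N : ℕ} {f : Fin N → ι}
    (hf : f.Injective) (hlaw : ∀ i, HasLaw (D (f i)) (uniformSphere (Amb M)) μ) (j : Fin N)
    {L : ℝ} (hL : 0 ≤ L) :
    μ {ω | V.starProjection (D (f j) ω) ≠ 0 ∧ ‖V.starProjection (D (f j) ω)‖ *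
        (N * (√(2 / Real.pi) / (√M * (1 - 1 / M))) + 2 * √(N * L / M)) ≤
          ∑ i ∈ Finset.univ.erase j, |inner ℝ (V.starProjection (D (f j) ω)) (D (f i) ω)|} ≤
      eexp (-L) := by
  have hM' : (2 : ℝ) ≤ M := by exact_mod_cast hM
  have hnt : Nontrivial (Amb M) := by
    refine Module.nontrivial_of_finrank_pos (R := ℝ) ?_
    rw [finrank_euclideanSpace_fin]; omega
  have hN : 0 < N := j.pos
  set e := √(2 / Real.pi) / (√(M : ℝ) * (1 - 1 / M)) with he
  have he0 : 0 ≤ e := by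
    have : 0 ≤ 1 - 1 / (M : ℝ) := by
      rw [sub_nonneg, div_le_one (by linarith)]; linarith
    positivity
  -- Given outlier j the direction is fixed and the other outliers are independent of it. They
  -- number N - 1, and N is used as an upper bound.
  have hind' := hind.precomp hf
  have hi := hind'.indepFun_finset₀ {j} (Finset.univ.erase j) (by simp) (fun i => hm _)
  have hi2 : IndepFun (D (f j)) (fun ω (i : (Finset.univ.erase j : Finset (Fin N))) =>
      D (f i) ω) μ :=
    hi.comp (φ := fun y : ({j} : Finset (Fin N)) → Amb M => y ⟨j, Finset.mem_singleton_self j⟩)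
      (ψ := id) (measurable_pi_apply _) measurable_id
  set Q := V.starProjection with hQ
  set B : Set (Amb M × (↥(Finset.univ.erase j) → Amb M)) :=
    {p | Q p.1 ≠ 0 ∧ ‖Q p.1‖ * (N * e + 2 * √(N * L / M)) ≤ ∑ i, |inner ℝ (Q p.1) (p.2 i)|} with hB
  have hBm : MeasurableSet B := by
    refine MeasurableSet.inter ?_ ?_
    · exact (measurableSet_eq_fun (f := fun p : Amb M × (↥(Finset.univ.erase j) →
        Amb M) => Q p.1) (by fun_prop) measurable_const).compl
    · exact measurableSet_le
        (f := fun p : Amb M × (↥(Finset.univ.erase j) → Amb M) =>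
          ‖Q p.1‖ * (N * e + 2 * √(N * L / M)))
        (g := fun p => ∑ i, |inner ℝ (Q p.1) (p.2 i)|) (by fun_prop)
        (Finset.measurable_fun_sum _ fun i _ => by fun_prop)
  have h := measure_pair_mem_le (p := eexp (-L)) hi2 (hm _)
    (aemeasurable_pi_lambda _ fun i => hm _) hBm (fun x => by
      rw [map_subfamily_eq_pi hind (f := fun i : (Finset.univ.erase j : Finset (Fin N)) => f i)
        (hf.comp Subtype.val_injective) (fun i => hlaw i)]
      by_cases hx : Q x = 0
      · simp [hB, hx]
      · have hcard : (Fintype.card (Finset.univ.erase j : Finset (Fin N)) : ℝ) ≤ N := by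
          rw [Fintype.card_coe, Finset.card_erase_of_mem (Finset.mem_univ j), Finset.card_univ,
            Fintype.card_fin]
          exact_mod_cast Nat.sub_le N 1
        have h1 := measure_sum_abs_inner_ge_le (ι := (Finset.univ.erase j : Finset (Fin N)))
          (ν := uniformSphere (Amb M)) (κ := (M : ℝ)⁻¹)
          (ae_norm_uniformSphere.mono fun a ha => ha.le) (inv_pos.2 (by linarith))
          (fun w => by simpa using lintegral_eexp_inner_uniformSphere_le w) hx hcard
          (by exact_mod_cast hN) hL
        refine (measure_mono ?_).trans h1
        rintro y ⟨-, hy⟩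
        refine le_trans ?_ hy
        have h2 : ∫ a, |inner ℝ (Q x) a| ∂(uniformSphere (Amb M)) ≤ ‖Q x‖ * e := by
          have hx0 : 0 < ‖Q x‖ := norm_pos_iff.2 hx
          have h3 := integral_abs_inner_uniformSphere_le (u := ‖Q x‖⁻¹ • Q x)
            (by simp [norm_smul, hx0.ne']) (by simpa using hM)
          simp only [inner_smul_left, conj_trivial, abs_mul, abs_inv, abs_norm] at h3
          rw [integral_const_mul, inv_mul_eq_div, div_le_iff₀ hx0, finrank_euclideanSpace_fin,
            mul_comm] at h3
          exact h3
        have h4 : (0 : ℝ) ≤ ‖Q x‖ * e := by positivity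
        have h5 := mul_le_mul hcard h2 (integral_nonneg fun _ => abs_nonneg _) (Nat.cast_nonneg N)
        have h6 : (N : ℝ) * (M : ℝ)⁻¹ * L = N * L / M := by ring
        rw [h6]
        linarith)
  refine (measure_mono ?_).trans h
  rintro ω ⟨h1, h2⟩
  refine ⟨h1, h2.trans_eq ?_⟩
  exact (Finset.sum_coe_sort (Finset.univ.erase j)
    (fun i => |inner ℝ (Q (D (f j) ω)) (D (f i) ω)|)).symm

end Events

/-! ### Numerical estimates -/

section Numerics

lemma sqrt_two_div_pi_bounds : 0.79788 ≤ √(2 / Real.pi) ∧ √(2 / Real.pi) ≤ 0.7979 := by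
  have h1 := Real.pi_gt_d6
  have h2 := Real.pi_lt_d6
  constructor
  · refine Real.le_sqrt_of_sq_le ?_
    rw [le_div_iff₀ Real.pi_pos]
    linarith
  · rw [Real.sqrt_le_left (by norm_num), div_le_iff₀ Real.pi_pos]
    linarith

/-- A quadratic self-bound for the deviation `ℓ` makes it a fraction `τ` of `Z`. -/
lemma le_mul_of_sq_le {Z ℓ L L' σ τ : ℝ} (hL : 0 ≤ L) (hL' : L + 1 ≤ L') (hτ0 : 0 < τ) (hτ1 : τ ≤ 1)
    (hτ : 0.53 ≤ τ ^ 2 * σ) (hσ : 0 ≤ σ) (hZ : 16.97 * L' * σ ≤ Z)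
    (hℓ : ℓ ^ 2 ≤ 7.0904 * L * Z + 7.0904 * √L * ℓ) : ℓ ≤ τ * Z := by
  by_contra! h
  set s := √L with hs
  have hs0 : 0 ≤ s := Real.sqrt_nonneg _
  have hsL : s ^ 2 = L := Real.sq_sqrt hL
  have hZ0 : 0 ≤ Z := le_trans (mul_nonneg (by linarith) hσ) hZ
  have hℓ0 : 0 < ℓ := lt_of_le_of_lt (by positivity) h
  -- Multiply the self-bound by τ, replace τZ by the larger ℓ, and divide by ℓ.
  have h1 : τ * ℓ ≤ 7.0904 * s ^ 2 + 7.0904 * τ * s := by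
    have h2 : τ * ℓ * ℓ ≤ (7.0904 * s ^ 2 + 7.0904 * τ * s) * ℓ := by
      have h3 : s ^ 2 * (τ * Z) ≤ s ^ 2 * ℓ := mul_le_mul_of_nonneg_left h.le (sq_nonneg s)
      have h4 := mul_le_mul_of_nonneg_left hℓ hτ0.le
      rw [← hsL] at h4
      nlinarith
    exact le_of_mul_le_mul_right h2 hℓ0
  have h5 : 16.97 * 0.53 * (s ^ 2 + 1) ≤ τ ^ 2 * Z := by
    have h6 := mul_le_mul_of_nonneg_left hZ (sq_nonneg τ)
    have h7 : 0.53 * (16.97 * L') ≤ τ ^ 2 * σ * (16.97 * L') :=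
      mul_le_mul_of_nonneg_right hτ (by linarith)
    nlinarith
  have h8 : τ ^ 2 * Z < τ * ℓ := by nlinarith
  have h9 : τ * s ≤ s := by nlinarith
  -- The bounds combine to 8.9941(s² + 1) < 7.0904(s² + s). The difference is a quadratic in s with
  -- negative discriminant, minimal near 1.9.
  nlinarith [sq_nonneg (s - 1.9)]

/-- τ is the share of Z conceded to the deviation. It is chosen so that (1 - τ)(σ + 4) = 0.926σ +
0.356, slightly more than the outliers need. The bound 0.53 ≤ τ²σ feeds `le_mul_of_sq_le` and is
nearly tight at 0.942, just below √(8/9). -/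
lemma exists_contraction_factor {σ : ℝ} (hσ : 0.942 ≤ σ) : ∃ τ : ℝ, 0 < τ ∧ τ ≤ 1 ∧
    0.53 ≤ τ ^ 2 * σ ∧ τ * (σ + 4) = 0.074 * σ + 3.644 := by
  have hσ4 : 0 < σ + 4 := by linarith
  have hτσ : (0.074 * σ + 3.644) / (σ + 4) * (σ + 4) = 0.074 * σ + 3.644 := by field_simp
  refine ⟨(0.074 * σ + 3.644) / (σ + 4), by positivity, ?_, ?_, hτσ⟩
  · rw [div_le_one hσ4]; linarith
  · refine le_of_mul_le_mul_right (a := (σ + 4) ^ 2) ?_ (by positivity)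
    calc 0.53 * (σ + 4) ^ 2 ≤ (0.074 * σ + 3.644) ^ 2 * σ := by
          have : 0 ≤ σ ^ 3 := by positivity
          nlinarith [sq_nonneg σ]
      _ = _ := by field_simp

/-- With S = √M and σ = √(N/M), `h3` reads Sσ(σ + 4) ≤ Z, so at least Sσ(0.926σ + 0.356) remains
after the deviation. The outliers need 1 + 1.15471·Sσ(0.80145σ + 0.23572). The σ-coefficient fits,
and the slack of more than 0.083·Sσ in the constant one, with Sσ ≥ 15·0.942, pays for the 1. -/
lemma outlier_bound_lt {M N L L' Z ℓ : ℝ} (hM : 227 ≤ M) (hN : 8 / 9 * M ≤ N) (hLM : 72 * L' ≤ M)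
    (hL : 0 ≤ L) (hL' : L + 1 ≤ L') (h1 : 2 * √72 * L' * √(N / M) ≤ Z) (h3 : N / √M + 4 * √N ≤ Z)
    (hℓ : ℓ ^ 2 ≤ 7.0904 * L * Z + 7.0904 * √L * ℓ) :
    1 + 2 / √3 * (N * (√(2 / Real.pi) / (√M * (1 - 1 / M))) + 2 * √(N * L' / M)) < Z - ℓ := by
  have hM0 : 0 < M := by linarith
  have hN0 : 0 ≤ N := by linarith
  obtain ⟨S, hS, hSM⟩ : ∃ S, 0 < S ∧ S ^ 2 = M := ⟨√M, Real.sqrt_pos.2 hM0, Real.sq_sqrt hM0.le⟩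
  obtain ⟨σ, hσ, hσM⟩ : ∃ σ, 0 ≤ σ ∧ σ ^ 2 = N / M :=
    ⟨√(N / M), Real.sqrt_nonneg _, Real.sq_sqrt (by positivity)⟩
  obtain ⟨t, ht, htL⟩ : ∃ t, 0 ≤ t ∧ t ^ 2 = L' :=
    ⟨√L', Real.sqrt_nonneg _, Real.sq_sqrt (by linarith)⟩
  have hNS : N = (S * σ) ^ 2 := by rw [mul_pow, hσM, hSM]; field_simp
  have e1 : √M = S := by rw [← hSM, Real.sqrt_sq hS.le]
  have e2 : √N = S * σ := by rw [hNS, Real.sqrt_sq (by positivity)]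
  have e3 : √(N / M) = σ := by rw [← hσM, Real.sqrt_sq hσ]
  have e4 : √(N * L' / M) = σ * t := by
    rw [mul_div_right_comm, ← hσM, ← htL, ← mul_pow, Real.sqrt_sq (by positivity)]
  have hσ1 : 0.942 ≤ σ := by
    have : 8 / 9 ≤ σ ^ 2 := by rw [hσM, le_div_iff₀ hM0]; exact hN
    nlinarith
  have hS1 : 15 ≤ S := by nlinarith
  -- 0.11786 is just above 1/√72.
  have hst : t ≤ 0.11786 * S := by
    have : t ^ 2 ≤ (0.11786 * S) ^ 2 := by nlinarith
    exact (abs_le_of_sq_le_sq' this (by positivity)).2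
  have h72 : 8.485 ≤ √72 := Real.le_sqrt_of_sq_le (by norm_num)
  have hs3 : 2 / √3 ≤ 1.15471 := by
    have : 1.73205 ≤ √3 := Real.le_sqrt_of_sq_le (by norm_num)
    rw [div_le_iff₀ (by positivity)]
    linarith
  rw [e3] at h1
  rw [e1, e2] at h3
  obtain ⟨τ, hτ0, hτ1, hττ, hτσ⟩ := exists_contraction_factor hσ1
  have hZ1 : 16.97 * L' * σ ≤ Z := by
    refine le_trans ?_ h1
    have : 0 ≤ L' * σ := mul_nonneg (by linarith) hσ
    nlinarith
  have h6 := le_mul_of_sq_le hL hL' hτ0 hτ1 hττ hσ hZ1 hℓ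
  have h7 : S * σ * (σ + 4) ≤ Z := by
    refine le_trans (le_of_eq ?_) h3
    rw [hNS]; field_simp
  have h8 : S * σ * (0.926 * σ + 0.356) ≤ (1 - τ) * Z := by
    refine le_trans (le_of_eq ?_) (mul_le_mul_of_nonneg_left h7 (by linarith : 0 ≤ 1 - τ))
    have : (1 - τ) * (S * σ * (σ + 4)) = S * σ * ((σ + 4) - τ * (σ + 4)) := by ring
    rw [this, hτσ]; ring
  have h9 : N * (√(2 / Real.pi) / (√M * (1 - 1 / M))) ≤ S * σ ^ 2 * 0.80145 := by
    have ha : 226 / 227 ≤ 1 - 1 / M := by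
      have : 1 / M ≤ 1 / 227 := one_div_le_one_div_of_le (by norm_num) hM
      linarith
    have hb : √(2 / Real.pi) / (1 - 1 / M) ≤ 0.80145 := by
      rw [div_le_iff₀ (by linarith)]
      linarith [sqrt_two_div_pi_bounds.2]
    have hc : N * (√(2 / Real.pi) / (√M * (1 - 1 / M))) =
        S * σ ^ 2 * (√(2 / Real.pi) / (1 - 1 / M)) := by
      rw [e1, hNS, div_mul_eq_div_div]
      field_simp
    rw [hc]
    exact mul_le_mul_of_nonneg_left hb (by positivity)
  have h10 : N * (√(2 / Real.pi) / (√M * (1 - 1 / M))) + 2 * √(N * L' / M) ≤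
      S * σ * (0.80145 * σ + 0.23572) := by
    rw [e4]
    have := mul_le_mul_of_nonneg_left hst hσ
    linarith
  have h11 : 2 / √3 * (N * (√(2 / Real.pi) / (√M * (1 - 1 / M))) + 2 * √(N * L' / M)) ≤
      1.15471 * (S * σ * (0.80145 * σ + 0.23572)) :=
    (mul_le_mul_of_nonneg_left h10 (by positivity)).trans
      (mul_le_mul_of_nonneg_right hs3 (by positivity))
  have h12 : 15 * 0.942 ≤ S * σ := mul_le_mul hS1 hσ1 (by norm_num) hS.le
  have h13 : 0 ≤ S * σ * σ := by positivity
  linarith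

/-- The self-bound for the deviation of the permeance. -/
lemma deviation_sq_le {ρ n d L : ℝ} (hρ0 : 0 ≤ ρ) (hρ : ρ ≤ 1) (hn : 0 ≤ n) (hd : 2 ≤ d)
    (hL : 0 ≤ L) {Z : ℝ} (hZ0 : 0 ≤ Z) (hZ : Z = ρ * (√(2 / Real.pi) * (n / √d) - 2 * √n)) :
    (ρ * (2 * √(2 * n * L / d))) ^ 2 ≤
      7.0904 * L * Z + 7.0904 * √L * (ρ * (2 * √(2 * n * L / d))) := by
  obtain ⟨hq, -⟩ := sqrt_two_div_pi_bounds
  have hs2 : 1.41421 ≤ √2 := Real.le_sqrt_of_sq_le (by norm_num)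
  have hq0 : 0 < √(2 / Real.pi) := by linarith
  set q := √(2 / Real.pi) with hqdef
  set e := √d with he
  have hee : √2 ≤ e := Real.sqrt_le_sqrt hd
  have he0 : 0 < e := by linarith
  have hed : d = e ^ 2 := (Real.sq_sqrt (by linarith)).symm
  set s := √L with hs
  set x := √n with hx
  have hx0 : 0 ≤ x := Real.sqrt_nonneg _
  have hs0 : 0 ≤ s := Real.sqrt_nonneg _
  have hsL : L = s ^ 2 := (Real.sq_sqrt hL).symm
  have hxn : n = x ^ 2 := (Real.sq_sqrt hn).symm
  have e1 : √(2 * n * L / d) = √2 * x * s / e := by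
    rw [Real.sqrt_div (by positivity), Real.sqrt_mul (by positivity), Real.sqrt_mul (by norm_num)]
  have h22 : √2 ^ 2 = 2 := Real.sq_sqrt (by norm_num)
  rw [e1]
  -- An exact identity: the product with Z produces the square up to the contribution of -2√n, which
  -- the term linear in the deviation restores.
  have h1 : (ρ * (2 * (√2 * x * s / e))) ^ 2 =
      8 * ρ / (q * e) * s ^ 2 * Z + 8 * ρ / (q * √2) * s * (ρ * (2 * (√2 * x * s / e))) := by
    rw [hZ, hxn]
    field_simp
    rw [h22]
    ring
  -- 7.0904 is just above 8/(0.79788·1.41421), and ρ ≤ 1; the next bound also uses d ≥ 2.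
  have h2 : 8 * ρ / (q * √2) ≤ 7.0904 := by
    rw [div_le_iff₀ (by positivity)]
    have : 0.79788 * 1.41421 ≤ q * √2 := by gcongr
    linarith
  have h3 : 8 * ρ / (q * e) ≤ 7.0904 := by
    rw [div_le_iff₀ (by positivity)]
    have : 0.79788 * 1.41421 ≤ q * e := by gcongr; exact hs2.trans hee
    linarith
  rw [h1, hsL]
  have h4 : 0 ≤ s * (ρ * (2 * (√2 * x * s / e))) := by positivity
  have h5 := mul_le_mul_of_nonneg_right h2 h4
  have h6 := mul_le_mul_of_nonneg_right h3 (mul_nonneg (sq_nonneg s) hZ0)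
  linarith

/-- The square of the maximum dominates the square of each entry; 9 = 3² and 72 = 9·8. -/
lemma nine_mul_le_cDelta_mul {M r no : ℕ} {δ : ℝ} (hr : 0 < r) :
    9 * (r : ℝ) ≤ cDelta M r no δ * r ∧
    72 * Real.pi * (M / ((M : ℝ) - 1)) ≤ cDelta M r no δ * r ∧
    72 * Real.log (no / δ) * (M / ((M : ℝ) - 1)) ≤ cDelta M r no δ * r := by
  have hr' : (0 : ℝ) < r := by exact_mod_cast hr
  set a := 8 * M * Real.pi / (((M : ℝ) - 1) * r) with ha
  set b := 8 * M * Real.log (no / δ) / (((M : ℝ) - 1) * r) with hb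
  have hc : cDelta M r no δ = 9 * max 1 (max √a √b) ^ 2 := by rw [cDelta]; ring
  have key : ∀ y : ℝ, √y ≤ max 1 (max √a √b) → y ≤ max 1 (max √a √b) ^ 2 := fun y hy =>
    Real.sqrt_le_iff.1 hy |>.2
  rw [hc]
  refine ⟨?_, ?_, ?_⟩
  · have h := key 1 (by simp)
    gcongr
    linarith
  · have h := key a (by simp)
    calc 72 * Real.pi * (M / ((M : ℝ) - 1)) = 9 * a * r := by
          rw [ha, ← div_div]; field_simp; ring
      _ ≤ _ := by gcongr
  · have h := key b (by simp)
    calc 72 * Real.log (no / δ) * (M / ((M : ℝ) - 1)) = 9 * b * r := by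
          rw [hb, ← div_div]; field_simp; ring
      _ ≤ _ := by gcongr

/-- Consequences of the size assumption on the ambient dimension. -/
lemma bounds_of_cDelta_mul_lt {M r no : ℕ} {δ : ℝ} (hr : 0 < r) (hno : 1 ≤ no) (hδ0 : 0 < δ)
    (hδ1 : δ < 1) (hM : cDelta M r no δ * r < M) :
    9 * r < M ∧ (227 : ℝ) ≤ M ∧ 72 * Real.log (no / δ) ≤ M ∧
      72 * Real.log (no / δ) ≤ cDelta M r no δ * r ∧ 0 ≤ Real.log (no / δ) := by
  obtain ⟨h1, h2, h3⟩ := nine_mul_le_cDelta_mul (M := M) (no := no) (δ := δ) hr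
  have h4 : (9 * r : ℝ) < M := h1.trans_lt hM
  have h4' : 9 * r < M := by exact_mod_cast h4
  have hr1 : (1 : ℝ) ≤ r := by exact_mod_cast hr
  have hM1 : (0 : ℝ) < (M : ℝ) - 1 := by linarith
  have hM2 : 1 ≤ (M : ℝ) / ((M : ℝ) - 1) := by rw [one_le_div hM1]; linarith
  have hlog : 0 ≤ Real.log (no / δ) := by
    refine Real.log_nonneg ?_
    rw [one_le_div hδ0]
    have : (1 : ℝ) ≤ no := by exact_mod_cast hno
    linarith
  have h5 : 72 * Real.log (no / δ) ≤ cDelta M r no δ * r :=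
    le_trans (le_mul_of_one_le_right (by positivity) hM2) h3
  refine ⟨h4', ?_, h5.trans hM.le, h5, hlog⟩
  -- Keeping the factor M/(M - 1) gives M > 72π + 1 > 227.
  have h6 : 72 * Real.pi * (M / ((M : ℝ) - 1)) < M := h2.trans_lt hM
  rw [← mul_div_assoc, div_lt_iff₀ hM1] at h6
  have h7 : 72 * Real.pi < (M : ℝ) - 1 := by
    have hMp : (0 : ℝ) < M := by linarith
    nlinarith
  linarith [Real.pi_gt_d6]

/-- The sufficient conditions imply lower bounds on `𝒜`. -/
lemma bounds_of_sufficientConditions {𝒜 χ δ : ℝ} {M r no nz : ℕ} (hM : 0 < M)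
    (hcr : 72 * Real.log (no / δ) ≤ cDelta M r no δ * r) (hL : 0 ≤ Real.log (no / δ)) (hχ : 1 ≤ χ)
    (h : SufficientConditions 𝒜 M r no nz χ δ) :
    2 * √72 * Real.log (no / δ) * √(no / M) ≤ 𝒜 ∧ no / √(M : ℝ) + 4 * √(no : ℝ) ≤ 𝒜 := by
  obtain ⟨h1, -, h3⟩ := h
  have hM' : (0 : ℝ) < M := by exact_mod_cast hM
  set L := Real.log (no / δ)
  constructor
  · have h4 : √72 * L * √(no / M) ≤ √(no * cDelta M r no δ * r * L / M) := by
      refine Real.le_sqrt_of_sq_le ?_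
      rw [mul_pow, mul_pow, Real.sq_sqrt (by norm_num), Real.sq_sqrt (by positivity)]
      have h5 : 72 * L * (L * (no / M)) ≤ cDelta M r no δ * r * (L * (no / M)) :=
        mul_le_mul_of_nonneg_right hcr (by positivity)
      calc 72 * L ^ 2 * (no / M) = 72 * L * (L * (no / M)) := by ring
        _ ≤ _ := h5
        _ = _ := by ring
    have h6 : 0 ≤ 2 * (nz : ℝ) * √(cDelta M r no δ * r / M) := by positivity
    linarith
  · have h4 : no / √(M : ℝ) ≤ χ * (no / √(M : ℝ)) := le_mul_of_one_le_left (by positivity) hχ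
    have h5 : 1 ≤ √χ := Real.one_le_sqrt.2 hχ
    have h6 : 2 * √(no : ℝ) * 2 ≤ 2 * √(no : ℝ) * (1 + √χ) := by gcongr; linarith
    have h7 : 0 ≤ 2 * √(2 * χ * no * Real.log (1 / δ) / ((M : ℝ) - 1)) := by positivity
    linarith

end Numerics

/-! ### Deterministic separation in the two regimes -/

section Deterministic

variable {M m no : ℕ} {n : Fin m → ℕ}

lemma l1_col (D : Col no n → Amb M) (c : Amb M) :
    l1 D c = (∑ j, |inner ℝ c (D (Sum.inl j))|) + ∑ k, l1 (fun i => D (Sum.inr ⟨k, i⟩)) c := by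
  simp only [l1]
  rw [Fintype.sum_sum_type, Fintype.sum_sigma]

lemma norm_sq_eq_norm_starProjection_add (W : Submodule ℝ (Amb M)) (b : Amb M) :
    ‖b‖ ^ 2 = ‖W.starProjection b‖ ^ 2 + ‖Wᗮ.starProjection b‖ ^ 2 := by
  have h : W.starProjection b + Wᗮ.starProjection b = b := by simp
  have h0 : inner ℝ (W.starProjection b) (Wᗮ.starProjection b) = 0 :=
    Submodule.inner_right_of_mem_orthogonal (W.starProjection_apply_mem b)
      (Wᗮ.starProjection_apply_mem b)
  nth_rewrite 1 [← h]
  rw [sq, sq, sq, norm_add_sq_eq_norm_sq_add_norm_sq_of_inner_eq_zero _ _ h0]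

/-- A feasible direction for an outlier that is orthogonal to all inliers. -/
lemma exists_direction_orthogonal {D : Col no n → Amb M} {W : Submodule ℝ (Amb M)}
    (hmem : ∀ i, D (Sum.inr i) ∈ W) (j : Fin no) (hj : Wᗮ.starProjection (D (Sum.inl j)) ≠ 0) :
    ∃ c, inner ℝ c (D (Sum.inl j)) = 1 ∧
      l1 D c = 1 + (‖Wᗮ.starProjection (D (Sum.inl j))‖ ^ 2)⁻¹ *
        ∑ i ∈ Finset.univ.erase j,
          |inner ℝ (Wᗮ.starProjection (D (Sum.inl j))) (D (Sum.inl i))| := by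
  set x := Wᗮ.starProjection (D (Sum.inl j)) with hx
  have hx0 : 0 < ‖x‖ ^ 2 := by have := norm_pos_iff.2 hj; positivity
  have hxb : inner ℝ x (D (Sum.inl j)) = ‖x‖ ^ 2 := by
    rw [hx, Submodule.inner_starProjection_left_eq_right, ← real_inner_self_eq_norm_sq,
      Submodule.inner_starProjection_left_eq_right,
      Submodule.starProjection_eq_self_iff.2 (Wᗮ.starProjection_apply_mem _)]
  have hc : inner ℝ ((‖x‖ ^ 2)⁻¹ • x) (D (Sum.inl j)) = 1 := by
    rw [real_inner_smul_left, hxb, inv_mul_cancel₀ hx0.ne']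
  refine ⟨(‖x‖ ^ 2)⁻¹ • x, hc, ?_⟩
  rw [l1_col, ← Finset.add_sum_erase _ _ (Finset.mem_univ j), hc, abs_one, Finset.mul_sum]
  have h0 : ∑ k, l1 (fun i => D (Sum.inr ⟨k, i⟩)) ((‖x‖ ^ 2)⁻¹ • x) = 0 := by
    refine Finset.sum_eq_zero fun k _ => Finset.sum_eq_zero fun i _ => ?_
    rw [real_inner_smul_left, Submodule.inner_left_of_mem_orthogonal (hmem _)
      (Wᗮ.starProjection_apply_mem _), mul_zero, abs_zero]
  rw [h0, add_zero]
  congr 1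
  refine Finset.sum_congr rfl fun i _ => ?_
  rw [real_inner_smul_left, abs_mul, abs_of_pos (inv_pos.2 hx0)]

lemma span_inliers_le_iSup {U : Fin m → Submodule ℝ (Amb M)} {D : Col no n → Amb M}
    (hmem : ∀ k i, D (Sum.inr ⟨k, i⟩) ∈ U k) (i : Σ k : Fin m, Fin (n k)) :
    D (Sum.inr i) ∈ ⨆ k, U k :=
  le_iSup U i.1 (hmem i.1 i.2)

/-- Few outliers in general position: their Innovation Value is at least one. -/
lemma innovationValue_lt_and_recoversExactly_of_generic {U : Fin m → Submodule ℝ (Amb M)}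
    {D : Col no n → Amb M} {c : Col no n → Amb M} (hc : ∀ i, IsOptimalDirection D (D i) (c i))
    {r : ℕ} (hr : Module.finrank ℝ (⨆ k, U k : Submodule ℝ (Amb M)) = r)
    (hn : ∀ k, 0 < n k) (hmem : ∀ k i, D (Sum.inr ⟨k, i⟩) ∈ U k)
    (hout : ∀ j, D (Sum.inl j) ∉ (⨆ k, U k) ⊔
      Submodule.span ℝ ((fun i => D (Sum.inl i)) '' {i | i ≠ j}))
    (hspan : ∀ k (i : Fin (n k)), U k ≤
      Submodule.span ℝ ((fun i' => D (Sum.inr ⟨k, i'⟩)) '' {i' | i' ≠ i})) :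
    (∀ (i : Σ k : Fin m, Fin (n k)) (j : Fin no),
      innovationValue D (c (Sum.inr i)) < innovationValue D (c (Sum.inl j))) ∧
    RecoversExactly D (fun i => innovationValue D (c i)) r (⨆ k, U k) := by
  refine innovationValue_lt_and_recoversExactly hc 1 ?_ ?_ (span_inliers_le_iSup hmem) ?_ hr
  · intro j
    set W := (⨆ k, U k) ⊔ Submodule.span ℝ ((fun i => D (Sum.inl i)) '' {i | i ≠ j}) with hW
    have hx : Wᗮ.starProjection (D (Sum.inl j)) ≠ 0 := by
      rw [Ne, Submodule.starProjection_apply_eq_zero_iff, Submodule.orthogonal_orthogonal]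
      exact hout j
    obtain ⟨c', h1, h2⟩ := exists_direction_orthogonal (D := D) (W := W)
      (fun i => le_sup_left (a := ⨆ k, U k) (span_inliers_le_iSup hmem i)) j hx
    refine ⟨c', h1, h2.le.trans ?_⟩
    rw [Finset.sum_eq_zero, mul_zero, add_zero]
    intro i hi
    rw [abs_eq_zero]
    refine Submodule.inner_left_of_mem_orthogonal ?_ (Wᗮ.starProjection_apply_mem _)
    exact le_sup_right (a := ⨆ k, U k) (Submodule.subset_span ⟨i, Finset.ne_of_mem_erase hi, rfl⟩)
  · rintro ⟨k, i⟩ c' h1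
    by_contra! h2
    -- The inlier itself contributes 1, so a value of at most 1 leaves nothing for the other
    -- columns.
    have h3 : ∀ i', i' ≠ i → inner ℝ c' (D (Sum.inr ⟨k, i'⟩)) = 0 := by
      intro i' hi'
      have h4 : ∑ z ∈ ({Sum.inr ⟨k, i⟩, Sum.inr ⟨k, i'⟩} : Finset (Col no n)),
          |inner ℝ c' (D z)| ≤ l1 D c' :=
        Finset.sum_le_sum_of_subset_of_nonneg (Finset.subset_univ _) fun _ _ _ => abs_nonneg _
      rw [Finset.sum_pair (by simpa using hi'.symm), h1, abs_one] at h4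
      exact abs_eq_zero.1 (le_antisymm (by linarith) (abs_nonneg _))
    have h5 : Submodule.span ℝ ((fun i' => D (Sum.inr ⟨k, i'⟩)) '' {i' | i' ≠ i}) ≤
        (Submodule.span ℝ {c'})ᗮ := by
      rw [Submodule.span_le]
      rintro _ ⟨i', hi', rfl⟩
      exact Submodule.mem_orthogonal_singleton_iff_inner_right.2 (h3 i' hi')
    have h6 := Submodule.mem_orthogonal_singleton_iff_inner_right.1 (h5 (hspan k i (hmem k i)))
    rw [h6] at h1
    exact zero_ne_one h1
  · refine iSup_le fun k => (hspan k ⟨0, hn k⟩).trans (Submodule.span_mono ?_)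
    rintro _ ⟨i, -, rfl⟩
    exact ⟨⟨k, i⟩, rfl⟩

/-- Outliers that are incoherent with each other and with `𝒰` have large Innovation Values. -/
lemma innovationValue_lt_and_recoversExactly_of_incoherent {U : Fin m → Submodule ℝ (Amb M)}
    {D : Col no n → Amb M} {c : Col no n → Amb M} (hc : ∀ i, IsOptimalDirection D (D i) (c i))
    {r : ℕ} (hr : Module.finrank ℝ (⨆ k, U k : Submodule ℝ (Amb M)) = r)
    (hmem : ∀ k i, D (Sum.inr ⟨k, i⟩) ∈ U k) (hnorm : ∀ i, ‖D i‖ = 1) {T p : ℝ} (hT : 0 ≤ T)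
    (hproj : ∀ j, ‖(⨆ k, U k).starProjection (D (Sum.inl j))‖ ≤ 1 / 2)
    (hsum : ∀ j, (⨆ k, U k)ᗮ.starProjection (D (Sum.inl j)) ≠ 0 →
      ∑ i ∈ Finset.univ.erase j,
        |inner ℝ ((⨆ k, U k)ᗮ.starProjection (D (Sum.inl j))) (D (Sum.inl i))| ≤
          ‖(⨆ k, U k)ᗮ.starProjection (D (Sum.inl j))‖ * T) (hp : 0 ≤ p)
    (hperm : ∀ k, p ≤ permeance (U k) fun i => D (Sum.inr ⟨k, i⟩))
    (hlt : 1 + 2 / √3 * T < rho U * p) :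
    (∀ (i : Σ k : Fin m, Fin (n k)) (j : Fin no),
      innovationValue D (c (Sum.inr i)) < innovationValue D (c (Sum.inl j))) ∧
    RecoversExactly D (fun i => innovationValue D (c i)) r (⨆ k, U k) := by
  have hT' : 0 ≤ 2 / √3 * T := by positivity
  refine innovationValue_lt_and_recoversExactly hc (1 + 2 / √3 * T) ?_ ?_
    (span_inliers_le_iSup hmem) ?_ hr
  · intro j
    set x := (⨆ k, U k)ᗮ.starProjection (D (Sum.inl j)) with hx
    have h1 := norm_sq_eq_norm_starProjection_add (⨆ k, U k) (D (Sum.inl j))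
    rw [hnorm, ← hx] at h1
    -- Pythagoras: ‖x‖² ≥ 1 - 1/4.
    have h2 : √3 / 2 ≤ ‖x‖ := by
      refine abs_le_of_sq_le_sq' (b := ‖x‖) ?_ (norm_nonneg _) |>.2
      rw [div_pow, Real.sq_sqrt (by norm_num)]
      nlinarith [hproj j, norm_nonneg ((⨆ k, U k).starProjection (D (Sum.inl j)))]
    have h3 : 0 < ‖x‖ := lt_of_lt_of_le (by positivity) h2
    have hx0 : x ≠ 0 := norm_pos_iff.1 h3
    obtain ⟨c', h4, h5⟩ := exists_direction_orthogonal (span_inliers_le_iSup hmem) j hx0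
    refine ⟨c', h4, h5.le.trans ?_⟩
    rw [← hx]
    refine add_le_add_right ?_ 1
    calc (‖x‖ ^ 2)⁻¹ * _ ≤ (‖x‖ ^ 2)⁻¹ * (‖x‖ * T) :=
          mul_le_mul_of_nonneg_left (hsum j hx0) (by positivity)
      _ = ‖x‖⁻¹ * T := by field_simp
      _ ≤ (√3 / 2)⁻¹ * T := by gcongr
      _ = 2 / √3 * T := by rw [inv_div]
  · intro i c' h1
    have h2 := rho_mul_mul_norm_le_l1 (A := fun k i => D (Sum.inr ⟨k, i⟩)) hmem hp hperm c'
    have h3 : 1 ≤ ‖(⨆ k, U k).starProjection c'‖ := by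
      have h4 := real_inner_le_norm ((⨆ k, U k).starProjection c') (D (Sum.inr i))
      rwa [Submodule.inner_starProjection_left_eq_right,
        Submodule.starProjection_eq_self_iff.2 (span_inliers_le_iSup hmem i), h1, hnorm,
        mul_one] at h4
    have h5 : ∑ k, l1 (fun i => D (Sum.inr ⟨k, i⟩)) c' ≤ l1 D c' := by
      rw [l1_col]
      exact le_add_of_nonneg_left (Finset.sum_nonneg fun _ _ => abs_nonneg _)
    have h6 : rho U * p ≤ rho U * p * ‖(⨆ k, U k).starProjection c'‖ :=
      le_mul_of_one_le_right (mul_nonneg (rho_nonneg U) hp) h3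
    linarith
  -- Otherwise a unit vector of 𝒰 is orthogonal to all inliers, contradicting ρp > 0.
  · by_contra hne
    obtain ⟨u, hu, hu1, horth⟩ := exists_unit_orthogonal (Submodule.span_le.2 (by
      rintro _ ⟨i, rfl⟩
      exact span_inliers_le_iSup hmem i)) hne
    have h2 := rho_mul_mul_norm_le_l1 (A := fun k i => D (Sum.inr ⟨k, i⟩)) hmem hp hperm u
    rw [Submodule.starProjection_eq_self_iff.2 hu, hu1, Finset.sum_eq_zero] at h2
    · linarith
    · intro k _
      refine Finset.sum_eq_zero fun i _ => ?_
      rw [horth _ (Submodule.subset_span ⟨⟨k, i⟩, rfl⟩), abs_zero]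

lemma abs_inner_eq_one_of_finrank_eq_one {V : Submodule ℝ (Amb M)} (hV : Module.finrank ℝ V = 1)
    {u a : Amb M} (hu : u ∈ V) (hu1 : ‖u‖ = 1) (ha : a ∈ V) (ha1 : ‖a‖ = 1) :
    |inner ℝ u a| = 1 := by
  have hu0 : (⟨u, hu⟩ : V) ≠ 0 := by
    intro h
    have : u = 0 := congrArg Subtype.val h
    simp [this] at hu1
  obtain ⟨t, ht⟩ := (finrank_eq_one_iff_of_nonzero' _ hu0).1 hV ⟨a, ha⟩
  have ht' : t • u = a := congrArg Subtype.val ht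
  rw [← ht', norm_smul, hu1, mul_one, Real.norm_eq_abs] at ha1
  rw [← ht', real_inner_smul_right, real_inner_self_eq_norm_sq, hu1, one_pow, mul_one, ha1]

/-- The permeance of a one-dimensional cluster. -/
lemma card_le_permeance {V : Submodule ℝ (Amb M)} (hV : Module.finrank ℝ V = 1) {N : ℕ}
    {A : Fin N → Amb M} (hA : ∀ i, A i ∈ V ∧ ‖A i‖ = 1) : N ≤ permeance V A := by
  have hV0 : V ≠ ⊥ := by
    rintro rfl
    simp at hV
  obtain ⟨v, hv, hv0⟩ := V.ne_bot_iff.1 hV0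
  have : Nonempty {δ : Amb M // δ ∈ V ∧ ‖δ‖ = 1} :=
    ⟨⟨‖v‖⁻¹ • v, V.smul_mem _ hv, by simp [norm_smul, hv0]⟩⟩
  refine le_ciInf fun u => le_of_eq ?_
  rw [l1, Finset.sum_congr rfl fun i _ =>
    abs_inner_eq_one_of_finrank_eq_one hV u.2.1 u.2.2 (hA i).1 (hA i).2]
  simp

/-- Cauchy-Schwarz applied to the constraint, with a unit column. -/
lemma one_le_chi {D c : Col no n → Amb M} (hno : 0 < no) (hD : ∀ j, ‖D (Sum.inl j)‖ = 1)
    (hc : ∀ i, IsOptimalDirection D (D i) (c i)) : 1 ≤ chi c := by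
  have h := real_inner_le_norm (c (Sum.inl ⟨0, hno⟩)) (D (Sum.inl ⟨0, hno⟩))
  rw [(hc _).1, hD, mul_one] at h
  exact h.trans (le_ciSup (f := fun j : Fin no => ‖c (Sum.inl j)‖)
    (Set.finite_range _).bddAbove ⟨0, hno⟩)

lemma card_le_finrank_iSup {U : Fin m → Submodule ℝ (Amb M)} (hU : iSupIndep U)
    (h : ∀ k, U k ≠ ⊥) : m ≤ Module.finrank ℝ (⨆ k, U k : Submodule ℝ (Amb M)) := by
  choose v hv hv0 using fun k => (U k).ne_bot_iff.1 (h k)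
  have hli := hU.linearIndependent U hv hv0
  have h1 := finrank_span_eq_card hli
  rw [Fintype.card_fin] at h1
  refine h1.symm.le.trans (Submodule.finrank_mono (Submodule.span_le.2 ?_))
  rintro _ ⟨k, rfl⟩
  exact le_iSup U k (hv k)

end Deterministic

/-! ### The margin when outliers are many -/

section Margin

variable {M m : ℕ}

/-- The margin between outliers and inliers when the outliers are many. -/
lemma one_add_lt_rho_mul {U : Fin m → Submodule ℝ (Amb M)} {r d no nz n : ℕ} {χ δ p : ℝ}
    (hr : 0 < r) (hno : 1 ≤ no) (hδ0 : 0 < δ) (hδ1 : δ < 1) (hM : cDelta M r no δ * r < M)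
    (hd : 1 ≤ d) (hm0 : 0 < m) (hmr : m ≤ r) (hMr : M < no + r) (hρ : rho U ≤ 1) (hχ : 1 ≤ χ)
    (h : SufficientConditions (calA (rho U) d r n δ) M r no nz χ δ)
    (hp1 : d = 1 → n ≤ p)
    (hp2 : 2 ≤ d → √(2 / Real.pi) * (n / √(d : ℝ)) - 2 * √(n : ℝ) -
      2 * √(2 * n * Real.log (m / δ) / d) ≤ p) :
    1 + 2 / √3 * (no * (√(2 / Real.pi) / (√M * (1 - 1 / M))) +
      2 * √(no * Real.log (no / δ) / M)) < rho U * p := by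
  obtain ⟨h9, hM227, hLM, hcr, hL⟩ := bounds_of_cDelta_mul_lt hr hno hδ0 hδ1 hM
  have hM0 : 0 < M := by omega
  obtain ⟨h1, h3⟩ := bounds_of_sufficientConditions hM0 hcr hL hχ h
  have hρ0 := rho_nonneg U
  set Z := rho U * (√(2 / Real.pi) * (n / √(d : ℝ)) - 2 * √(n : ℝ)) with hZ
  have hAZ : calA (rho U) d r n δ ≤ Z := by
    rw [calA, hZ]
    exact mul_le_mul_of_nonneg_left (sub_le_self _ (Real.sqrt_nonneg _)) hρ0
  have hZ0 : 0 ≤ Z := le_trans (by positivity) (h3.trans hAZ)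
  have hNM : 8 / 9 * (M : ℝ) ≤ no := by
    have : 8 * M ≤ 9 * no := by omega
    have : (8 : ℝ) * M ≤ 9 * no := by exact_mod_cast this
    linarith
  have hm1 : (1 : ℝ) ≤ m := by exact_mod_cast hm0
  have hLm : 0 ≤ Real.log (m / δ) := by
    refine Real.log_nonneg ?_
    rw [one_le_div hδ0]
    linarith
  -- From 9r < M < n_o + r follows 8m ≤ 8r < n_o, and e ≤ 8.
  have hLm' : Real.log (m / δ) + 1 ≤ Real.log (no / δ) := by
    have h8 : (8 : ℝ) * m ≤ no := by exact_mod_cast (by omega : 8 * m ≤ no)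
    have he : Real.exp 1 ≤ 8 := by linarith [Real.exp_one_lt_d9]
    rw [← Real.exp_le_exp, Real.exp_add, Real.exp_log (by positivity),
      Real.exp_log (by have : (1 : ℝ) ≤ no := by exact_mod_cast hno
                       positivity), div_mul_eq_mul_div]
    refine div_le_div_of_nonneg_right ?_ hδ0.le
    nlinarith
  have key : ∀ ℓ, ℓ ^ 2 ≤ 7.0904 * Real.log (m / δ) * Z + 7.0904 * √(Real.log (m / δ)) * ℓ →
      Z - ℓ ≤ rho U * p → _ := fun ℓ hℓ hle =>
    (outlier_bound_lt hM227 hNM hLM hLm hLm' (h1.trans hAZ) (h3.trans hAZ) hℓ).trans_le hle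
  -- In dimension one the permeance is at least n, with no deviation to absorb; `deviation_sq_le`
  -- requires d ≥ 2.
  rcases hd.eq_or_lt with hd1 | hd2
  · refine key 0 (by rw [mul_zero, add_zero, zero_pow two_ne_zero]; positivity) ?_
    rw [sub_zero, hZ]
    refine mul_le_mul_of_nonneg_left (le_trans ?_ (hp1 hd1.symm)) hρ0
    rw [← hd1]
    have hq := sqrt_two_div_pi_bounds.2
    have : √(2 / Real.pi) * n ≤ 1 * n :=
      mul_le_mul_of_nonneg_right (by linarith) (Nat.cast_nonneg n)
    simp only [Nat.cast_one, Real.sqrt_one, div_one]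
    linarith [Real.sqrt_nonneg (n : ℝ)]
  · refine key _ (deviation_sq_le hρ0 hρ (Nat.cast_nonneg n) (by exact_mod_cast hd2) hLm hZ0 hZ) ?_
    rw [hZ, ← mul_sub]
    exact mul_le_mul_of_nonneg_left (hp2 hd2) hρ0

end Margin

/-! ### Union bounds and assembly -/

section Assembly

variable {Ω : Type*} [MeasurableSpace Ω] {μ : Measure Ω}

/-- At level log(N/δ) each of the N events costs δ/N. -/
lemma measure_iUnion_le_of_eexp {N : ℕ} {δ : ℝ} (hδ : 0 < δ) {s : Fin N → Set Ω}
    (hs : ∀ i, μ (s i) ≤ eexp (-Real.log (N / δ))) : μ (⋃ i, s i) ≤ ENNReal.ofReal δ := by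
  rcases N.eq_zero_or_pos with rfl | hN
  · simp
  have hN' : (0 : ℝ) < N := by exact_mod_cast hN
  calc μ (⋃ i, s i) ≤ ∑ i, μ (s i) := measure_iUnion_fintype_le _ _
    _ ≤ ∑ _ : Fin N, eexp (-Real.log (N / δ)) := Finset.sum_le_sum fun i _ => hs i
    _ = ENNReal.ofReal δ := by
      rw [Finset.sum_const, Finset.card_univ, Fintype.card_fin, nsmul_eq_mul, eexp,
        ← ENNReal.ofReal_natCast, ← ENNReal.ofReal_mul hN'.le, ← Real.log_inv,
        Real.exp_log (by positivity), inv_div, mul_div_cancel₀ _ hN'.ne']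

variable {M r m d no : ℕ} {n : Fin m → ℕ} {δ : ℝ} {U : Fin m → Submodule ℝ (Amb M)}
  {D : Col no n → Ω → Amb M}

lemma ae_mem_and_norm_eq_one {X : Ω → Amb M} {V : Submodule ℝ (Amb M)}
    (h : HasLaw X (uniformSphereIn V) μ) : ∀ᵐ ω ∂μ, X ω ∈ V ∧ ‖X ω‖ = 1 :=
  ae_of_ae_map h.aemeasurable (h.map_eq.symm ▸ ae_uniformSphereIn)

lemma ae_norm_eq_one {X : Ω → Amb M} (h : HasLaw X (uniformSphere (Amb M)) μ) :
    ∀ᵐ ω ∂μ, ‖X ω‖ = 1 :=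
  ae_of_ae_map h.aemeasurable (h.map_eq.symm ▸ ae_norm_uniformSphere)

variable [IsProbabilityMeasure μ]

/-- The bad set need not be measurable, so the complement of its measurable hull is taken. -/
lemma exists_measurableSet_notMem {N : Set Ω} {ε : ℝ} (hε : 0 ≤ ε)
    (hN : μ N ≤ ENNReal.ofReal ε) :
    ∃ G, MeasurableSet G ∧ 1 - ε ≤ μ.real G ∧ ∀ ω ∈ G, ω ∉ N := by
  refine ⟨(toMeasurable μ N)ᶜ, (measurableSet_toMeasurable μ N).compl, ?_,
    fun ω hω hN' => hω (subset_toMeasurable μ N hN')⟩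
  rw [probReal_compl_eq_one_sub (measurableSet_toMeasurable μ N), measureReal_def,
    measure_toMeasurable]
  linarith [ENNReal.toReal_le_of_le_ofReal hε hN]

/-- 𝒰 and the n_o - 1 other outliers span at most r + n_o - 1 < M dimensions. -/
lemma ae_outlier_generic (hno : 1 ≤ no) (hMr : no + r ≤ M)
    (hUr : Module.finrank ℝ (⨆ k, U k : Submodule ℝ (Amb M)) = r)
    (hindep : iIndepFun D μ) (hm : ∀ i, AEMeasurable (D i) μ)
    (hB : ∀ j : Fin no, HasLaw (D (Sum.inl j)) (uniformSphere (Amb M)) μ) (j : Fin no) :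
    ∀ᵐ ω ∂μ, D (Sum.inl j) ω ∉ (⨆ k, U k) ⊔
      Submodule.span ℝ ((fun i => D (Sum.inl i) ω) '' {i | i ≠ j}) := by
  have h := ae_notMem_sup_span (V := ⊤) (W := ⨆ k, U k) (j := Sum.inl j)
    (S := (Finset.univ.erase j).map Function.Embedding.inl) hindep hm (by simp) (hB j)
    (fun W hW => uniformSphere_submodule_eq_zero fun h => hW h.ge) (by
      rw [Finset.card_map, Finset.card_erase_of_mem (Finset.mem_univ j), Finset.card_univ,
        Fintype.card_fin, hUr, finrank_top, finrank_euclideanSpace_fin]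
      omega)
  refine h.mono fun ω hω => ?_
  have hs : ((Finset.univ.erase j : Finset (Fin no)) : Set (Fin no)) = {i | i ≠ j} := by
    ext; simp
  rw [Finset.coe_map, Set.image_image, hs] at hω
  exact hω

/-- Omitting one inlier leaves at least d of them; this is where d < n k must be strict. -/
lemma ae_inlier_generic (hn : ∀ k, d < n k) (hd : ∀ k, Module.finrank ℝ (U k) = d)
    (hindep : iIndepFun D μ) (hm : ∀ i, AEMeasurable (D i) μ)
    (hA : ∀ (k : Fin m) (i : Fin (n k)), HasLaw (D (Sum.inr ⟨k, i⟩)) (uniformSphereIn (U k)) μ)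
    (k : Fin m) (i : Fin (n k)) :
    ∀ᵐ ω ∂μ, U k ≤ Submodule.span ℝ ((fun i' => D (Sum.inr ⟨k, i'⟩) ω) '' {i' | i' ≠ i}) := by
  have h := ae_le_span_of_card (V := U k) hindep hm
    ((Finset.univ.erase i).map ((Function.Embedding.sigmaMk k).trans Function.Embedding.inr))
    (by
      intro z hz
      obtain ⟨i', -, rfl⟩ := Finset.mem_map.1 hz
      exact hA k i') (by
      rw [Finset.card_map, Finset.card_erase_of_mem (Finset.mem_univ i), Finset.card_univ,
        Fintype.card_fin, hd]
      have := hn k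
      omega)
  refine h.mono fun ω hω => ?_
  have hs : ((Finset.univ.erase i : Finset (Fin (n k))) : Set (Fin (n k))) = {i' | i' ≠ i} := by
    ext; simp
  rw [Finset.coe_map, Set.image_image, hs] at hω
  exact hω

lemma sqrt_add_sqrt_le_half {M r L : ℝ} (hM : 0 < M) (hr : 9 * r ≤ M) (hL : 72 * L ≤ M) :
    √(r / M) + √(2 * L / M) ≤ 1 / 2 := by
  have s1 : √(r / M) ≤ 1 / 3 := by
    rw [Real.sqrt_le_left (by norm_num), div_le_iff₀ hM]
    linarith
  have s2 : √(2 * L / M) ≤ 1 / 6 := by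
    rw [Real.sqrt_le_left (by norm_num), div_le_iff₀ hM]
    linarith
  linarith

/-- The event on which the inliers permeate their subspaces, and the outliers are incoherent with
each other and with the inliers. -/
lemma exists_event_incoherent (hM2 : 2 ≤ M) (hδ0 : 0 < δ) (hn : ∀ k, d < n k) (hd1 : 1 ≤ d)
    (hd : ∀ k, Module.finrank ℝ (U k) = d) (hsup : (⨆ k, U k) ≠ ⊥)
    (hL : 0 ≤ Real.log (no / δ)) (hLm : 0 ≤ Real.log (m / δ)) (hindep : iIndepFun D μ)
    (hB : ∀ j : Fin no, HasLaw (D (Sum.inl j)) (uniformSphere (Amb M)) μ)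
    (hA : ∀ (k : Fin m) (i : Fin (n k)), HasLaw (D (Sum.inr ⟨k, i⟩)) (uniformSphereIn (U k)) μ) :
    ∃ G, MeasurableSet G ∧ 1 - 7 * δ ≤ μ.real G ∧ ∀ ω ∈ G,
      (∀ k i, D (Sum.inr ⟨k, i⟩) ω ∈ U k ∧ ‖D (Sum.inr ⟨k, i⟩) ω‖ = 1) ∧
      (∀ j, ‖D (Sum.inl j) ω‖ = 1) ∧
      (∀ j, ‖(⨆ k, U k).starProjection (D (Sum.inl j) ω)‖ ≤
        √(Module.finrank ℝ (⨆ k, U k : Submodule ℝ (Amb M)) / M) +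
          √(2 * Real.log (no / δ) / M)) ∧
      (∀ j, (⨆ k, U k)ᗮ.starProjection (D (Sum.inl j) ω) ≠ 0 →
        ∑ i ∈ Finset.univ.erase j,
          |inner ℝ ((⨆ k, U k)ᗮ.starProjection (D (Sum.inl j) ω)) (D (Sum.inl i) ω)| ≤
            ‖(⨆ k, U k)ᗮ.starProjection (D (Sum.inl j) ω)‖ *
              (no * (√(2 / Real.pi) / (√M * (1 - 1 / M))) +
                2 * √(no * Real.log (no / δ) / M))) ∧
      (∀ k, √(2 / Real.pi) * (n k / √(d : ℝ)) - 2 * √(n k : ℝ) -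
        2 * √(2 * n k * Real.log (m / δ) / d) ≤
          permeance (U k) fun i => D (Sum.inr ⟨k, i⟩) ω) := by
  have hm : ∀ i, AEMeasurable (D i) μ := by
    rintro (j | ⟨k, i⟩)
    exacts [(hB j).aemeasurable, (hA k i).aemeasurable]
  have hin := ae_all_iff.2 fun k => ae_all_iff.2 fun i => ae_mem_and_norm_eq_one (hA k i)
  have hout := ae_all_iff.2 fun j => ae_norm_eq_one (hB j)
  have e1 := measure_iUnion_le_of_eexp hδ0 fun j =>
    measure_norm_projection_sphere_ge_le hsup (hB j) hL
  have e2 := measure_iUnion_le_of_eexp hδ0 fun j =>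
    measure_sum_abs_inner_projection_ge_le hindep hm (⨆ k, U k)ᗮ hM2 Sum.inl_injective hB j hL
  have e3 := measure_iUnion_le_of_eexp hδ0 fun k =>
    measure_permeance_lt_le hindep (hd k) hd1 ((Nat.zero_le d).trans_lt (hn k))
      (f := fun i => Sum.inr ⟨k, i⟩) (Sum.inr_injective.comp sigma_mk_injective) (hA k) hLm
  have e4 := ae_iff.1 (hin.and hout)
  -- Three failure events of probability at most δ each, plus a null set: 3δ ≤ 7δ.
  obtain ⟨G, hG, hGμ, hGN⟩ := exists_measurableSet_notMem (ε := 7 * δ) (by positivity)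
    (((measure_union_le _ _).trans (add_le_add ((measure_union_le _ _).trans
      (add_le_add ((measure_union_le _ _).trans (add_le_add e1 e2)) e3)) e4.le)).trans (by
        rw [add_zero, ← ENNReal.ofReal_add hδ0.le hδ0.le,
          ← ENNReal.ofReal_add (by positivity) hδ0.le]
        exact ENNReal.ofReal_le_ofReal (by linarith)))
  refine ⟨G, hG, hGμ, fun ω hω => ?_⟩
  have hω' := hGN ω hω
  simp only [Set.mem_union, not_or, Set.mem_iUnion, not_exists, Set.mem_ofPred_eq, not_lt,
    not_not] at hω'
  obtain ⟨⟨⟨w1, w2⟩, w3⟩, w4, w5⟩ := hω'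
  exact ⟨w4, w5, fun j => (not_le.1 (w1 j)).le, fun j hj => (not_le.1 fun h => w2 j ⟨hj, h⟩).le, w3⟩

end Assembly

end ISearch

theorem theorem4 {Ω : Type*} [MeasurableSpace Ω] (μ : Measure Ω) [IsProbabilityMeasure μ]
    (M r m d no : ℕ) (n : Fin m → ℕ) (δ : ℝ)
    (hr : 2 ≤ r) (hno : 1 ≤ no) (hδ0 : 0 < δ) (hδ1 : δ < 1)
    -- each cluster has more members than the dimension of its subspace
    (hn : ∀ k, d < n k)
    -- the square root in the second sufficient condition is defined
    (hM : ISearch.cDelta M r no δ * r < M)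
    -- `𝒰 = 𝒰₁ ⊕ ⋯ ⊕ 𝒰ₘ` with `dim 𝒰ₖ = d`, `dim 𝒰 = r`
    (U : Fin m → Submodule ℝ (ISearch.Amb M))
    (hd : ∀ k, Module.finrank ℝ (U k) = d)
    (hU : iSupIndep U)
    (hUr : Module.finrank ℝ (⨆ k, U k : Submodule ℝ (ISearch.Amb M)) = r)
    -- the independent random columns of the data matrix `[B A]`
    (D : ISearch.Col no n → Ω → ISearch.Amb M)
    (hindep : iIndepFun D μ)
    (hB : ∀ j : Fin no, HasLaw (D (Sum.inl j)) (ISearch.uniformSphere (ISearch.Amb M)) μ)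
    (hA : ∀ (k : Fin m) (i : Fin (n k)),
      HasLaw (D (Sum.inr ⟨k, i⟩)) (ISearch.uniformSphereIn (U k)) μ) :
    ∃ G : Set Ω, MeasurableSet G ∧ 1 - 7 * δ ≤ μ.real G ∧
      ∀ ω ∈ G,
        -- for any choice of optimal directions and any minimizing index `g` for this data matrix
        ∀ c : ISearch.Col no n → ISearch.Amb M,
          (∀ i, ISearch.IsOptimalDirection (fun i' => D i' ω) (D i ω) (c i)) →
        ∀ g : Fin m,
          (∀ k, ISearch.permeance (U g) (fun i : Fin (n g) => D (Sum.inr ⟨g, i⟩) ω)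
            ≤ ISearch.permeance (U k) (fun i : Fin (n k) => D (Sum.inr ⟨k, i⟩) ω)) →
        ISearch.SufficientConditions (ISearch.calA (ISearch.rho U) d r (n g) δ) M r no
          (ISearch.nz (fun i => D i ω) c) (ISearch.chi c) δ →
        -- outliers have the larger Innovation Values, and `𝒰` is recovered exactly
        (∀ (i : Σ k : Fin m, Fin (n k)) (j : Fin no),
          ISearch.innovationValue (fun i' => D i' ω) (c (Sum.inr i))
            < ISearch.innovationValue (fun i' => D i' ω) (c (Sum.inl j))) ∧
        ISearch.RecoversExactly (fun i => D i ω)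
          (fun i => ISearch.innovationValue (fun i' => D i' ω) (c i)) r (⨆ k, U k) := by
  have hm : ∀ i, AEMeasurable (D i) μ := by
    rintro (j | ⟨k, i⟩)
    exacts [(hB j).aemeasurable, (hA k i).aemeasurable]
  obtain ⟨h9, hM227, hLM, -, hL⟩ :=
    ISearch.bounds_of_cDelta_mul_lt (by omega : 0 < r) hno hδ0 hδ1 hM
  have hin := ae_all_iff.2 fun k => ae_all_iff.2 fun i => ISearch.ae_mem_and_norm_eq_one (hA k i)
  have hout := ae_all_iff.2 fun j => ISearch.ae_norm_eq_one (hB j)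
  -- Few outliers: general position suffices. Many outliers: n_o is comparable to M, and the margin
  -- comes from the conditions on 𝒜.
  rcases le_or_gt (no + r) M with hMr | hMr
  · have h1 := ae_all_iff.2 fun j => ISearch.ae_outlier_generic hno hMr hUr hindep hm hB j
    have h2 := ae_all_iff.2 fun k => ae_all_iff.2 fun i =>
      ISearch.ae_inlier_generic hn hd hindep hm hA k i
    have h3 := hin.and (h1.and h2)
    obtain ⟨G, hG, hGμ, hGN⟩ := ISearch.exists_measurableSet_notMem (ε := 7 * δ) (by positivity)
      ((ae_iff.1 h3).le.trans bot_le)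
    refine ⟨G, hG, hGμ, fun ω hω c hc g hg hcond => ?_⟩
    obtain ⟨ha, hb, he⟩ := not_not.1 (hGN ω hω)
    exact ISearch.innovationValue_lt_and_recoversExactly_of_generic hc hUr
      (fun k => (Nat.zero_le d).trans_lt (hn k)) (fun k i => (ha k i).1) hb he
  · have hd1 : 1 ≤ d := by
      by_contra! h0
      have h1 : ∀ k, U k = ⊥ := fun k => by
        rw [← Submodule.finrank_eq_zero (R := ℝ), hd]; omega
      rw [show (⨆ k, U k) = ⊥ by simp [h1], finrank_bot] at hUr
      omega
    have hbot : ∀ k, U k ≠ ⊥ := fun k h => by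
      have := hd k
      rw [h, finrank_bot] at this
      omega
    have hm0 : 0 < m := by
      by_contra! h0
      obtain rfl : m = 0 := by omega
      rw [iSup_of_empty, finrank_bot] at hUr
      omega
    have hsup : (⨆ k, U k) ≠ ⊥ := fun h => by
      rw [h, finrank_bot] at hUr
      omega
    have hmr : m ≤ r := hUr ▸ ISearch.card_le_finrank_iSup hU hbot
    have hM2 : 2 ≤ M := by omega
    have hLm : 0 ≤ Real.log (m / δ) := by
      refine Real.log_nonneg ?_
      rw [one_le_div hδ0]
      have : (1 : ℝ) ≤ m := by exact_mod_cast hm0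
      linarith
    obtain ⟨G, hG, hGμ, hGN⟩ := ISearch.exists_event_incoherent hM2 hδ0 hn hd1 hd hsup hL hLm hindep
      hB hA
    refine ⟨G, hG, hGμ, fun ω hω c hc g hg hcond => ?_⟩
    obtain ⟨w4, w5, w1, w2, w3⟩ := hGN ω hω
    have hM0 : (0 : ℝ) < M := lt_of_lt_of_le (by norm_num) hM227
    have hM1 : (0 : ℝ) ≤ 1 - 1 / M := by
      rw [sub_nonneg, div_le_one hM0]
      exact le_trans (by norm_num) hM227
    have h9' : (9 : ℝ) * r ≤ M := by exact_mod_cast h9.le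
    have hhalf := ISearch.sqrt_add_sqrt_le_half hM0 h9' hLM
    rw [hUr] at w1
    have hnorm : ∀ i, ‖D i ω‖ = 1 := by
      rintro (j | ⟨k, i⟩)
      exacts [w5 j, (w4 k i).2]
    have hp1 : d = 1 → (n g : ℝ) ≤ ISearch.permeance (U g) fun i => D (Sum.inr ⟨g, i⟩) ω :=
      fun h => ISearch.card_le_permeance ((hd g).trans h) (w4 g)
    have hχ : 1 ≤ ISearch.chi c := ISearch.one_le_chi (D := fun i => D i ω) hno w5 hc
    have hlt := ISearch.one_add_lt_rho_mul (by omega) hno hδ0 hδ1 hM hd1 hm0 hmr hMr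
      (ISearch.rho_le_one hU g (hbot g)) hχ hcond hp1 fun _ => w3 g
    exact ISearch.innovationValue_lt_and_recoversExactly_of_incoherent (D := fun i => D i ω) hc hUr
      (fun k i => (w4 k i).1) hnorm (by positivity) (fun j => (w1 j).trans hhalf) w2
      (Real.iInf_nonneg fun _ => ISearch.l1_nonneg _ _) hg hlt
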